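/- Let $M$ be a smooth, compact, connected manifold without boundary, endowed with a smooth Riemannian metric with associated distance $d$. A function $H:T^*M\to\mathbb{R}$ is said to satisfy (H1)–(H3) if - (H1) $H$ is locally Lipschitz; - (H2) $p\mapsto H(x,p)$ is differentiable for every $x\in M$, and $(x,p)\mapsto H_p(x,p)\in T_xM$ is continuous; - (H3) $p\mapsto H(x,p)$ is strictly convex for every $x\in M$, and $\lim_{|p|_x\to\infty}H(x,p)/|p|_x=+\infty$ uniformly in $x$. Let $\omega:[0,\infty)\to[0,\infty)$ be nondecreasing and upper semicontinuous with $\lim_{r\to0^+}\omega(r)=0$. A function $\phi:M\to\mathbb{R}$ is called $\omega$-semiconcave if for every constant-speed minimizing geodesic $c:[0,1]\to M$, with $x=c(0)$ and $y=c(1)$, and every $\lambda\in[0,1]$, $$(1-\lambda)\phi(x)+\lambda\phi(y)-\phi(c(\lambda))\leq\lambda(1-\lambda)\,d(x,y)\,\omega(d(x,y)).$$ For $x\in M$ put $D^+\phi(x)=\{D\psi(x): r>0,\ \psi\in C^1(B_r(x)),\ \psi\geq\phi \text{ on } B_r(x),\ \psi(x)=\phi(x)\}\subset T^*_xM$, and,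 for $\phi$ $\omega$-semiconcave and $H$ satisfying (H1)–(H3), let $\mathbf{p}^\#_{\phi,H}(x)$ be the unique minimizer of $H(x,\cdot)$ on $D^+\phi(x)$. A curve $\gamma:\mathbb{R}\to M$ is a strict singular characteristic for the pair $(\phi,H)$ if it is locally absolutely continuous and $$\dot\gamma(t)=H_p\big(\gamma(t),\mathbf{p}^\#_{\phi,H}(\gamma(t))\big)\quad\text{for a.e. } t\in\mathbb{R}.$$ **Theorem (stability of strict singular characteristics).** Let $\{H_k\}$ be a sequence of Hamiltonians satisfying (H1)–(H3), let $\{\phi_k\}$ be a sequence of $\omega$-semiconcave functions on $M$ (with the same $\omega$), and for each $k\in\mathbb{N}$ let $\gamma_k:\mathbb{R}\to M$ be a strict singular characteristic for the pair $(\phi_k,H_k)$. Suppose that 1. $\phi_k$ converges to $\phi:M\to\mathbb{R}$ uniformly on $M$; 2. $H_k$ converges, uniformly on compact subsets of $T^*M$, to a Hamiltonian $H$ satisfying (H1)–(H3); 3. $\gamma_k$ converges to $\gamma:\mathbb{R}\to M$ uniformly on compact subsets of $\mathbb{R}$. Then $\phi$ is $\omega$-semiconcave and $\gamma$ is a strict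 singular characteristic for the pair $(\phi,H)$. Moreover, there is a subsequence $\{k_i\}$ such that $$\lim_{i\to\infty}\mathbf{p}^\#_{\phi_{k_i},H_{k_i}}(\gamma_{k_i}(t))=\mathbf{p}^\#_{\phi,H}(\gamma(t))\quad\text{in } T^*M,\ \text{for a.e. } t\in\mathbb{R}.$$ -/

import Mathlib

open Set Filter Topology MeasureTheory Bundle
open scoped Manifold ContDiff NNReal

noncomputable section

section Cotangent

/-- The cotangent space `T*_x M`, the (topological) dual of `T_x M`. -/
abbrev CotSpace (E : Type*) [NormedAddCommGroup E] [NormedSpace ℝ E]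
    {M : Type*} [TopologicalSpace M] [ChartedSpace E M] (x : M) : Type _ :=
  TangentSpace 𝓘(ℝ, E) x →L[ℝ] ℝ

/-- The cotangent bundle `T*M`, with the topology and the charts that Mathlib puts on the bundle
of continuous linear maps from `TM` to the trivial line bundle. -/
abbrev CotBundle (E : Type*) [NormedAddCommGroup E] [NormedSpace ℝ E]
    (M : Type*) [TopologicalSpace M] [ChartedSpace E M] : Type _ :=
  TotalSpace (E →L[ℝ] ℝ) (fun x : M => CotSpace E x)

variable {E : Type*} [NormedAddCommGroup E] [NormedSpace ℝ E] [FiniteDimensional ℝ E]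
  {M : Type*} [TopologicalSpace M] [ChartedSpace E M]

instance tangentSpace_finiteDimensional (x : M) : FiniteDimensional ℝ (TangentSpace 𝓘(ℝ, E) x) :=
  inferInstanceAs (FiniteDimensional ℝ E)

instance tangentSpace_t2Space (x : M) : T2Space (TangentSpace 𝓘(ℝ, E) x) :=
  inferInstanceAs (T2Space E)

/-- The fibre derivative `H_p(x, p)`: the differential at `p` of `H(x, ·) : T*_x M → ℝ` is a
linear form on `T*_x M`, and `H_p(x, p)` is the corresponding vector of `T_x M` under the
canonical isomorphism of `T_x M` with its bidual; see `apply_fiberDeriv`. -/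
def fiberDeriv (H : CotBundle E M → ℝ) (x : M) (p : CotSpace E x) : TangentSpace 𝓘(ℝ, E) x :=
  (Module.evalEquiv ℝ (TangentSpace 𝓘(ℝ, E) x)).symm
    ((fderiv ℝ (fun q : CotSpace E x => H ⟨x, q⟩) p).toLinearMap ∘ₗ
      (LinearMap.toContinuousLinearMap :
        (TangentSpace 𝓘(ℝ, E) x →ₗ[ℝ] ℝ) ≃ₗ[ℝ] CotSpace E x).toLinearMap)

theorem apply_fiberDeriv (H : CotBundle E M → ℝ) (x : M) (p q : CotSpace E x) :
    q (fiberDeriv H x p) = fderiv ℝ (fun q : CotSpace E x => H ⟨x, q⟩) p q := by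
  have h := LinearMap.congr_fun
    ((Module.evalEquiv ℝ (TangentSpace 𝓘(ℝ, E) x)).apply_symm_apply
      ((fderiv ℝ (fun q : CotSpace E x => H ⟨x, q⟩) p).toLinearMap ∘ₗ
        (LinearMap.toContinuousLinearMap :
          (TangentSpace 𝓘(ℝ, E) x →ₗ[ℝ] ℝ) ≃ₗ[ℝ] CotSpace E x).toLinearMap)) q.toLinearMap
  exact h

end Cotangent

section Riemannian

variable {E : Type*} [NormedAddCommGroup E] [NormedSpace ℝ E] [FiniteDimensional ℝ E]
  {M : Type*} [MetricSpace M] [ChartedSpace E M] [IsManifold 𝓘(ℝ, E) ∞ M]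

/-- The standing conditions on a Hamiltonian `H : T*M → ℝ`. -/
structure IsHamiltonian [RiemannianBundle (fun x : M => TangentSpace 𝓘(ℝ, E) x)]
    (H : CotBundle E M → ℝ) : Prop where
  /-- `H` is locally Lipschitz, as read in the charts of the manifold `T*M`. -/
  locallyLipschitz : ∀ ξ : CotBundle E M,
    ∃ K : ℝ≥0, ∃ s ∈ 𝓝 (extChartAt (𝓘(ℝ, E).prod 𝓘(ℝ, E →L[ℝ] ℝ)) ξ ξ),
      LipschitzOnWith K (H ∘ (extChartAt (𝓘(ℝ, E).prod 𝓘(ℝ, E →L[ℝ] ℝ)) ξ).symm) s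
  /-- `p ↦ H(x, p)` is differentiable. -/
  differentiable : ∀ x : M, Differentiable ℝ (fun p : CotSpace E x => H ⟨x, p⟩)
  /-- `(x, p) ↦ H_p(x, p)` is continuous from `T*M` to `TM`. -/
  continuous_fiberDeriv : Continuous (fun ξ : CotBundle E M =>
    (⟨ξ.proj, fiberDeriv H ξ.proj ξ.snd⟩ : TangentBundle 𝓘(ℝ, E) M))
  /-- `p ↦ H(x, p)` is strictly convex. -/
  strictConvex : ∀ x : M, StrictConvexOn ℝ univ (fun p : CotSpace E x => H ⟨x, p⟩)
  /-- `H(x, p) / |p|_x → +∞` as `|p|_x → ∞`, uniformly in `x`. -/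
  superlinear : ∀ A : ℝ, ∃ R : ℝ, ∀ (x : M) (p : CotSpace E x), R ≤ ‖p‖ → A ≤ H ⟨x, p⟩ / ‖p‖

/-- A modulus of semiconcavity, as a function `[0, ∞) → [0, ∞)`. -/
structure IsModulus (θ : ℝ≥0 → ℝ≥0) : Prop where
  monotone : Monotone θ
  upperSemicontinuous : UpperSemicontinuous θ
  tendsto_zero : Tendsto θ (𝓝[>] 0) (𝓝 0)

/-- `c` restricted to `[0, 1]` is a minimizing geodesic with constant speed from `c 0` to `c 1`. -/
def IsMinGeodesic {X : Type*} [MetricSpace X] (c : ℝ → X) : Prop :=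
  ∀ s ∈ Icc (0 : ℝ) 1, ∀ t ∈ Icc (0 : ℝ) 1, dist (c s) (c t) = |s - t| * dist (c 0) (c 1)

/-- `φ` is semiconcave with modulus `θ`, along minimizing geodesics. -/
def IsSemiconcave {X : Type*} [MetricSpace X] (θ : ℝ≥0 → ℝ≥0) (φ : X → ℝ) : Prop :=
  ∀ c : ℝ → X, IsMinGeodesic c → ∀ t ∈ Icc (0 : ℝ) 1,
    (1 - t) * φ (c 0) + t * φ (c 1) - φ (c t) ≤
      t * (1 - t) * dist (c 0) (c 1) * θ (nndist (c 0) (c 1))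

/-- The superdifferential `D⁺φ(x)`: the differentials at `x` of the `C¹` functions `ψ`, defined on
a ball around `x`, that touch `φ` from above at `x`. -/
def superdiff (φ : M → ℝ) (x : M) : Set (CotSpace E x) :=
  {p | ∃ r > (0 : ℝ), ∃ ψ : M → ℝ,
    ContMDiffOn 𝓘(ℝ, E) 𝓘(ℝ, ℝ) 1 ψ (Metric.ball x r) ∧
    (∀ y ∈ Metric.ball x r, φ y ≤ ψ y) ∧ ψ x = φ x ∧
    HasMFDerivAt 𝓘(ℝ, E) 𝓘(ℝ, ℝ) ψ x p}

/-- The minimal energy selection `p^#_{φ,H}(x) = argmin {H(x, p) : p ∈ D⁺φ(x)}`. -/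
def minEnergy (φ : M → ℝ) (H : CotBundle E M → ℝ) (x : M) : CotSpace E x :=
  Classical.epsilon fun p : CotSpace E x =>
    p ∈ superdiff φ x ∧ ∀ q ∈ superdiff φ x, H ⟨x, p⟩ ≤ H ⟨x, q⟩

/-- `γ : ℝ → M` is a strict singular characteristic of `(φ, H)`: it is locally absolutely
continuous and `γ'(t) = H_p(γ(t), p^#_{φ,H}(γ(t)))` for almost every `t`. -/
structure IsStrictSingularChar (φ : M → ℝ) (H : CotBundle E M → ℝ) (γ : ℝ → M) : Prop where
  absolutelyContinuous : ∀ a b : ℝ, AbsolutelyContinuousOnInterval γ a b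
  deriv_eq : ∀ᵐ t : ℝ, HasMFDerivAt 𝓘(ℝ, ℝ) 𝓘(ℝ, E) γ t
    (ContinuousLinearMap.toSpanSingleton ℝ (fiberDeriv H (γ t) (minEnergy φ H (γ t))))

end Riemannian

end

/-! Let `p_k(t)` be the minimal energy covector of `(φ_k, H_k)` at `γ_k(t)`, and `q(t)` that of `(φ,
H)` at `γ(t)`. At almost every time all elements of `D⁺φ_k(γ_k)` take the same value on the
velocity, namely `(φ_k ∘ γ_k)'`. As `γ_k'` is the fibre derivative of `H_k` at `p_k`, convexity
gives `H_k(γ_k, p_k) - H_k(γ_k, q) ≤ p_k(γ_k') - q(γ_k') = (φ_k ∘ γ_k)' - q(γ_k') =: A_k`. The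
integral of `A_k` over a short interval tends to zero: the increments of `φ_k ∘ γ_k` converge to
those of `φ ∘ γ`, the velocities converge weakly, and `(φ ∘ γ)' = q(γ')` by the same chain rule. On
the other hand the left side has nonnegative lower limit at every time, since cluster points of
`p_k(t)` lie in `D⁺φ(γ(t))`, where `q(t)` minimizes `H`. By dominated convergence the negative part
of `A_k` tends to zero in `L¹`, hence so does `A_k`, and a subsequence tends to zero almost
everywhere. Along it every cluster point `p` of `p_k(t)` satisfies `H(γ, p) ≤ H(γ, q)`, so `p = q`
by strict convexity. The velocities then converge almost everywhere, which identifies `γ'`.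

This argument is `exists_tendsto_lintegral_enorm`, with `HasDerivAt.eq_of_mem_frechetSuper` (chain
rule), `tendsto_integral_apply_deriv` (weak convergence), `tendsto_of_sub_le` (cluster points) and
`IsCoordHamiltonian.tendsto_apply` (convexity turns convergence of `H_k` into convergence of fibre
derivatives).

What remains is to make the superdifferentials stable. Semiconcavity is given along minimizing
geodesics only, and the functions are not assumed continuous. In a chart, minimizing geodesics are
shown to be quadratically close to segments and to depend on their endpoints as segments do
(`IsMetricBall.norm_sub_sub_smul_le`, from the integrated Euler-Lagrange equation). Hence
semiconcave functions are bounded (`exists_ball_bddBelow`: a geodesic hull of finitely many points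
contains a ball), then Lipschitz, and their superdifferentials are described by an inequality with a
modulus common to all `k` (`uniformSuper_of_frechetSuper`), which passes to the limit
(`uniformSuper_of_tendsto`). `exists_contDiff_majorant` returns from this inequality to `C¹` test
functions. -/

open Manifold

noncomputable section

/-! ### Charts and trivializations of the tangent bundle. -/

section Frame
variable {E : Type*} [NormedAddCommGroup E] [NormedSpace ℝ E] 
    {M : Type*} [MetricSpace M] [ChartedSpace E M] [IsManifold 𝓘(ℝ, E) ∞ M]

/-- The inverse of the trivialization at `x₀` of the tangent bundle, on the fibre over `x`. -/
def frame (x₀ x : M) : E →L[ℝ] TangentSpace 𝓘(ℝ, E) x :=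
  (trivializationAt E (TangentSpace 𝓘(ℝ, E)) x₀).symmL ℝ x

/-- The trivialization at `x₀` of the tangent bundle, on the fibre over `x`. -/
def coframe (x₀ x : M) : TangentSpace 𝓘(ℝ, E) x →L[ℝ] E :=
  (trivializationAt E (TangentSpace 𝓘(ℝ, E)) x₀).continuousLinearMapAt ℝ x

theorem frame_coframe {x₀ x : M} (hx : x ∈ (extChartAt 𝓘(ℝ, E) x₀).source)
    (v : TangentSpace 𝓘(ℝ, E) x) : frame (E := E) x₀ x (coframe x₀ x v) = v :=
  (trivializationAt E (TangentSpace 𝓘(ℝ, E)) x₀).symmL_continuousLinearMapAt (R := ℝ)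
    (by simpa using hx) v

theorem coframe_frame {x₀ x : M} (hx : x ∈ (extChartAt 𝓘(ℝ, E) x₀).source) (v : E) :
    coframe (E := E) x₀ x (frame x₀ x v) = v :=
  (trivializationAt E (TangentSpace 𝓘(ℝ, E)) x₀).continuousLinearMapAt_symmL (R := ℝ)
    (by simpa using hx) v

theorem hasMFDerivAt_extChartAt_coframe {x₀ x : M} (hx : x ∈ (extChartAt 𝓘(ℝ, E) x₀).source) :
    HasMFDerivAt 𝓘(ℝ, E) 𝓘(ℝ, E) (extChartAt 𝓘(ℝ, E) x₀) x (coframe (E := E) x₀ x) := by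
  have hx' : x ∈ (chartAt E x₀).source := by simpa using hx
  rw [coframe, TangentBundle.continuousLinearMapAt_trivializationAt hx']
  exact (mdifferentiableAt_extChartAt hx').hasMFDerivAt

theorem hasMFDerivAt_extChartAt_symm_frame {x₀ : M} {a : E}
    (ha : a ∈ (extChartAt 𝓘(ℝ, E) x₀).target) :
    HasMFDerivAt 𝓘(ℝ, E) 𝓘(ℝ, E) (extChartAt 𝓘(ℝ, E) x₀).symm a
      (frame (E := E) x₀ ((extChartAt 𝓘(ℝ, E) x₀).symm a)) := by
  have hx : (extChartAt 𝓘(ℝ, E) x₀).symm a ∈ (chartAt E x₀).source := by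
    simpa using (extChartAt 𝓘(ℝ, E) x₀).map_target ha
  have h := TangentBundle.symmL_trivializationAt (I := 𝓘(ℝ, E)) (x₀ := x₀) hx
  have h1 := (mdifferentiableWithinAt_extChartAt_symm (I := 𝓘(ℝ, E)) ha).hasMFDerivWithinAt
  have e : extChartAt 𝓘(ℝ, E) x₀ ((extChartAt 𝓘(ℝ, E) x₀).symm a) = a :=
    (extChartAt 𝓘(ℝ, E) x₀).right_inv ha
  rw [modelWithCornersSelf_coe, range_id] at h h1
  rw [hasMFDerivWithinAt_univ] at h1
  -- The derivative produced above is taken at `ψ (ψ.symm a)`, which equals `a` only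
  -- propositionally; the point is generalized so that the equality can be substituted.
  have key : ∀ a', a' = a → HasMFDerivAt 𝓘(ℝ, E) 𝓘(ℝ, E) (extChartAt 𝓘(ℝ, E) x₀).symm a
      (mfderivWithin 𝓘(ℝ, E) 𝓘(ℝ, E) (extChartAt 𝓘(ℝ, E) x₀).symm univ a') := by
    rintro _ rfl
    exact h1
  rw [frame, h]
  exact key _ e

theorem contMDiffOn_frame (x₀ : M) (v : E) :
    ContMDiffOn 𝓘(ℝ, E) (𝓘(ℝ, E).prod 𝓘(ℝ, E)) ∞
      (fun x => (TotalSpace.mk' E x (frame x₀ x v) : TangentBundle 𝓘(ℝ, E) M))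
      (extChartAt 𝓘(ℝ, E) x₀).source := by
  have h := (trivializationAt E (TangentSpace 𝓘(ℝ, E)) x₀).contMDiffOn_symm (n := ∞)
    (IB := 𝓘(ℝ, E))
  have h2 : ContMDiffOn 𝓘(ℝ, E) (𝓘(ℝ, E).prod 𝓘(ℝ, E)) ∞ (fun x : M => (x, v))
      (extChartAt 𝓘(ℝ, E) x₀).source :=
    contMDiffOn_id.prodMk contMDiffOn_const
  refine (h.comp h2 ?_).congr ?_
  · intro x hx
    simpa [(trivializationAt E (TangentSpace 𝓘(ℝ, E)) x₀).target_eq] using hx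
  · intro x hx
    have hx' : x ∈ (trivializationAt E (TangentSpace 𝓘(ℝ, E)) x₀).baseSet := by simpa using hx
    rw [Function.comp_apply, frame, Trivialization.symmL_apply _ hx',
      ← Trivialization.mk_symm _ hx']

end Frame
-- The Riemannian metric in a chart.
section Metric
variable {E : Type*} [NormedAddCommGroup E] [NormedSpace ℝ E] 
    {M : Type*} [MetricSpace M] [ChartedSpace E M] [IsManifold 𝓘(ℝ, E) ∞ M]
    [RiemannianBundle (fun x : M => TangentSpace 𝓘(ℝ, E) x)]

/-- The Riemannian metric at the point with coordinate `a`, read in the chart at `x₀`. -/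
def metricCoord (x₀ : M) (a : E) : E →L[ℝ] E →L[ℝ] ℝ :=
  (innerSL ℝ (E := TangentSpace 𝓘(ℝ, E) ((extChartAt 𝓘(ℝ, E) x₀).symm a))).bilinearComp
    (frame (E := E) x₀ ((extChartAt 𝓘(ℝ, E) x₀).symm a))
    (frame (E := E) x₀ ((extChartAt 𝓘(ℝ, E) x₀).symm a))

theorem metricCoord_apply (x₀ : M) (a v w : E) : metricCoord x₀ a v w =
    inner ℝ (frame x₀ ((extChartAt 𝓘(ℝ, E) x₀).symm a) v)
      (frame x₀ ((extChartAt 𝓘(ℝ, E) x₀).symm a) w) := rfl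

theorem sqrt_metricCoord (x₀ : M) (a v : E) :
    √(metricCoord x₀ a v v) = ‖frame x₀ ((extChartAt 𝓘(ℝ, E) x₀).symm a) v‖ := by
  rw [metricCoord_apply, real_inner_self_eq_norm_sq, Real.sqrt_sq (norm_nonneg _)]

theorem metricCoord_comm (x₀ : M) (a v w : E) : metricCoord x₀ a v w = metricCoord x₀ a w v := by
  rw [metricCoord_apply, metricCoord_apply, real_inner_comm]

theorem metricCoord_pos {x₀ : M} {a : E} (ha : a ∈ (extChartAt 𝓘(ℝ, E) x₀).target) {v : E}
    (hv : v ≠ 0) : 0 < metricCoord x₀ a v v := by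
  rw [metricCoord_apply, real_inner_self_eq_norm_sq]
  have : frame x₀ ((extChartAt 𝓘(ℝ, E) x₀).symm a) v ≠ 0 := by
    intro h
    apply hv
    rw [← coframe_frame ((extChartAt 𝓘(ℝ, E) x₀).map_target ha) v, h, map_zero]
  positivity

theorem contDiffOn_metricCoord [FiniteDimensional ℝ E]
    [IsContMDiffRiemannianBundle 𝓘(ℝ, E) ∞ E (fun x : M => TangentSpace 𝓘(ℝ, E) x)] (x₀ : M) :
    ContDiffOn ℝ ∞ (metricCoord (E := E) x₀) (extChartAt 𝓘(ℝ, E) x₀).target := by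
  rw [contDiffOn_clm_apply]
  intro v
  rw [contDiffOn_clm_apply]
  intro w
  rw [← contMDiffOn_iff_contDiffOn]
  have h := ContMDiffOn.inner_bundle (IB := 𝓘(ℝ, E)) (F := E)
    (E := fun x : M => TangentSpace 𝓘(ℝ, E) x) (b := id)
    (contMDiffOn_frame x₀ v) (contMDiffOn_frame x₀ w)
  exact h.comp (contMDiffOn_extChartAt_symm x₀) (extChartAt 𝓘(ℝ, E) x₀).symm.mapsTo
end Metric

/-! ### Positive definite bilinear forms and their square roots. -/

section Bilin
variable {E : Type*} [NormedAddCommGroup E] [NormedSpace ℝ E]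

instance instNormedAddCommGroupDual : NormedAddCommGroup (E →L[ℝ] ℝ) :=
  ContinuousLinearMap.toNormedAddCommGroup

instance instNormedSpaceDual : NormedSpace ℝ (E →L[ℝ] ℝ) :=
  ContinuousLinearMap.toNormedSpace

instance instNormedAddCommGroupBilin : NormedAddCommGroup (E →L[ℝ] E →L[ℝ] ℝ) :=
  ContinuousLinearMap.toNormedAddCommGroup

instance instNormedSpaceBilin : NormedSpace ℝ (E →L[ℝ] E →L[ℝ] ℝ) :=
  ContinuousLinearMap.toNormedSpace

theorem exists_pos_forall_le_bilin [FiniteDimensional ℝ E] {B : E →L[ℝ] E →L[ℝ] ℝ}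
    (hB : ∀ v, v ≠ 0 → 0 < B v v) : ∃ c > 0, ∀ v, c * ‖v‖ ^ 2 ≤ B v v := by
  rcases subsingleton_or_nontrivial E with h | h
  · exact ⟨1, one_pos, fun v => by simp [Subsingleton.elim v 0]⟩
  have hc : IsCompact (Metric.sphere (0 : E) 1) := isCompact_sphere 0 1
  have hne : (Metric.sphere (0 : E) 1).Nonempty := NormedSpace.sphere_nonempty.2 zero_le_one
  obtain ⟨v₀, hv₀, hmin⟩ := hc.exists_isMinOn hne (f := fun v => B v v) (by fun_prop)
  have hv₀' : v₀ ≠ 0 := by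
    rintro rfl
    simp at hv₀
  refine ⟨B v₀ v₀, hB v₀ hv₀', fun v => ?_⟩
  rcases eq_or_ne v 0 with rfl | hv
  · simp
  have hn : ‖v‖ ≠ 0 := norm_ne_zero_iff.2 hv
  have h1 := hmin (a := ‖v‖⁻¹ • v) (by simp [norm_smul, hn])
  simp only [mem_ofPred_eq, map_smul, smul_apply, smul_eq_mul] at h1
  calc B v₀ v₀ * ‖v‖ ^ 2 ≤ (‖v‖⁻¹ * (‖v‖⁻¹ * B v v)) * ‖v‖ ^ 2 := by gcongr
    _ = B v v := by field_simp

/-- From `|√x - √y| (√x + √y) = |x - y|`: the right side is at most `‖G a - G a₀‖ ‖v‖²`, and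
coercivity bounds `√y` below by a multiple of `‖v‖`, so one factor `‖v‖` cancels. -/
theorem exists_ball_abs_sqrt_bilin_sub_le [FiniteDimensional ℝ E] {G : E → E →L[ℝ] E →L[ℝ] ℝ}
    {a₀ : E} (hG : ContinuousAt G a₀) (hpos : ∀ v, v ≠ 0 → 0 < G a₀ v v) {ε : ℝ} (hε : 0 < ε) :
    ∀ᶠ a in 𝓝 a₀, ∀ v, |√(G a v v) - √(G a₀ v v)| ≤ ε * ‖v‖ := by
  obtain ⟨c, hc, hcv⟩ := exists_pos_forall_le_bilin hpos
  -- The second entry of the minimum keeps `G a v v` nonnegative, so that its square root squares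
  -- back to it.
  have h1 : ∀ᶠ a in 𝓝 a₀, ‖G a - G a₀‖ < min (ε * √c) c := by
    have h0 : 0 < min (ε * √c) c := lt_min (mul_pos hε (Real.sqrt_pos.2 hc)) hc
    exact (tendsto_iff_norm_sub_tendsto_zero.1 hG).eventually (gt_mem_nhds h0)
  filter_upwards [h1] with a ha v
  rcases eq_or_ne v 0 with rfl | hv
  · simp
  have hn : 0 < ‖v‖ := norm_pos_iff.2 hv
  have h2 : |G a v v - G a₀ v v| ≤ ‖G a - G a₀‖ * ‖v‖ ^ 2 := by
    have := (G a - G a₀).le_opNorm₂ v v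
    simp only [sub_apply, Real.norm_eq_abs] at this
    linarith [this, sq ‖v‖, mul_assoc ‖G a - G a₀‖ ‖v‖ ‖v‖]
  have h3 : √c * ‖v‖ ≤ √(G a₀ v v) := by
    apply Real.le_sqrt_of_sq_le
    rw [mul_pow, Real.sq_sqrt hc.le]
    exact hcv v
  have h4 : 0 ≤ G a v v := by
    have := hcv v
    have h5 : ‖G a - G a₀‖ * ‖v‖ ^ 2 ≤ c * ‖v‖ ^ 2 := by
      gcongr
      exact (ha.trans_le (min_le_right _ _)).le
    linarith [abs_le.1 h2]
  have hx : 0 ≤ √(G a v v) := Real.sqrt_nonneg _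
  have hy : 0 < √(G a₀ v v) := lt_of_lt_of_le (by positivity) h3
  have hprod : |√(G a v v) - √(G a₀ v v)| * (√(G a v v) + √(G a₀ v v)) = |G a v v - G a₀ v v| := by
    rw [← abs_of_pos (add_pos_of_nonneg_of_pos hx hy)]
    rw [← abs_mul]
    congr 1
    linear_combination Real.sq_sqrt h4 - Real.sq_sqrt (hpos v hv).le
  have h6 : |√(G a v v) - √(G a₀ v v)| * (√c * ‖v‖) ≤ (ε * ‖v‖) * (√c * ‖v‖) := by
    calc |√(G a v v) - √(G a₀ v v)| * (√c * ‖v‖)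
        ≤ |√(G a v v) - √(G a₀ v v)| * (√(G a v v) + √(G a₀ v v)) := by
          gcongr
          linarith
      _ ≤ ‖G a - G a₀‖ * ‖v‖ ^ 2 := hprod ▸ h2
      _ ≤ (ε * √c) * ‖v‖ ^ 2 := by
        gcongr
        exact (ha.trans_le (min_le_left _ _)).le
      _ = (ε * ‖v‖) * (√c * ‖v‖) := by ring
  exact le_of_mul_le_mul_right h6 (by positivity)
end Bilin
-- Comparison of the Riemannian distance with the norm in a chart.
section DistChart
variable {E : Type*} [NormedAddCommGroup E] [NormedSpace ℝ E] [FiniteDimensional ℝ E]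
    {M : Type*} [MetricSpace M] [ChartedSpace E M] [IsManifold 𝓘(ℝ, E) ∞ M]
    [RiemannianBundle (fun x : M => TangentSpace 𝓘(ℝ, E) x)]
    [IsContMDiffRiemannianBundle 𝓘(ℝ, E) ∞ E (fun x : M => TangentSpace 𝓘(ℝ, E) x)]
    [IsRiemannianManifold 𝓘(ℝ, E) M]

omit [FiniteDimensional ℝ E] 
  [IsContMDiffRiemannianBundle 𝓘(ℝ, E) ∞ E (fun x : M => TangentSpace 𝓘(ℝ, E) x)] in
theorem dist_extChartAt_symm_le_of_segment {x₀ : M} {a b : E} {c : ℝ}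
    (hs : segment ℝ a b ⊆ (extChartAt 𝓘(ℝ, E) x₀).target)
    (hc : ∀ z ∈ segment ℝ a b, ‖frame x₀ ((extChartAt 𝓘(ℝ, E) x₀).symm z) (b - a)‖ ≤ c) :
    dist ((extChartAt 𝓘(ℝ, E) x₀).symm a) ((extChartAt 𝓘(ℝ, E) x₀).symm b) ≤ c := by
  set X := (extChartAt 𝓘(ℝ, E) x₀).symm with hX
  have hc0 : 0 ≤ c := (norm_nonneg _).trans (hc a (left_mem_segment ℝ a b))
  let η : ℝ → E := fun t => a + t • (b - a)
  have hη : ∀ t ∈ Icc (0 : ℝ) 1, η t ∈ segment ℝ a b := by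
    intro t ht
    rw [segment_eq_image']
    exact ⟨t, ht, rfl⟩
  have hηs : ContMDiffOn 𝓘(ℝ, ℝ) 𝓘(ℝ, E) 1 η (Icc 0 1) := by
    apply ContMDiff.contMDiffOn
    rw [contMDiff_iff_contDiff]
    fun_prop
  have hle : riemannianEDist 𝓘(ℝ, E) (X a) (X b) ≤ pathELength 𝓘(ℝ, E) (X ∘ η) 0 1 := by
    apply riemannianEDist_le_pathELength _ (by simp [η]) (by simp [η]) zero_le_one
    exact ((contMDiffOn_extChartAt_symm x₀).comp hηs fun t ht => hs (hη t ht))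
  have hlen : pathELength 𝓘(ℝ, E) (X ∘ η) 0 1 ≤ ENNReal.ofReal c := by
    rw [pathELength_eq_lintegral_mfderiv_Icc]
    calc _ ≤ ∫⁻ t in Icc (0 : ℝ) 1, ENNReal.ofReal c := by
          apply setLIntegral_mono' measurableSet_Icc
          intro t ht
          have h1 : HasMFDerivAt 𝓘(ℝ, ℝ) 𝓘(ℝ, E) η t
              (ContinuousLinearMap.toSpanSingleton ℝ (b - a)) := by
            have : HasDerivAt η (b - a) t := by
              simpa [η] using! ((hasDerivAt_id t).smul_const (b - a)).const_add a
            exact hasMFDerivAt_iff_hasFDerivAt.2 this.hasFDerivAt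
          have h2 := (hasMFDerivAt_extChartAt_symm_frame (hs (hη t ht))).comp t h1
          rw [h2.mfderiv]
          have h3 := hc _ (hη t ht)
          rw [← ofReal_norm]
          apply ENNReal.ofReal_le_ofReal
          have e : (ContinuousLinearMap.toSpanSingleton ℝ (b - a)) (1 : ℝ) = b - a := by simp
          refine le_trans (le_of_eq ?_) h3
          exact congrArg (fun w : E => ‖frame x₀ (X (η t)) w‖) e
      _ = ENNReal.ofReal c := by simp
  rw [dist_edist, IsRiemannianManifold.out (I := 𝓘(ℝ, E)) (X a) (X b)]
  exact ENNReal.toReal_le_of_le_ofReal hc0 (hle.trans hlen)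

omit [FiniteDimensional ℝ E] 
  [IsContMDiffRiemannianBundle 𝓘(ℝ, E) ∞ E (fun x : M => TangentSpace 𝓘(ℝ, E) x)]
  [IsRiemannianManifold 𝓘(ℝ, E) M] in
/-- A path in the chart domain along which a linear form `ℓ`, read in the chart, is bounded by the
Riemannian norm moves `ℓ` by at most its length. -/
theorem enorm_sub_le_pathELength {x₀ : M} {c : ℝ → M} {C : ℝ≥0} {ℓ : E →L[ℝ] ℝ}
    (hc : ContMDiffOn 𝓘(ℝ, ℝ) 𝓘(ℝ, E) 1 c (Icc 0 1))
    (hs : ∀ t ∈ Icc (0 : ℝ) 1, c t ∈ (extChartAt 𝓘(ℝ, E) x₀).source)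
    (hℓ : ∀ t ∈ Icc (0 : ℝ) 1, ∀ v : TangentSpace 𝓘(ℝ, E) (c t), ‖ℓ (coframe x₀ (c t) v)‖ ≤ C * ‖v‖) :
    ‖ℓ (extChartAt 𝓘(ℝ, E) x₀ (c 1)) - ℓ (extChartAt 𝓘(ℝ, E) x₀ (c 0))‖ₑ ≤
      C * pathELength 𝓘(ℝ, E) c 0 1 := by
  set γ' : ℝ → ℝ := fun t => ℓ (extChartAt 𝓘(ℝ, E) x₀ (c t)) with hγ'
  have h1 : ContMDiffOn 𝓘(ℝ, ℝ) 𝓘(ℝ, E) 1 (extChartAt 𝓘(ℝ, E) x₀ ∘ c) (Icc 0 1) :=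
    (contMDiffOn_extChartAt (I := 𝓘(ℝ, E)) (x := x₀) (n := 1)).comp hc
      (fun t ht => by simpa using hs t ht)
  have h2 : ContDiffOn ℝ 1 γ' (Icc 0 1) := ℓ.contDiff.comp_contDiffOn (contMDiffOn_iff_contDiffOn.1 h1)
  calc ‖γ' 1 - γ' 0‖ₑ ≤ ∫⁻ t in Icc (0 : ℝ) 1, ‖derivWithin γ' (Icc 0 1) t‖ₑ :=
        enorm_sub_le_lintegral_derivWithin_Icc_of_contDiffOn_Icc h2 zero_le_one
    _ ≤ ∫⁻ t in Icc (0 : ℝ) 1, C * ‖mfderivWithin 𝓘(ℝ, ℝ) 𝓘(ℝ, E) c (Icc 0 1) t 1‖ₑ := by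
      apply setLIntegral_mono' measurableSet_Icc
      intro t ht
      have hu : UniqueDiffWithinAt ℝ (Icc (0 : ℝ) 1) t := uniqueDiffOn_Icc zero_lt_one t ht
      have h3 := (hc.mdifferentiableOn one_ne_zero t ht).hasMFDerivWithinAt
      have h4 := (hasMFDerivAt_extChartAt_coframe (hs t ht)).comp_hasMFDerivWithinAt t h3
      have h5 := hasMFDerivWithinAt_iff_hasFDerivWithinAt.1 h4
      have h6 := ℓ.hasFDerivAt.comp_hasFDerivWithinAt t h5
      have h7 : derivWithin γ' (Icc 0 1) t =
          ℓ (coframe x₀ (c t) (mfderivWithin 𝓘(ℝ, ℝ) 𝓘(ℝ, E) c (Icc 0 1) t 1)) := by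
        rw [← fderivWithin_derivWithin]
        exact congrArg (fun L : ℝ →L[ℝ] ℝ => L 1) (h6.fderivWithin hu)
      rw [h7]
      have := hℓ t ht (mfderivWithin 𝓘(ℝ, ℝ) 𝓘(ℝ, E) c (Icc 0 1) t 1)
      rw [← ofReal_norm, ← ofReal_norm, ← ENNReal.ofReal_coe_nnreal, ← ENNReal.ofReal_mul C.coe_nonneg]
      exact ENNReal.ofReal_le_ofReal this
    _ = C * pathELength 𝓘(ℝ, E) c 0 1 := by
      rw [lintegral_const_mul' _ _ ENNReal.coe_ne_top, pathELength_eq_lintegral_mfderivWithin_Icc]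

omit [FiniteDimensional ℝ E] [IsManifold 𝓘(ℝ, E) ∞ M]
  [IsContMDiffRiemannianBundle 𝓘(ℝ, E) ∞ E (fun x : M => TangentSpace 𝓘(ℝ, E) x)] in
theorem exists_path_lt {x y : M} {r : ℝ} (hr : dist x y < r) :
    ∃ c : ℝ → M, c 0 = x ∧ c 1 = y ∧ ContMDiffOn 𝓘(ℝ, ℝ) 𝓘(ℝ, E) 1 c (Icc 0 1) ∧
      pathELength 𝓘(ℝ, E) c 0 1 < ENNReal.ofReal r ∧
      ∀ s t, 0 ≤ s → s ≤ t → t ≤ 1 → edist (c s) (c t) ≤ pathELength 𝓘(ℝ, E) c s t := by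
  have h : riemannianEDist 𝓘(ℝ, E) x y < ENNReal.ofReal r := by
    rw [← IsRiemannianManifold.out (I := 𝓘(ℝ, E)) x y, edist_dist]
    exact (ENNReal.ofReal_lt_ofReal_iff (dist_nonneg.trans_lt hr)).2 hr
  obtain ⟨c, h0, h1, hc, hl⟩ := exists_lt_of_riemannianEDist_lt h
  refine ⟨c, h0, h1, hc, hl, fun s t hs hst ht => ?_⟩
  rw [IsRiemannianManifold.out (I := 𝓘(ℝ, E)) (c s) (c t)]
  exact riemannianEDist_le_pathELength (hc.mono (Icc_subset_Icc hs ht)) rfl rfl hst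

end DistChart

section DistChart
variable {E : Type*} [NormedAddCommGroup E] [NormedSpace ℝ E] [FiniteDimensional ℝ E]
    {M : Type*} [MetricSpace M] [ChartedSpace E M] [IsManifold 𝓘(ℝ, E) ∞ M]
    [RiemannianBundle (fun x : M => TangentSpace 𝓘(ℝ, E) x)]
    [IsContMDiffRiemannianBundle 𝓘(ℝ, E) ∞ E (fun x : M => TangentSpace 𝓘(ℝ, E) x)]
    [IsRiemannianManifold 𝓘(ℝ, E) M]

/-- In a chart the Riemannian distance is strictly differentiable along the diagonal, with the
norm of the metric as derivative. -/
theorem exists_ball_abs_dist_sub_le {x₀ : M} {a₀ : E} (ha₀ : a₀ ∈ (extChartAt 𝓘(ℝ, E) x₀).target)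
    {ε : ℝ} (hε : 0 < ε) : ∃ δ > 0, Metric.ball a₀ δ ⊆ (extChartAt 𝓘(ℝ, E) x₀).target ∧
      ∀ a ∈ Metric.ball a₀ δ, ∀ b ∈ Metric.ball a₀ δ,
        |dist ((extChartAt 𝓘(ℝ, E) x₀).symm a) ((extChartAt 𝓘(ℝ, E) x₀).symm b) -
          √(metricCoord x₀ a₀ (b - a) (b - a))| ≤ ε * ‖b - a‖ := by
  set ψ := extChartAt 𝓘(ℝ, E) x₀ with hψ
  have htgt : IsOpen ψ.target := isOpen_extChartAt_target x₀
  set G := metricCoord (E := E) x₀ with hG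
  set N : E → E → ℝ := fun a v => √(G a v v) with hN
  have hGc : ContinuousAt G a₀ := (contDiffOn_metricCoord x₀).continuousOn.continuousAt
    (htgt.mem_nhds ha₀)
  have hpos : ∀ v, v ≠ 0 → 0 < G a₀ v v := fun v hv => metricCoord_pos ha₀ hv
  obtain ⟨c, hc, hcv⟩ := exists_pos_forall_le_bilin hpos
  set m := √c with hm
  have hm0 : 0 < m := Real.sqrt_pos.2 hc
  have hmv : ∀ v, m * ‖v‖ ≤ N a₀ v := by
    intro v
    apply Real.le_sqrt_of_sq_le
    rw [mul_pow, Real.sq_sqrt hc.le]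
    exact hcv v
  set K := √‖G a₀‖ with hK
  have hKv : ∀ v, N a₀ v ≤ K * ‖v‖ := by
    intro v
    apply Real.sqrt_le_iff.2 ⟨by positivity, ?_⟩
    rw [mul_pow, Real.sq_sqrt (norm_nonneg _), sq, ← mul_assoc]
    exact (le_abs_self _).trans ((G a₀).le_opNorm₂ v v)
  have hK0 : 0 ≤ K := Real.sqrt_nonneg _
  -- The bound by `ε` serves the upper estimate, the bound by `1` gives `dist ≤ (K + 1) ‖b - a‖`,
  -- the bound by `m / 2` keeps nearby norms at least `(m / 2) ‖v‖`, and the last one gives `κ (K +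
  -- 1) ≤ ε` for the relative error `κ = 2 ε' / m` of the lower estimate.
  set ε' := min (min ε 1) (min (m / 2) (ε * m / (2 * (K + 1)))) with hε'
  have hε'0 : 0 < ε' := by positivity
  obtain ⟨δ₁, hδ₁, hδ₁'⟩ := Metric.eventually_nhds_iff_ball.1
    ((exists_ball_abs_sqrt_bilin_sub_le hGc hpos hε'0).and (htgt.mem_nhds ha₀))
  have hNa : ∀ a ∈ Metric.ball a₀ δ₁, ∀ v, |N a v - N a₀ v| ≤ ε' * ‖v‖ := fun a ha =>
    (hδ₁' a ha).1
  have hsub : Metric.ball a₀ δ₁ ⊆ ψ.target := fun a ha => (hδ₁' a ha).2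
  -- short paths stay in the chart ball
  have hx : ψ.symm a₀ ∈ ψ.source := ψ.map_target ha₀
  have hnhds : ψ.source ∩ ψ ⁻¹' Metric.ball a₀ δ₁ ∈ 𝓝 (ψ.symm a₀) := by
    apply inter_mem ((isOpen_extChartAt_source x₀).mem_nhds hx)
    have := (continuousOn_extChartAt (I := 𝓘(ℝ, E)) x₀).continuousAt
      ((isOpen_extChartAt_source x₀).mem_nhds hx)
    apply this.preimage_mem_nhds
    rw [← hψ, ψ.right_inv ha₀]
    exact Metric.ball_mem_nhds _ hδ₁
  obtain ⟨ρ, hρ, hρ'⟩ := Metric.mem_nhds_iff.1 hnhds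
  have hXc : ContinuousAt ψ.symm a₀ := (continuousOn_extChartAt_symm x₀).continuousAt
    (htgt.mem_nhds ha₀)
  obtain ⟨δ₂, hδ₂, hδ₂'⟩ := Metric.continuousAt_iff.1 hXc (ρ / 4) (by positivity)
  refine ⟨min δ₁ δ₂, lt_min hδ₁ hδ₂,
    (Metric.ball_subset_ball (min_le_left _ _)).trans hsub, ?_⟩
  intro a ha b hb
  have ha1 := Metric.ball_subset_ball (min_le_left δ₁ δ₂) ha
  have hb1 := Metric.ball_subset_ball (min_le_left δ₁ δ₂) hb
  have ha2 := hδ₂' (Metric.ball_subset_ball (min_le_right δ₁ δ₂) ha)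
  have hb2 := hδ₂' (Metric.ball_subset_ball (min_le_right δ₁ δ₂) hb)
  have hseg : segment ℝ a b ⊆ Metric.ball a₀ δ₁ := (convex_ball _ _).segment_subset ha1 hb1
  have hupper : dist (ψ.symm a) (ψ.symm b) ≤ N a₀ (b - a) + ε' * ‖b - a‖ := by
    apply dist_extChartAt_symm_le_of_segment (hseg.trans hsub)
    intro z hz
    rw [← sqrt_metricCoord]
    linarith [(abs_le.1 (hNa z (hseg hz) (b - a))).2]
  set κ := 2 * ε' / m with hκ
  have hκ0 : 0 ≤ κ := by positivity
  have hεm : ε' ≤ m / 2 := (min_le_right _ _).trans (min_le_left _ _)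
  have hlower : N a₀ (b - a) ≤ (1 + κ) * dist (ψ.symm a) (ψ.symm b) := by
    rcases eq_or_ne (b - a) 0 with h0 | h0
    · rw [h0]
      simp only [hN, map_zero, Real.sqrt_zero]
      positivity
    have hN0 : 0 < N a₀ (b - a) := Real.sqrt_pos.2 (hpos _ h0)
    apply le_of_forall_gt_imp_ge_of_dense
    intro r hr
    have hk1 : 0 < 1 + κ := by positivity
    -- A path shorter than `ρ / 2` that starts within `ρ / 4` of `ψ.symm a₀` cannot leave the ball
    -- of radius `ρ`, where the metric is almost constant.
    have hr' : dist (ψ.symm a) (ψ.symm b) < min (r / (1 + κ)) (ρ / 2) := by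
      apply lt_min
      · rw [lt_div_iff₀ hk1]
        linarith
      · linarith [dist_triangle_right (ψ.symm a) (ψ.symm b) (ψ.symm a₀)]
    obtain ⟨p, hp0, hp1, hps, hpl, hpe⟩ := exists_path_lt (E := E) hr'
    have hpin : ∀ t ∈ Icc (0 : ℝ) 1, p t ∈ ψ.source ∩ ψ ⁻¹' Metric.ball a₀ δ₁ := by
      intro t ht
      apply hρ'
      have h1 : edist (p 0) (p t) < ENNReal.ofReal (min (r / (1 + κ)) (ρ / 2)) :=
        ((hpe 0 t le_rfl ht.1 ht.2).trans (pathELength_mono le_rfl ht.2)).trans_lt hpl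
      rw [edist_lt_ofReal, hp0] at h1
      have h2 := h1.trans_le (min_le_right _ _)
      rw [Metric.mem_ball]
      linarith [dist_triangle_left (p t) (ψ.symm a₀) (ψ.symm a)]
    -- A calibration: by Cauchy-Schwarz this form is bounded by the norm `N a₀`, with equality in
    -- the direction `b - a`. The length of any short path therefore controls `N a₀ (b - a)`.
    set ℓ : E →L[ℝ] ℝ := (N a₀ (b - a))⁻¹ • G a₀ (b - a) with hℓ
    have hℓv : ∀ v, ‖ℓ v‖ ≤ N a₀ v := by
      intro v
      have h1 : ‖G a₀ (b - a) v‖ ≤ N a₀ (b - a) * N a₀ v := by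
        simp only [hN, hG, sqrt_metricCoord]
        rw [metricCoord_apply]
        exact norm_inner_le_norm _ _
      rw [hℓ, smul_apply, norm_smul, norm_inv, Real.norm_of_nonneg hN0.le,
        inv_mul_le_iff₀ hN0]
      exact h1
    have hk : (0 : ℝ) ≤ 1 + κ := hk1.le
    have hmain := enorm_sub_le_pathELength (x₀ := x₀) (C := (1 + κ).toNNReal) (ℓ := ℓ) hps
      (fun t ht => (hpin t ht).1) (by
        intro t ht v
        have h1 := hpin t ht
        have h2 : N (ψ (p t)) (coframe x₀ (p t) v) = ‖v‖ := by
          have key : ∀ y, y = p t → ‖frame x₀ y (coframe x₀ (p t) v)‖ = ‖v‖ := by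
            rintro _ rfl
            rw [frame_coframe h1.1]
          simp only [hN, hG, sqrt_metricCoord]
          exact key _ (ψ.left_inv h1.1)
        refine (hℓv _).trans ?_
        have h3 := abs_le.1 (hNa _ h1.2 (coframe x₀ (p t) v))
        have h4 := hmv (coframe x₀ (p t) v)
        rw [h2] at h3
        have h5 : m / 2 * ‖coframe (E := E) x₀ (p t) v‖ ≤ ‖v‖ := by
          nlinarith [norm_nonneg (coframe (E := E) x₀ (p t) v), h3.1, h3.2]
        have h6 : ε' * ‖coframe (E := E) x₀ (p t) v‖ ≤ κ * ‖v‖ := by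
          calc _ = κ * (m / 2 * ‖coframe (E := E) x₀ (p t) v‖) := by
                rw [hκ]
                field_simp
            _ ≤ κ * ‖v‖ := by gcongr
        rw [Real.coe_toNNReal _ hk]
        linarith [h3.1])
    rw [hp0, hp1, ← hψ, ψ.right_inv (hsub ha1), ψ.right_inv (hsub hb1), ← map_sub] at hmain
    have hval : ℓ (b - a) = N a₀ (b - a) := by
      rw [hℓ, smul_apply, smul_eq_mul, inv_mul_eq_div, div_eq_iff hN0.ne']
      exact (Real.mul_self_sqrt (hpos _ h0).le).symm
    rw [hval, ← ofReal_norm, Real.norm_of_nonneg hN0.le] at hmain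
    have h7 : ENNReal.ofReal (N a₀ (b - a)) ≤ ENNReal.ofReal r := by
      calc _ ≤ _ := hmain
        _ ≤ ENNReal.ofReal (1 + κ) * ENNReal.ofReal (r / (1 + κ)) := by
          gcongr
          · exact le_rfl
          · exact hpl.le.trans (ENNReal.ofReal_le_ofReal (min_le_left _ _))
        _ = ENNReal.ofReal r := by
          rw [← ENNReal.ofReal_mul hk]
          congr 1
          field_simp
    have hr0 : 0 ≤ r := le_trans (by positivity) hr.le
    exact (ENNReal.ofReal_le_ofReal_iff hr0).1 h7
  have hn := norm_nonneg (b - a)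
  have hε1 : ε' ≤ ε := (min_le_left _ _).trans (min_le_left _ _)
  have hε2 : ε' ≤ 1 := (min_le_left _ _).trans (min_le_right _ _)
  have hε3 : ε' ≤ ε * m / (2 * (K + 1)) := (min_le_right _ _).trans (min_le_right _ _)
  have hκK : κ * (K + 1) ≤ ε := by
    rw [le_div_iff₀ (by positivity)] at hε3
    rw [hκ, div_mul_eq_mul_div, div_le_iff₀ hm0]
    linarith
  rw [abs_le]
  constructor
  · have h1 : dist (ψ.symm a) (ψ.symm b) ≤ (K + 1) * ‖b - a‖ := by
      nlinarith [hKv (b - a)]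
    have h2 : κ * dist (ψ.symm a) (ψ.symm b) ≤ ε * ‖b - a‖ := by
      calc _ ≤ κ * ((K + 1) * ‖b - a‖) := by gcongr
        _ = κ * (K + 1) * ‖b - a‖ := by ring
        _ ≤ _ := by gcongr
    change _ ≤ dist (ψ.symm a) (ψ.symm b) - N a₀ (b - a)
    linarith
  · change dist (ψ.symm a) (ψ.symm b) - N a₀ (b - a) ≤ _
    have : ε' * ‖b - a‖ ≤ ε * ‖b - a‖ := by gcongr
    linarith
end DistChart

/-! ### Existence of minimizing geodesics. -/

section Geodesic

/-- The upper bounds on `[0, s]`, `[s, t]` and `[t, 1]` add up to the full distance, so by the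
triangle inequality each of them is an equality. -/
theorem IsMinGeodesic.of_dist_le {X : Type*} [MetricSpace X] {c : ℝ → X}
    (h : ∀ s ∈ Icc (0 : ℝ) 1, ∀ t ∈ Icc (0 : ℝ) 1, s ≤ t →
      dist (c s) (c t) ≤ (t - s) * dist (c 0) (c 1)) : IsMinGeodesic c := by
  have key : ∀ s ∈ Icc (0 : ℝ) 1, ∀ t ∈ Icc (0 : ℝ) 1, s ≤ t →
      dist (c s) (c t) = (t - s) * dist (c 0) (c 1) := by
    intro s hs t ht hst
    have h1 := h 0 (by simp) s hs hs.1
    have h2 := h s hs t ht hst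
    have h3 := h t ht 1 (by simp) ht.2
    have h4 := dist_triangle4 (c 0) (c s) (c t) (c 1)
    linarith
  intro s hs t ht
  rcases le_total s t with hst | hst
  · rw [abs_sub_comm, abs_of_nonneg (sub_nonneg.2 hst)]
    exact key s hs t ht hst
  · rw [abs_of_nonneg (sub_nonneg.2 hst), dist_comm]
    exact key t ht s hs hst

/-- An almost shortest path, parametrized proportionally to arc length. -/
theorem exists_almost_geodesic (E : Type*) [NormedAddCommGroup E] [NormedSpace ℝ E]
    {M : Type*} [MetricSpace M] [ChartedSpace E M]
    [RiemannianBundle (fun x : M => TangentSpace 𝓘(ℝ, E) x)]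
    [IsRiemannianManifold 𝓘(ℝ, E) M] (x y : M) {ε : ℝ} (hε : 0 < ε) :
    ∃ c : ℝ → M, c 0 = x ∧ c 1 = y ∧ ∀ s ∈ Icc (0 : ℝ) 1, ∀ t ∈ Icc (0 : ℝ) 1, s ≤ t →
      dist (c s) (c t) ≤ (t - s) * (dist x y + ε) := by
  obtain ⟨p, hp0, hp1, hps, hpl, hpe⟩ := exists_path_lt (E := E) (lt_add_of_pos_right (dist x y) hε)
  have hfin : ∀ s t, 0 ≤ s → t ≤ 1 → pathELength 𝓘(ℝ, E) p s t ≠ ⊤ := fun s t hs ht =>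
    ((pathELength_mono hs ht).trans_lt (hpl.trans ENNReal.ofReal_lt_top)).ne
  set L : ℝ → ℝ := fun t => (pathELength 𝓘(ℝ, E) p 0 t).toReal with hL
  have hsub : ∀ s t, 0 ≤ s → s ≤ t → t ≤ 1 →
      L t - L s = (pathELength 𝓘(ℝ, E) p s t).toReal := by
    intro s t hs hst ht
    simp only [hL]
    rw [← pathELength_add hs hst, ENNReal.toReal_add (hfin 0 s le_rfl (hst.trans ht))
      (hfin s t hs ht)]
    ring
  have hLcont : ContinuousOn L (Icc 0 1) := by
    have hint : ∫⁻ t in Icc (0 : ℝ) 1, ‖mfderiv 𝓘(ℝ, ℝ) 𝓘(ℝ, E) p t 1‖ₑ ≠ ⊤ := by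
      rw [← pathELength_eq_lintegral_mfderiv_Icc]
      exact hfin 0 1 le_rfl le_rfl
    -- Uniform continuity of arc length is absolute continuity of the integral of the speed.
    have key : ∀ η > 0, ∃ δ > 0, ∀ s t, 0 ≤ s → s ≤ t → t ≤ 1 → t - s < δ → L t - L s < η := by
      intro η hη
      obtain ⟨δ, hδ, hδ'⟩ := exists_pos_setLIntegral_lt_of_measure_lt hint
        (ε := ENNReal.ofReal η) (by simpa using hη)
      obtain ⟨d, -, hd, hdδ⟩ := ENNReal.lt_iff_exists_real_btwn.1 hδ
      refine ⟨d, by simpa using hd, fun s t hs hst ht htd => ?_⟩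
      rw [hsub s t hs hst ht]
      have hss : Icc s t ⊆ Icc 0 1 := Icc_subset_Icc hs ht
      have h1 := hδ' (Icc s t) (by
        rw [Measure.restrict_apply measurableSet_Icc, inter_eq_self_of_subset_left hss,
          Real.volume_Icc]
        exact (ENNReal.ofReal_le_ofReal htd.le).trans_lt hdδ)
      rw [Measure.restrict_restrict measurableSet_Icc, inter_eq_self_of_subset_left hss,
        ← pathELength_eq_lintegral_mfderiv_Icc] at h1
      exact (ENNReal.lt_ofReal_iff_toReal_lt (hfin s t hs ht)).1 h1
    have hmono : ∀ s t, 0 ≤ s → s ≤ t → t ≤ 1 → 0 ≤ L t - L s := fun s t hs hst ht => by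
      rw [hsub s t hs hst ht]
      exact ENNReal.toReal_nonneg
    rw [Metric.continuousOn_iff]
    intro b hb η hη
    obtain ⟨δ, hδ, h⟩ := key η hη
    refine ⟨δ, hδ, fun a ha hab => ?_⟩
    rw [Real.dist_eq] at hab ⊢
    rcases le_total a b with h1 | h1
    · rw [abs_sub_comm, abs_of_nonneg (hmono a b ha.1 h1 hb.2)]
      exact h a b ha.1 h1 hb.2 ((le_abs_self _).trans_lt (abs_sub_comm a b ▸ hab))
    · rw [abs_of_nonneg (hmono b a hb.1 h1 ha.2)]
      exact h b a hb.1 h1 ha.2 ((le_abs_self _).trans_lt hab)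
  have hL0 : L 0 = 0 := by
    simp [hL]
  have hL1 : L 1 ≤ dist x y + ε := by
    simp only [hL]
    exact ENNReal.toReal_le_of_le_ofReal (by positivity) hpl.le
  have hL1' : 0 ≤ L 1 := ENNReal.toReal_nonneg
  -- Any preimage of `s * L 1` under arc length will do, with no regularity of `τ`. The values at
  -- `0` and `1` are imposed because arc length need not be injective.
  have hτ : ∀ s, ∃ τ, s ∈ Icc (0 : ℝ) 1 → τ ∈ Icc (0 : ℝ) 1 ∧ L τ = s * L 1 ∧ (s = 0 → τ = 0) ∧
      (s = 1 → τ = 1) := by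
    intro s
    by_cases hs : s ∈ Icc (0 : ℝ) 1
    · rcases eq_or_ne s 0 with rfl | h0
      · exact ⟨0, fun _ => ⟨by simp, by simp [hL0], fun _ => rfl, fun h => by simp at h⟩⟩
      rcases eq_or_ne s 1 with rfl | h1
      · exact ⟨1, fun _ => ⟨by simp, by simp, fun h => by simp at h, fun _ => rfl⟩⟩
      have hmem : s * L 1 ∈ Icc (L 0) (L 1) := by
        rw [hL0]
        exact ⟨mul_nonneg hs.1 hL1', mul_le_of_le_one_left hL1' hs.2⟩
      obtain ⟨τ, hτ, hτ'⟩ := intermediate_value_Icc zero_le_one hLcont hmem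
      exact ⟨τ, fun _ => ⟨hτ, hτ', fun h => absurd h h0, fun h => absurd h h1⟩⟩
    · exact ⟨0, fun h => absurd h hs⟩
  choose τ hτ using hτ
  refine ⟨p ∘ τ, ?_, ?_, fun s hs t ht hst => ?_⟩
  · rw [Function.comp_apply, (hτ 0 (by simp)).2.2.1 rfl, hp0]
  · rw [Function.comp_apply, (hτ 1 (by simp)).2.2.2 rfl, hp1]
  have hd : ∀ a b, 0 ≤ a → a ≤ b → b ≤ 1 → dist (p a) (p b) ≤ L b - L a := by
    intro a b ha hab hb
    rw [hsub a b ha hab hb, dist_edist]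
    exact ENNReal.toReal_mono (hfin a b ha hb) (hpe a b ha hab hb)
  obtain ⟨hs1, hs2, -⟩ := hτ s hs
  obtain ⟨ht1, ht2, -⟩ := hτ t ht
  have h1 : (t - s) * L 1 ≤ (t - s) * (dist x y + ε) :=
    mul_le_mul_of_nonneg_left hL1 (sub_nonneg.2 hst)
  have h2 : 0 ≤ (t - s) * L 1 := mul_nonneg (sub_nonneg.2 hst) hL1'
  rw [Function.comp_apply, Function.comp_apply]
  rcases le_total (τ s) (τ t) with h | h
  · have := hd _ _ hs1.1 h ht1.2
    linarith
  · have := hd _ _ ht1.1 h hs1.2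
    rw [dist_comm] at this
    linarith

/-- The upper bounds for almost geodesics pass to a pointwise limit. Compactness of `M` gives such a
limit at all times at once along an ultrafilter, and the bounds themselves force the limit to be a
geodesic. -/
theorem exists_isMinGeodesic (E : Type*) [NormedAddCommGroup E] [NormedSpace ℝ E]
    {M : Type*} [MetricSpace M] [ChartedSpace E M]
    [RiemannianBundle (fun x : M => TangentSpace 𝓘(ℝ, E) x)]
    [IsRiemannianManifold 𝓘(ℝ, E) M] [CompactSpace M] (x y : M) :
    ∃ c : ℝ → M, c 0 = x ∧ c 1 = y ∧ IsMinGeodesic c := by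
  choose c hc0 hc1 hc using fun n : ℕ =>
    exists_almost_geodesic E x y (ε := 1 / ((n : ℝ) + 1)) Nat.one_div_pos_of_nat
  let F : Ultrafilter ℕ := Ultrafilter.of atTop
  have hF : (F : Filter ℕ) ≤ atTop := Ultrafilter.of_le atTop
  have hlim : ∀ t, ∃ z, Tendsto (fun n => c n t) F (𝓝 z) := fun t => by
    obtain ⟨z, -, hz⟩ := isCompact_univ.ultrafilter_le_nhds (F.map fun n => c n t) (by simp)
    exact ⟨z, hz⟩
  choose z hz using hlim
  have hz0 : z 0 = x := tendsto_nhds_unique (hz 0) (by simp [hc0])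
  have hz1 : z 1 = y := tendsto_nhds_unique (hz 1) (by simp [hc1])
  refine ⟨z, hz0, hz1, IsMinGeodesic.of_dist_le fun s hs t ht hst => ?_⟩
  have h1 : Tendsto (fun n : ℕ => (t - s) * (dist x y + 1 / ((n : ℝ) + 1))) F
      (𝓝 ((t - s) * (dist x y + 0))) :=
    ((tendsto_one_div_add_atTop_nhds_zero_nat.mono_left hF).const_add _).const_mul _
  rw [hz0, hz1]
  rw [add_zero] at h1
  exact le_of_tendsto_of_tendsto ((hz s).dist (hz t)) h1
    (Eventually.of_forall fun n => hc n s hs t ht hst)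

end Geodesic

/-! ### Absolutely continuous curves and the lemma of du Bois-Reymond. -/

section AbsolutelyContinuous

theorem AbsolutelyContinuousOnInterval.comp_of_dist_le {X Y : Type*} [PseudoMetricSpace X]
    [PseudoMetricSpace Y] {f : ℝ → X} {g : X → Y} {a b K : ℝ}
    (hf : AbsolutelyContinuousOnInterval f a b)
    (hg : ∀ s ∈ uIcc a b, ∀ t ∈ uIcc a b, dist (g (f s)) (g (f t)) ≤ K * dist (f s) (f t)) :
    AbsolutelyContinuousOnInterval (g ∘ f) a b := by
  rw [absolutelyContinuousOnInterval_iff] at hf ⊢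
  intro ε hε
  obtain ⟨δ, hδ, h⟩ := hf (ε / (|K| + 1)) (by positivity)
  refine ⟨δ, hδ, fun I hI hIδ => ?_⟩
  have h1 := h I hI hIδ
  rw [lt_div_iff₀ (by positivity), Finset.sum_mul] at h1
  refine lt_of_le_of_lt (Finset.sum_le_sum fun i hi => ?_) h1
  refine (hg _ (hI.1 i hi).1 _ (hI.1 i hi).2).trans ?_
  rw [mul_comm]
  gcongr
  linarith [le_abs_self K]

/-- A functional that norms the increment reduces the claim to the fundamental theorem of calculus
for real absolutely continuous functions. -/
theorem AbsolutelyContinuousOnInterval.norm_sub_le {F : Type*} [NormedAddCommGroup F]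
    [NormedSpace ℝ F] {f : ℝ → F} {a b σ : ℝ} (hab : a ≤ b)
    (hf : AbsolutelyContinuousOnInterval f a b)
    (hd : ∀ᵐ x, x ∈ Icc a b → ∃ f', HasDerivAt f f' x ∧ ‖f'‖ ≤ σ) :
    ‖f b - f a‖ ≤ σ * (b - a) := by
  obtain ⟨g, hg, hgv⟩ := exists_dual_vector'' ℝ (f b - f a)
  have hgac : AbsolutelyContinuousOnInterval (g ∘ f) a b :=
    hf.comp_of_dist_le (K := ‖g‖) fun s _ t _ => g.lipschitz.dist_le_mul _ _
  have h1 := hgac.integral_deriv_eq_sub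
  have h2 : ‖∫ x in a..b, deriv (g ∘ f) x‖ ≤ σ * |b - a| := by
    apply intervalIntegral.norm_integral_le_of_norm_le_const_ae
    filter_upwards [hd] with x hx hxab
    rw [uIoc_of_le hab] at hxab
    obtain ⟨f', hf', hσ⟩ := hx (Ioc_subset_Icc_self hxab)
    have h3 : HasDerivAt (g ∘ f) (g f') x := g.hasFDerivAt.comp_hasDerivAt x hf'
    rw [h3.deriv]
    calc ‖g f'‖ ≤ ‖g‖ * ‖f'‖ := g.le_opNorm _
      _ ≤ 1 * ‖f'‖ := by gcongr
      _ ≤ σ := by rwa [one_mul]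
  rw [h1, abs_of_nonneg (sub_nonneg.2 hab)] at h2
  have h4 : (g ∘ f) b - (g ∘ f) a = ‖f b - f a‖ := by
    rw [Function.comp_apply, Function.comp_apply, ← map_sub, hgv]
    rfl
  rw [h4] at h2
  exact (le_abs_self _).trans h2

/-- The lemma of du Bois-Reymond, for bounded coefficients and Lipschitz test functions. -/
theorem ae_eq_const_add_integral_of_forall_integral_eq_zero {m n : ℝ → ℝ} {A : ℝ}
    (hm : Measurable m) (hn : Measurable n) (hmA : ∀ t, |m t| ≤ A) (hnA : ∀ t, |n t| ≤ A)
    (h : ∀ (ζ : ℝ → ℝ) (K : ℝ≥0), LipschitzWith K ζ → ζ 0 = 0 → ζ 1 = 0 →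
      ∫ t in (0 : ℝ)..1, (m t * deriv ζ t + n t * ζ t) = 0) :
    ∃ κ, ∀ᵐ t, t ∈ Icc (0 : ℝ) 1 → m t = κ + ∫ s in (0 : ℝ)..t, n s := by
  have hlip : ∀ (f : ℝ → ℝ) (C : ℝ), Measurable f → (∀ t, |f t| ≤ C) →
      LocallyIntegrable f volume ∧ (∀ a b, IntervalIntegrable f volume a b) ∧
      ∃ K : ℝ≥0, LipschitzWith K (fun t => ∫ s in (0 : ℝ)..t, f s) := by
    intro f C hf hfC
    have h0 : ∀ a b, IntervalIntegrable f volume a b := fun a b =>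
      (intervalIntegrable_const (c := C)).mono_fun hf.aestronglyMeasurable
        (Eventually.of_forall fun t => by
          simpa using (hfC t).trans (le_abs_self C))
    refine ⟨?_, h0, C.toNNReal, LipschitzWith.of_dist_le_mul fun a b => ?_⟩
    · exact (locallyIntegrable_const C).mono hf.aestronglyMeasurable
        (Eventually.of_forall fun t => by
          simpa using (hfC t).trans (le_abs_self C))
    · have hC : 0 ≤ C := (abs_nonneg _).trans (hfC 0)
      rw [Real.coe_toNNReal _ hC, dist_eq_norm, Real.dist_eq,
        intervalIntegral.integral_interval_sub_left (h0 _ _) (h0 _ _)]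
      exact intervalIntegral.norm_integral_le_of_norm_le_const fun t _ => hfC t
  obtain ⟨hnl, hni, Kn, hKn⟩ := hlip n A hn hnA
  set N : ℝ → ℝ := fun t => ∫ s in (0 : ℝ)..t, n s with hN
  have hNd : ∀ᵐ t, HasDerivAt N (n t) t := by
    filter_upwards [LocallyIntegrable.ae_hasDerivAt_integral hnl] with t ht using ht 0
  -- the difference `m - N`, cut off outside the unit interval
  set q : ℝ → ℝ := fun t => (Icc (0 : ℝ) 1).indicator (fun t => m t - N t) t with hq
  have hqm : Measurable q := (hm.sub hKn.continuous.measurable).indicator measurableSet_Icc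
  have hqA : ∀ t, |q t| ≤ A + Kn := by
    intro t
    have hA : 0 ≤ A := (abs_nonneg _).trans (hmA 0)
    by_cases ht : t ∈ Icc (0 : ℝ) 1
    · simp only [hq, indicator_of_mem ht]
      have h1 := hKn.dist_le_mul t 0
      have h2 : N 0 = 0 := by simp [hN]
      rw [h2, Real.dist_eq, sub_zero, Real.dist_eq, sub_zero] at h1
      have h3 : (Kn : ℝ) * |t| ≤ Kn := mul_le_of_le_one_right Kn.2 (by
        rw [abs_of_nonneg ht.1]; exact ht.2)
      linarith [abs_sub (m t) (N t), hmA t]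
    · simp only [hq, indicator_of_notMem ht, abs_zero]
      positivity
  -- Subtracting the mean makes the primitive `ζ` of `q - μ` vanish at `1`, so that it is an
  -- admissible test function.
  set μ := ∫ t in (0 : ℝ)..1, q t with hμ
  have hrA : ∀ t, |q t - μ| ≤ A + Kn + |μ| := fun t => (abs_sub _ _).trans (by linarith [hqA t])
  obtain ⟨hrl, hri, Kr, hKr⟩ := hlip (fun t => q t - μ) _ (hqm.sub_const μ) hrA
  set ζ : ℝ → ℝ := fun t => ∫ s in (0 : ℝ)..t, (q s - μ) with hζ
  have hζd : ∀ᵐ t, HasDerivAt ζ (q t - μ) t := by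
    filter_upwards [LocallyIntegrable.ae_hasDerivAt_integral hrl] with t ht using ht 0
  obtain ⟨-, hqi, -⟩ := hlip q _ hqm hqA
  have hζ0 : ζ 0 = 0 := by simp [hζ]
  have hζ1 : ζ 1 = 0 := by
    simp only [hζ]
    rw [intervalIntegral.integral_sub (hqi 0 1) intervalIntegrable_const]
    simp [hμ]
  have h1 := h ζ Kr hKr hζ0 hζ1
  have hNac : AbsolutelyContinuousOnInterval N 0 1 :=
    (hKn.lipschitzOnWith (s := uIcc 0 1)).absolutelyContinuousOnInterval
  have hζac : AbsolutelyContinuousOnInterval ζ 0 1 :=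
    (hKr.lipschitzOnWith (s := uIcc 0 1)).absolutelyContinuousOnInterval
  have h2 := hNac.integral_deriv_mul_eq_sub hζac
  rw [hζ0, hζ1, mul_zero, mul_zero, sub_zero] at h2
  -- Integration by parts turns `n ζ` into `-N ζ'`, so the hypothesis says that `m - N` is
  -- orthogonal to `ζ' = q - μ`. Constants are orthogonal to it too, hence so is `q - μ` itself.
  have hsq : ∫ t in (0 : ℝ)..1, (q t - μ) * (q t - μ) = 0 := by
    have e1 : ∫ t in (0 : ℝ)..1, (m t * deriv ζ t + n t * ζ t) =
        ∫ t in (0 : ℝ)..1, (m t * (q t - μ) + n t * ζ t) := by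
      apply intervalIntegral.integral_congr_ae
      filter_upwards [hζd] with t ht _
      rw [ht.deriv]
    have e2 : ∫ t in (0 : ℝ)..1, (deriv N t * ζ t + N t * deriv ζ t) =
        ∫ t in (0 : ℝ)..1, (n t * ζ t + N t * (q t - μ)) := by
      apply intervalIntegral.integral_congr_ae
      filter_upwards [hζd, hNd] with t ht ht' _
      rw [ht.deriv, ht'.deriv]
    have i1 : IntervalIntegrable (fun t => n t * ζ t) volume 0 1 :=
      (hni 0 1).mul_continuousOn hKr.continuous.continuousOn
    have i2 : IntervalIntegrable (fun t => m t * (q t - μ)) volume 0 1 :=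
      (hlip _ (A * (A + Kn + |μ|)) (hm.mul (hqm.sub_const μ)) fun t => by
        rw [Pi.mul_apply, abs_mul]
        exact mul_le_mul (hmA t) (hrA t) (abs_nonneg _) ((abs_nonneg _).trans (hmA t))).2.1 0 1
    have i3 : IntervalIntegrable (fun t => N t * (q t - μ)) volume 0 1 :=
      (hri 0 1).continuousOn_mul hKn.continuous.continuousOn
    have i4 : IntervalIntegrable (fun t => μ * (q t - μ)) volume 0 1 := (hri 0 1).const_mul μ
    have e3 : ∫ t in (0 : ℝ)..1, (q t - μ) * (q t - μ) =
        (∫ t in (0 : ℝ)..1, (m t * (q t - μ) + n t * ζ t)) -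
        (∫ t in (0 : ℝ)..1, (n t * ζ t + N t * (q t - μ))) -
        ∫ t in (0 : ℝ)..1, μ * (q t - μ) := by
      rw [← intervalIntegral.integral_sub (i2.add i1) (i1.add i3),
        ← intervalIntegral.integral_sub ((i2.add i1).sub (i1.add i3)) i4]
      apply intervalIntegral.integral_congr
      intro t ht
      rw [uIcc_of_le zero_le_one] at ht
      simp only [hq, indicator_of_mem ht]
      ring
    have e4 : ∫ t in (0 : ℝ)..1, μ * (q t - μ) = 0 := by
      rw [intervalIntegral.integral_const_mul]
      have : ∫ t in (0 : ℝ)..1, (q t - μ) = 0 := hζ1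
      rw [this, mul_zero]
    rw [e3, ← e1, h1, ← e2, h2, e4]
    ring
  refine ⟨μ, ?_⟩
  have hri2 : IntervalIntegrable (fun t => (q t - μ) * (q t - μ)) volume 0 1 :=
    (hlip _ ((A + Kn + |μ|) * (A + Kn + |μ|)) ((hqm.sub_const μ).mul (hqm.sub_const μ)) fun t => by
      rw [Pi.mul_apply, abs_mul]
      exact mul_le_mul (hrA t) (hrA t) (abs_nonneg _) ((abs_nonneg _).trans (hrA t))).2.1 0 1
  have h3 := (intervalIntegral.integral_eq_zero_iff_of_nonneg_ae (μ := volume) (a := 0) (b := 1)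
    (f := fun t => (q t - μ) * (q t - μ)) (by
      filter_upwards with t
      exact mul_self_nonneg _) hri2).1 hsq
  rw [Filter.EventuallyEq, ae_restrict_iff' (measurableSet_Ioc.union measurableSet_Ioc)] at h3
  have h0 : ∀ᵐ t : ℝ, t ≠ 0 := by simp [ae_iff, measure_singleton]
  filter_upwards [h3, h0] with t ht ht0 htI
  have h4 := ht (Or.inl ⟨lt_of_le_of_ne htI.1 (Ne.symm ht0), htI.2⟩)
  simp only [Pi.zero_apply, mul_self_eq_zero, hq, indicator_of_mem htI] at h4
  linarith

end AbsolutelyContinuous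

/-! ### Length and energy in a metric ball. -/

section MetricBall

variable {E : Type*} [NormedAddCommGroup E] [NormedSpace ℝ E]

instance instNormedAddCommGroupTrilin : NormedAddCommGroup (E →L[ℝ] E →L[ℝ] E →L[ℝ] ℝ) :=
  ContinuousLinearMap.toNormedAddCommGroup

instance instNormedSpaceTrilin : NormedSpace ℝ (E →L[ℝ] E →L[ℝ] E →L[ℝ] ℝ) :=
  ContinuousLinearMap.toNormedSpace

/-- Uniform control, on a ball of a chart `X`, of a Riemannian metric `G` and of the distance that
it induces. -/
structure IsMetricBall {M : Type*} [MetricSpace M] (X : E → M) (G : E → E →L[ℝ] E →L[ℝ] ℝ)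
    (a₀ : E) (R c C : ℝ) : Prop where
  pos_radius : 0 < R
  pos_const : 0 < c
  symm : ∀ a v w, G a v w = G a w v
  coercive : ∀ a ∈ Metric.ball a₀ R, ∀ v, c * ‖v‖ ^ 2 ≤ G a v v
  norm_le : ∀ a ∈ Metric.ball a₀ R, ‖G a‖ ≤ C
  differentiableAt : ∀ a ∈ Metric.ball a₀ R, DifferentiableAt ℝ G a
  norm_fderiv_le : ∀ a ∈ Metric.ball a₀ R, ‖fderiv ℝ G a‖ ≤ C
  norm_fderiv_sub_le : ∀ a ∈ Metric.ball a₀ R, ∀ b ∈ Metric.ball a₀ R,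
    ‖fderiv ℝ G a - fderiv ℝ G b‖ ≤ C * ‖a - b‖
  le_dist : ∀ a ∈ Metric.ball a₀ R, ∀ b ∈ Metric.ball a₀ R, c * ‖a - b‖ ≤ dist (X a) (X b)
  dist_le : ∀ a ∈ Metric.ball a₀ R, ∀ b ∈ Metric.ball a₀ R, dist (X a) (X b) ≤ C * ‖a - b‖
  strict : ∀ a ∈ Metric.ball a₀ R, ∀ ε > 0, ∃ δ > 0, ∀ x ∈ Metric.ball a δ,
    ∀ y ∈ Metric.ball a δ, |dist (X x) (X y) - √(G a (y - x) (y - x))| ≤ ε * ‖y - x‖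

namespace IsMetricBall

variable {M : Type*} [MetricSpace M] {X : E → M} {G : E → E →L[ℝ] E →L[ℝ] ℝ}
    {a₀ : E} {R c C : ℝ} (h : IsMetricBall X G a₀ R c C)
include h

theorem nonneg_const : 0 ≤ C :=
  (norm_nonneg _).trans (h.norm_le a₀ (Metric.mem_ball_self h.pos_radius))

theorem continuousOn : ContinuousOn G (Metric.ball a₀ R) := fun a ha =>
  (h.differentiableAt a ha).continuousAt.continuousWithinAt

theorem nonneg {a : E} (ha : a ∈ Metric.ball a₀ R) (v : E) : 0 ≤ G a v v :=
  (mul_nonneg h.pos_const.le (sq_nonneg _)).trans (h.coercive a ha v)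

theorem norm_sub_le {a b : E} (ha : a ∈ Metric.ball a₀ R) (hb : b ∈ Metric.ball a₀ R) :
    ‖G b - G a‖ ≤ C * ‖b - a‖ :=
  (convex_ball a₀ R).norm_image_sub_le_of_norm_hasFDerivWithin_le
    (fun z hz => (h.differentiableAt z hz).hasFDerivAt.hasFDerivWithinAt)
    (fun z hz => h.norm_fderiv_le z hz) ha hb

theorem norm_taylor_le {a b : E} (ha : a ∈ Metric.ball a₀ R) (hb : b ∈ Metric.ball a₀ R) :
    ‖G b - G a - fderiv ℝ G a (b - a)‖ ≤ C * ‖b - a‖ ^ 2 := by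
  -- On the intersection with the closed ball of radius `‖b - a‖` around `a`, the derivative of `G`
  -- varies by at most `C ‖b - a‖`; this gives the quadratic remainder.
  have h1 := ((convex_ball a₀ R).inter
    (convex_closedBall a ‖b - a‖)).norm_image_sub_le_of_norm_hasFDerivWithin_le'
    (f := G) (f' := fun z => fderiv ℝ G z) (φ := fderiv ℝ G a) (C := C * ‖b - a‖)
    (fun z hz => (h.differentiableAt z hz.1).hasFDerivAt.hasFDerivWithinAt)
    (fun z hz => (h.norm_fderiv_sub_le z hz.1 a ha).trans (by
      have := h.nonneg_const
      gcongr
      simpa [dist_eq_norm] using hz.2)) (x := a) (y := b) ⟨ha, by simp⟩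
    ⟨hb, by simp [dist_eq_norm]⟩
  calc _ ≤ C * ‖b - a‖ * ‖b - a‖ := h1
    _ = _ := by ring

/-- Metric speed equals Riemannian speed: strict differentiability of the distance along the
diagonal allows its replacement by the norm of the increment, which is the norm of a slope. -/
theorem tendsto_dist_div {v : ℝ → E} {v' : E} {t : ℝ} (hv : HasDerivAt v v' t)
    (ht : v t ∈ Metric.ball a₀ R) :
    Tendsto (fun s => dist (X (v t)) (X (v s)) / |s - t|) (𝓝[≠] t)
      (𝓝 √(G (v t) v' v')) := by
  have hs := hasDerivAt_iff_tendsto_slope.1 hv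
  have hcont : Continuous fun w : E => √(G (v t) w w) := by
    apply Real.continuous_sqrt.comp
    fun_prop
  have h1 : Tendsto (fun s => √(G (v t) (slope v t s) (slope v t s))) (𝓝[≠] t)
      (𝓝 √(G (v t) v' v')) := (hcont.tendsto v').comp hs
  have h2 : Tendsto (fun s => dist (X (v t)) (X (v s)) / |s - t| -
      √(G (v t) (slope v t s) (slope v t s))) (𝓝[≠] t) (𝓝 0) := by
    rw [Metric.tendsto_nhds]
    intro ε hε
    obtain ⟨δ, hδ, hδ'⟩ := h.strict (v t) ht (ε / (‖v'‖ + 2)) (by positivity)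
    have e1 : ∀ᶠ s in 𝓝[≠] t, v s ∈ Metric.ball (v t) δ :=
      (hv.continuousAt.eventually (Metric.ball_mem_nhds _ hδ)).filter_mono nhdsWithin_le_nhds
    have e2 : ∀ᶠ s in 𝓝[≠] t, ‖slope v t s‖ < ‖v'‖ + 1 :=
      hs.norm.eventually (gt_mem_nhds (lt_add_one _))
    filter_upwards [e1, e2, self_mem_nhdsWithin] with s hs1 hs2 hs3
    have hne : s - t ≠ 0 := sub_ne_zero.2 hs3
    have hpos : 0 < |s - t| := abs_pos.2 hne
    have hval : √(G (v t) (slope v t s) (slope v t s)) =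
        √(G (v t) (v s - v t) (v s - v t)) / |s - t| := by
      rw [slope_def_module, map_smul, map_smul, smul_apply, smul_eq_mul,
        smul_eq_mul, ← mul_assoc, Real.sqrt_mul (mul_self_nonneg _), Real.sqrt_mul_self_eq_abs,
        abs_inv]
      field_simp
    have hn : ‖v s - v t‖ = ‖slope v t s‖ * |s - t| := by
      rw [slope_def_module, norm_smul, norm_inv, Real.norm_eq_abs]
      field_simp
    rw [hval, ← sub_div, Real.dist_eq, sub_zero, abs_div, abs_abs, div_lt_iff₀ hpos]
    calc _ ≤ ε / (‖v'‖ + 2) * ‖v s - v t‖ := hδ' _ (Metric.mem_ball_self hδ) _ hs1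
      _ = ε / (‖v'‖ + 2) * ‖slope v t s‖ * |s - t| := by rw [hn]; ring
      _ < ε / (‖v'‖ + 2) * (‖v'‖ + 2) * |s - t| := by gcongr; linarith
      _ = ε * |s - t| := by field_simp
  have h3 := h2.add h1
  simpa using h3

/-- The metric speed of a minimizing geodesic is constant, equal to the distance of its endpoints.
-/
theorem metric_deriv_le {u : ℝ → E} {u' : E} {t : ℝ} (hu : IsMinGeodesic (X ∘ u))
    (ht : t ∈ Ioo (0 : ℝ) 1) (hut : u t ∈ Metric.ball a₀ R) (hd : HasDerivAt u u' t) :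
    G (u t) u' u' ≤ dist (X (u 0)) (X (u 1)) ^ 2 := by
  have h1 := h.tendsto_dist_div hd hut
  have h2 : Tendsto (fun s => dist (X (u t)) (X (u s)) / |s - t|) (𝓝[≠] t)
      (𝓝 (dist (X (u 0)) (X (u 1)))) := by
    apply tendsto_const_nhds.congr'
    have h0 : ∀ᶠ s in 𝓝 t, s ∈ Ioo (0 : ℝ) 1 := Ioo_mem_nhds ht.1 ht.2
    have : ∀ᶠ s in 𝓝[≠] t, s ∈ Ioo (0 : ℝ) 1 := h0.filter_mono nhdsWithin_le_nhds
    filter_upwards [this, self_mem_nhdsWithin] with s hs hst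
    have hpos : 0 < |s - t| := abs_pos.2 (sub_ne_zero.2 hst)
    have := hu t (Ioo_subset_Icc_self ht) s (Ioo_subset_Icc_self hs)
    simp only [Function.comp_apply] at this
    rw [this, abs_sub_comm]
    field_simp
  have h3 := tendsto_nhds_unique h1 h2
  rw [← h3, Real.sq_sqrt (h.nonneg hut u')]

theorem lipschitzOnWith_of_isMinGeodesic {u : ℝ → E} (hu : IsMinGeodesic (X ∘ u))
    (hub : ∀ t ∈ Icc (0 : ℝ) 1, u t ∈ Metric.ball a₀ R) {s t : ℝ} (hs : s ∈ Icc (0 : ℝ) 1)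
    (ht : t ∈ Icc (0 : ℝ) 1) : ‖u s - u t‖ ≤ C / c * ‖u 1 - u 0‖ * |s - t| := by
  have h1 := h.le_dist _ (hub s hs) _ (hub t ht)
  have h2 := hu s hs t ht
  simp only [Function.comp_apply] at h2
  have h3 := h.dist_le _ (hub 0 (by simp)) _ (hub 1 (by simp))
  rw [norm_sub_rev (u 0)] at h3
  rw [h2] at h1
  have h4 : |s - t| * dist (X (u 0)) (X (u 1)) ≤ |s - t| * (C * ‖u 1 - u 0‖) := by gcongr
  have hc := h.pos_const
  calc ‖u s - u t‖ = (c * ‖u s - u t‖) / c := by field_simp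
    _ ≤ (|s - t| * (C * ‖u 1 - u 0‖)) / c :=
      div_le_div_of_nonneg_right (h1.trans h4) hc.le
    _ = _ := by ring

variable [FiniteDimensional ℝ E]

theorem intervalIntegrable_energy {v : ℝ → E} {K : ℝ≥0} (hv : LipschitzWith K v)
    (hvb : ∀ t ∈ Icc (0 : ℝ) 1, v t ∈ Metric.ball a₀ R) :
    IntervalIntegrable (fun t => G (v t) (deriv v t) (deriv v t)) volume 0 1 := by
  have h1 : ContinuousOn (fun t => G (v t)) (Ioc 0 1) :=
    h.continuousOn.comp hv.continuous.continuousOn fun t ht => hvb t (Ioc_subset_Icc_self ht)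
  have hm : AEStronglyMeasurable (fun t => G (v t) (deriv v t) (deriv v t))
      (volume.restrict (Ioc 0 1)) := by
    have h2 := h1.aestronglyMeasurable (μ := volume) measurableSet_Ioc
    have h3 : AEStronglyMeasurable (deriv v) (volume.restrict (Ioc (0 : ℝ) 1)) :=
      aestronglyMeasurable_deriv _ _
    exact (ContinuousLinearMap.id ℝ (E →L[ℝ] ℝ)).aestronglyMeasurable_comp₂
      ((ContinuousLinearMap.id ℝ (E →L[ℝ] E →L[ℝ] ℝ)).aestronglyMeasurable_comp₂ h2 h3) h3
  rw [intervalIntegrable_iff_integrableOn_Ioc_of_le zero_le_one]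
  refine Integrable.of_bound hm (C * K * K) ?_
  rw [ae_restrict_iff' measurableSet_Ioc]
  filter_upwards with t ht
  calc _ ≤ ‖G (v t)‖ * ‖deriv v t‖ * ‖deriv v t‖ := (G (v t)).le_opNorm₂ _ _
    _ ≤ C * K * K := by
      have := h.norm_le _ (hvb t (Ioc_subset_Icc_self ht))
      have h3 := norm_deriv_le_of_lipschitz (x₀ := t) hv
      have := h.nonneg_const
      gcongr

/-- The distance from the starting point grows at most at the Riemannian speed. Integrating this and
comparing speed with its square bounds the squared distance by the energy. -/
theorem dist_sq_le_energy {v : ℝ → E} {K : ℝ≥0} (hv : LipschitzWith K v)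
    (hvb : ∀ t ∈ Icc (0 : ℝ) 1, v t ∈ Metric.ball a₀ R) :
    dist (X (v 0)) (X (v 1)) ^ 2 ≤ ∫ t in (0 : ℝ)..1, G (v t) (deriv v t) (deriv v t) := by
  set D := dist (X (v 0)) (X (v 1)) with hD
  have hint := h.intervalIntegrable_energy hv hvb
  set f : ℝ → ℝ := fun t => dist (X (v 0)) (X (v t)) with hf
  have hfac : AbsolutelyContinuousOnInterval f 0 1 := by
    have : LipschitzOnWith (C * K).toNNReal f (uIcc 0 1) := by
      apply LipschitzOnWith.of_dist_le_mul
      intro s hs t ht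
      rw [uIcc_of_le zero_le_one] at hs ht
      have hC := h.nonneg_const
      rw [Real.coe_toNNReal _ (by positivity)]
      calc dist (f s) (f t) ≤ dist (X (v s)) (X (v t)) := by
            simp only [hf, dist_comm (X (v 0)), Real.dist_eq]
            exact abs_dist_sub_le _ _ _
        _ ≤ C * ‖v s - v t‖ := h.dist_le _ (hvb s hs) _ (hvb t ht)
        _ ≤ C * (K * dist s t) := by
          gcongr
          rw [← dist_eq_norm]
          exact hv.dist_le_mul s t
        _ = _ := by ring
    exact this.absolutelyContinuousOnInterval
  have h1 := hfac.integral_deriv_eq_sub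
  have hfd : ∀ᵐ t, t ∈ Ioo (0 : ℝ) 1 → deriv f t ≤ √(G (v t) (deriv v t) (deriv v t)) := by
    filter_upwards [hfac.ae_differentiableAt, hv.ae_differentiableAt_real] with t ht1 ht2 ht
    have htI : t ∈ Icc (0 : ℝ) 1 := Ioo_subset_Icc_self ht
    have hd := (ht1 (by rwa [uIcc_of_le zero_le_one])).hasDerivAt
    have h2 := h.tendsto_dist_div ht2.hasDerivAt (hvb t htI)
    have h3 := hasDerivAt_iff_tendsto_slope.1 hd
    have hmono : 𝓝[>] t ≤ 𝓝[≠] t := nhdsWithin_mono _ fun s hs => ne_of_gt hs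
    refine le_of_tendsto_of_tendsto (h3.mono_left hmono) (h2.mono_left hmono) ?_
    filter_upwards [self_mem_nhdsWithin] with s hs
    have hs' : 0 < s - t := sub_pos.2 hs
    rw [slope_def_field, abs_of_pos hs']
    gcongr
    simp only [hf]
    linarith [dist_triangle (X (v 0)) (X (v t)) (X (v s))]
  rcases eq_or_ne D 0 with h0 | h0
  · rw [h0, zero_pow two_ne_zero]
    exact intervalIntegral.integral_nonneg zero_le_one fun t ht => h.nonneg (hvb t ht) _
  have hDpos : 0 < D := lt_of_le_of_ne dist_nonneg (Ne.symm h0)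
  -- The arithmetic-geometric inequality with weight `D` stands in for Cauchy-Schwarz: it integrates
  -- to `D ≤ energy / (2 D) + D / 2`.
  have h4 : D ≤ ∫ t in (0 : ℝ)..1, (G (v t) (deriv v t) (deriv v t) / (2 * D) + D / 2) := by
    have e : f 1 - f 0 = D := by simp [hf, hD]
    refine (e.symm.trans h1.symm).trans_le ?_
    apply intervalIntegral.integral_mono_ae_restrict zero_le_one hfac.intervalIntegrable_deriv
      ((hint.div_const _).add intervalIntegrable_const)
    rw [Filter.EventuallyLE, ae_restrict_congr_set Ioo_ae_eq_Icc.symm,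
      ae_restrict_iff' measurableSet_Ioo]
    filter_upwards [hfd] with t ht htI
    refine (ht htI).trans ?_
    have hg := h.nonneg (hvb t (Ioo_subset_Icc_self htI)) (deriv v t)
    have h6 : √(G (v t) (deriv v t) (deriv v t)) * (2 * D) ≤
        G (v t) (deriv v t) (deriv v t) + D ^ 2 := by
      nlinarith [Real.sq_sqrt hg, sq_nonneg (√(G (v t) (deriv v t) (deriv v t)) - D)]
    rw [← le_div_iff₀ (by positivity)] at h6
    refine h6.trans (le_of_eq ?_)
    field_simp
  rw [intervalIntegral.integral_add (hint.div_const _) intervalIntegrable_const,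
    intervalIntegral.integral_div] at h4
  simp only [intervalIntegral.integral_const, sub_zero, one_smul] at h4
  have h5 : D / 2 ≤ (∫ t in (0 : ℝ)..1, G (v t) (deriv v t) (deriv v t)) / (2 * D) := by
    linarith
  rw [le_div_iff₀ (by positivity)] at h5
  linarith

/-- So minimizing geodesics also minimize energy among Lipschitz curves in the ball with the same
endpoints; the energy, unlike the length, can be varied. -/
theorem energy_eq {u : ℝ → E} (hu : IsMinGeodesic (X ∘ u)) {K : ℝ≥0} (hv : LipschitzWith K u)
    (hub : ∀ t ∈ Icc (0 : ℝ) 1, u t ∈ Metric.ball a₀ R) :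
    ∫ t in (0 : ℝ)..1, G (u t) (deriv u t) (deriv u t) = dist (X (u 0)) (X (u 1)) ^ 2 := by
  refine le_antisymm ?_ (h.dist_sq_le_energy hv hub)
  calc ∫ t in (0 : ℝ)..1, G (u t) (deriv u t) (deriv u t)
      ≤ ∫ t in (0 : ℝ)..1, dist (X (u 0)) (X (u 1)) ^ 2 := by
        apply intervalIntegral.integral_mono_ae_restrict zero_le_one
          (h.intervalIntegrable_energy hv hub) intervalIntegrable_const
        rw [Filter.EventuallyLE, ae_restrict_congr_set Ioo_ae_eq_Icc.symm,
          ae_restrict_iff' measurableSet_Ioo]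
        filter_upwards [hv.ae_differentiableAt_real] with t ht htI
        exact h.metric_deriv_le hu htI (hub t (Ioo_subset_Icc_self htI)) ht.hasDerivAt
    _ = _ := by simp

end IsMetricBall
end MetricBall

/-! ### First variation of the energy and the integrated Euler-Lagrange equation. -/

section EulerLagrange

variable {E : Type*} [NormedAddCommGroup E] [NormedSpace ℝ E]

/-- Second order expansion of `G v' v'` around `A x x`, where `G = A + s z B + O(s²)` and
`v' = x + s τ e`. -/
theorem bilin_variation_le {A G B : E →L[ℝ] E →L[ℝ] ℝ} {x e : E} {s z τ C k K ε : ℝ}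
    (hsymm : ∀ v w, A v w = A w v) (hA : ‖A‖ ≤ C) (hB : ‖B‖ ≤ C * ε) (he : ‖e‖ ≤ ε)
    (hG : ‖G - A - (s * z) • B‖ ≤ C * (s * k * ε) ^ 2) (hx : ‖x‖ ≤ K) (hz : |z| ≤ k)
    (hτ : |τ| ≤ k) (hs : |s| ≤ 1) :
    G (x + (s * τ) • e) (x + (s * τ) • e) ≤ A x x + s * (2 * A x e * τ + B x x * z) +
      s ^ 2 * (C * (k * ε) ^ 2 * (K + k * ε) ^ 2 + C * (k * ε) ^ 2 +
        k * (C * ε) * (2 * K * (k * ε) + (k * ε) ^ 2)) := by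
  have hC : 0 ≤ C := (norm_nonneg _).trans hA
  have hk : 0 ≤ k := (abs_nonneg _).trans hz
  have hK : 0 ≤ K := (norm_nonneg _).trans hx
  have hε : 0 ≤ ε := (norm_nonneg _).trans he
  have hτe : ‖τ • e‖ ≤ k * ε := by
    rw [norm_smul, Real.norm_eq_abs]; gcongr
  set f := τ • e with hf
  have hy : ‖x + s • f‖ ≤ K + k * ε := by
    refine (norm_add_le _ _).trans ?_
    rw [norm_smul, Real.norm_eq_abs]
    have : |s| * ‖f‖ ≤ 1 * (k * ε) := by gcongr
    linarith
  have e1 : (s * τ) • e = s • f := by rw [hf, smul_smul]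
  rw [e1]
  have h1 : (G - A - (s * z) • B) (x + s • f) (x + s • f) ≤
      s ^ 2 * (C * (k * ε) ^ 2 * (K + k * ε) ^ 2) := by
    refine (le_abs_self _).trans (((G - A - (s * z) • B).le_opNorm₂ _ _).trans ?_)
    calc _ ≤ C * (s * k * ε) ^ 2 * (K + k * ε) * (K + k * ε) := by gcongr
      _ = _ := by ring
  have h2 : A f f ≤ C * (k * ε) ^ 2 := by
    refine (le_abs_self _).trans ((A.le_opNorm₂ _ _).trans ?_)
    calc _ ≤ C * (k * ε) * (k * ε) := by gcongr
      _ = _ := by ring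
  have h3 : |B x f| ≤ C * ε * (K * (k * ε)) := by
    refine ((B.le_opNorm₂ _ _).trans ?_)
    calc _ ≤ C * ε * K * (k * ε) := by gcongr
      _ = _ := by ring
  have h4 : |B f x| ≤ C * ε * (K * (k * ε)) := by
    refine ((B.le_opNorm₂ _ _).trans ?_)
    calc _ ≤ C * ε * (k * ε) * K := by gcongr
      _ = _ := by ring
  have h5 : |B f f| ≤ C * ε * (k * ε) ^ 2 := by
    refine ((B.le_opNorm₂ _ _).trans ?_)
    calc _ ≤ C * ε * (k * ε) * (k * ε) := by gcongr
      _ = _ := by ring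
  have h6 : z * (B x f + B f x + s * B f f) ≤
      k * (C * ε) * (2 * K * (k * ε) + (k * ε) ^ 2) := by
    refine (le_abs_self _).trans ?_
    rw [abs_mul]
    calc |z| * |B x f + B f x + s * B f f| ≤ k * (|B x f| + |B f x| + 1 * |B f f|) := by
          gcongr
          refine (abs_add_le _ _).trans ?_
          rw [abs_mul]
          gcongr
          exact abs_add_le _ _
      _ ≤ k * (C * ε * (K * (k * ε)) + C * ε * (K * (k * ε)) + 1 * (C * ε * (k * ε) ^ 2)) := by
          gcongr
      _ = _ := by ring
  have h7 : A x f = A x e * τ := by rw [hf, map_smul, smul_eq_mul, mul_comm]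
  have hexp : G (x + s • f) (x + s • f) = (G - A - (s * z) • B) (x + s • f) (x + s • f) +
      (A x x + s * (2 * A x f + B x x * z)) +
      s ^ 2 * (A f f + z * (B x f + B f x + s * B f f)) := by
    simp only [sub_apply, smul_apply, map_add, map_smul, add_apply, smul_eq_mul]
    rw [hsymm f x]
    ring
  rw [hexp, h7]
  have h8 : s ^ 2 * (A f f + z * (B x f + B f x + s * B f f)) ≤ s ^ 2 * (C * (k * ε) ^ 2 +
      k * (C * ε) * (2 * K * (k * ε) + (k * ε) ^ 2)) := by gcongr
  linarith

theorem eq_zero_of_forall_add_sq_nonneg {l Q s₀ : ℝ} (hs₀ : 0 < s₀)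
    (h : ∀ s, |s| ≤ s₀ → 0 ≤ s * l + s ^ 2 * Q) : l = 0 := by
  by_contra hl
  have hQ : 0 < |Q| + 1 := by positivity
  set τ := min s₀ (|l| / (2 * (|Q| + 1))) with hτ
  have hl' : 0 < |l| := abs_pos.2 hl
  have hτ0 : 0 < τ := lt_min hs₀ (by positivity)
  have hτ1 : τ ≤ |l| / (2 * (|Q| + 1)) := min_le_right _ _
  rw [le_div_iff₀ (by positivity)] at hτ1
  have key : ∀ s, |s| = τ → s * l = -(τ * |l|) → False := by
    intro s hs hsl
    have h1 := h s (hs.le.trans (min_le_left _ _))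
    rw [hsl, ← sq_abs s, hs] at h1
    have h2 : τ ^ 2 * Q ≤ τ ^ 2 * |Q| := by gcongr; exact le_abs_self Q
    nlinarith [mul_pos hτ0 hl', abs_nonneg Q, sq_nonneg τ]
  rcases lt_or_gt_of_ne hl with h0 | h0
  · exact key τ (abs_of_pos hτ0) (by rw [abs_of_neg h0]; ring)
  · exact key (-τ) (by rw [abs_neg, abs_of_pos hτ0]) (by rw [abs_of_pos h0]; ring)

namespace IsMetricBall

variable {M : Type*} [MetricSpace M] {X : E → M} {G : E → E →L[ℝ] E →L[ℝ] ℝ}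
    {a₀ : E} {R c C : ℝ} (h : IsMetricBall X G a₀ R c C)
include h

theorem continuousOn_fderiv : ContinuousOn (fderiv ℝ G) (Metric.ball a₀ R) := by
  have : LipschitzOnWith C.toNNReal (fderiv ℝ G) (Metric.ball a₀ R) := by
    apply LipschitzOnWith.of_dist_le_mul
    intro a ha b hb
    rw [Real.coe_toNNReal _ h.nonneg_const, dist_eq_norm, dist_eq_norm]
    exact h.norm_fderiv_sub_le a ha b hb
  exact this.continuousOn

variable [FiniteDimensional ℝ E]

theorem stronglyMeasurable_bilin {u : ℝ → E} {K : ℝ≥0} (hu : LipschitzWith K u)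
    (hub : ∀ t, u t ∈ Metric.ball a₀ R) (e : E) :
    StronglyMeasurable fun t => G (u t) (deriv u t) e := by
  have h1 : Continuous fun t => G (u t) := h.continuousOn.comp_continuous hu.continuous hub
  have h3 : StronglyMeasurable (deriv u) := stronglyMeasurable_deriv u
  have h4 : Continuous fun p : (E →L[ℝ] E →L[ℝ] ℝ) × E => p.1 p.2 e := by fun_prop
  exact h4.comp_stronglyMeasurable (h1.stronglyMeasurable.prodMk h3)

theorem stronglyMeasurable_fderiv_bilin {u : ℝ → E} {K : ℝ≥0} (hu : LipschitzWith K u)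
    (hub : ∀ t, u t ∈ Metric.ball a₀ R) (e : E) :
    StronglyMeasurable fun t => fderiv ℝ G (u t) e (deriv u t) (deriv u t) := by
  have h1 : Continuous fun t => fderiv ℝ G (u t) :=
    h.continuousOn_fderiv.comp_continuous hu.continuous hub
  have h3 : StronglyMeasurable (deriv u) := stronglyMeasurable_deriv u
  have h4 : Continuous fun p : (E →L[ℝ] E →L[ℝ] E →L[ℝ] ℝ) × E => p.1 e p.2 p.2 := by fun_prop
  exact h4.comp_stronglyMeasurable (h1.stronglyMeasurable.prodMk h3)

omit [FiniteDimensional ℝ E] in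
theorem abs_bilin_le {u : ℝ → E} {K : ℝ≥0} (hu : LipschitzWith K u)
    (hub : ∀ t, u t ∈ Metric.ball a₀ R) (e : E) (t : ℝ) :
    |G (u t) (deriv u t) e| ≤ C * K * ‖e‖ := by
  refine ((G (u t)).le_opNorm₂ _ _).trans ?_
  have := h.norm_le _ (hub t)
  have h3 := norm_deriv_le_of_lipschitz (x₀ := t) hu
  have := h.nonneg_const
  gcongr

omit [FiniteDimensional ℝ E] in
theorem norm_fderiv_apply_le {a : E} (ha : a ∈ Metric.ball a₀ R) (e : E) :
    ‖fderiv ℝ G a e‖ ≤ C * ‖e‖ := by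
  refine ((fderiv ℝ G a).le_opNorm _).trans ?_
  gcongr
  exact h.norm_fderiv_le _ ha

omit [FiniteDimensional ℝ E] in
theorem abs_fderiv_bilin_le {u : ℝ → E} {K : ℝ≥0} (hu : LipschitzWith K u)
    (hub : ∀ t, u t ∈ Metric.ball a₀ R) (e : E) (t : ℝ) :
    |fderiv ℝ G (u t) e (deriv u t) (deriv u t)| ≤ C * ‖e‖ * K * K := by
  refine ((fderiv ℝ G (u t) e).le_opNorm₂ _ _).trans ?_
  have := h.norm_fderiv_apply_le (hub t) e
  have h3 := norm_deriv_le_of_lipschitz (x₀ := t) hu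
  have := h.nonneg_const
  gcongr

theorem intervalIntegrable_fderiv_bilin {u : ℝ → E} {K : ℝ≥0} (hu : LipschitzWith K u)
    (hub : ∀ t, u t ∈ Metric.ball a₀ R) (e : E) (a b : ℝ) :
    IntervalIntegrable (fun t => fderiv ℝ G (u t) e (deriv u t) (deriv u t)) volume a b :=
  (intervalIntegrable_const (c := C * ‖e‖ * K * K)).mono_fun
    (h.stronglyMeasurable_fderiv_bilin hu hub e).aestronglyMeasurable
    (Eventually.of_forall fun t => by
      simpa using (h.abs_fderiv_bilin_le hu hub e t).trans (le_abs_self _))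

/-- The curve `u + s ζ e` has the endpoints of `u`, hence at least its energy. The difference of
energies is at most `s l + s² Q`, with `l` the integral below, and nonnegativity for small `s` of
both signs forces `l = 0`. -/
theorem integral_first_variation_eq_zero {u : ℝ → E} (hmin : IsMinGeodesic (X ∘ u)) {K : ℝ≥0}
    (hu : LipschitzWith K u) (hub : ∀ t, u t ∈ Metric.ball a₀ (R / 2)) (e : E)
    {ζ : ℝ → ℝ} {k : ℝ≥0} (hζ : LipschitzWith k ζ) (h0 : ζ 0 = 0) (h1 : ζ 1 = 0) :
    ∫ t in (0 : ℝ)..1, (2 * G (u t) (deriv u t) e * deriv ζ t +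
      fderiv ℝ G (u t) e (deriv u t) (deriv u t) * ζ t) = 0 := by
  have hR := h.pos_radius
  have hC := h.nonneg_const
  have hub' : ∀ t, u t ∈ Metric.ball a₀ R := fun t =>
    Metric.ball_subset_ball (by linarith) (hub t)
  have hζk : ∀ t ∈ Icc (0 : ℝ) 1, |ζ t| ≤ k := by
    intro t ht
    have := hζ.dist_le_mul t 0
    rw [h0, Real.dist_eq, Real.dist_eq, sub_zero, sub_zero, abs_of_nonneg ht.1] at this
    exact this.trans (mul_le_of_le_one_right k.2 ht.2)
  have hζ' : ∀ t, |deriv ζ t| ≤ k := fun t => norm_deriv_le_of_lipschitz (x₀ := t) hζ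
  set Q : ℝ := C * (k * ‖e‖) ^ 2 * (K + k * ‖e‖) ^ 2 + C * (k * ‖e‖) ^ 2 +
        k * (C * ‖e‖) * (2 * K * (k * ‖e‖) + (k * ‖e‖) ^ 2) with hQ
  set l : ℝ → ℝ := fun t => 2 * G (u t) (deriv u t) e * deriv ζ t +
      fderiv ℝ G (u t) e (deriv u t) (deriv u t) * ζ t with hl
  have hlm : StronglyMeasurable l :=
    (((h.stronglyMeasurable_bilin hu hub' e).const_mul 2).mul (stronglyMeasurable_deriv ζ)).add
      ((h.stronglyMeasurable_fderiv_bilin hu hub' e).mul hζ.continuous.stronglyMeasurable)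
  have hlint : IntervalIntegrable l volume 0 1 := by
    rw [intervalIntegrable_iff_integrableOn_Ioc_of_le zero_le_one]
    refine Integrable.of_bound hlm.aestronglyMeasurable
      (2 * (C * K * ‖e‖) * k + C * ‖e‖ * K * K * k) ?_
    rw [ae_restrict_iff' measurableSet_Ioc]
    filter_upwards with t ht
    refine (norm_add_le _ _).trans ?_
    rw [norm_mul, norm_mul, norm_mul, Real.norm_ofNat]
    have e1 := h.abs_bilin_le hu hub' e t
    have e2 := h.abs_fderiv_bilin_le hu hub' e t
    have e3 := hζ' t
    have e4 := hζk t (Ioc_subset_Icc_self ht)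
    simp only [Real.norm_eq_abs]
    gcongr
  -- The second entry keeps the varied curve within `R / 2` of `u`, hence in the ball of radius `R`.
  set s₀ : ℝ := min 1 (R / 2 / (k * ‖e‖ + 1)) with hs₀
  have hs₀pos : 0 < s₀ := lt_min one_pos (by positivity)
  apply eq_zero_of_forall_add_sq_nonneg (Q := Q) hs₀pos
  intro s hs
  have hs1 : |s| ≤ 1 := hs.trans (min_le_left _ _)
  have hs2 : |s| * (k * ‖e‖ + 1) ≤ R / 2 := by
    rw [← le_div_iff₀ (by positivity)]; exact hs.trans (min_le_right _ _)
  set v : ℝ → E := fun t => u t + (s * ζ t) • e with hv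
  have hvsub : ∀ t ∈ Icc (0 : ℝ) 1, ‖v t - u t‖ ≤ |s| * (k * ‖e‖) := by
    intro t ht
    simp only [hv, add_sub_cancel_left, norm_smul, norm_mul, Real.norm_eq_abs]
    have := hζk t ht
    calc |s| * |ζ t| * ‖e‖ ≤ |s| * k * ‖e‖ := by gcongr
      _ = _ := by ring
  have hvb : ∀ t ∈ Icc (0 : ℝ) 1, v t ∈ Metric.ball a₀ R := by
    intro t ht
    have h2 := hub t
    rw [Metric.mem_ball] at h2 ⊢
    have h3 := hvsub t ht
    rw [← dist_eq_norm] at h3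
    have := dist_triangle (v t) (u t) a₀
    nlinarith [abs_nonneg s]
  have hvlip : ∃ K', LipschitzWith K' v := by
    refine ⟨K + ‖s‖₊ * k * ‖e‖₊, ?_⟩
    apply LipschitzWith.of_dist_le_mul
    intro t t'
    have e1 : v t - v t' = (u t - u t') + (s * (ζ t - ζ t')) • e := by
      simp only [hv]; module
    have h3 := hu.dist_le_mul t t'
    have h4 := hζ.dist_le_mul t t'
    rw [dist_eq_norm] at h3 h4 ⊢
    rw [e1]
    refine (norm_add_le _ _).trans ?_
    rw [norm_smul, norm_mul]
    push_cast
    calc ‖u t - u t'‖ + ‖s‖ * ‖ζ t - ζ t'‖ * ‖e‖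
        ≤ K * dist t t' + ‖s‖ * (k * dist t t') * ‖e‖ := by gcongr
      _ = _ := by ring
  obtain ⟨K', hvK⟩ := hvlip
  have hD := h.dist_sq_le_energy hvK hvb
  have hE := h.energy_eq hmin hu fun t _ => hub' t
  have hv0 : v 0 = u 0 := by simp [hv, h0]
  have hv1 : v 1 = u 1 := by simp [hv, h1]
  rw [hv0, hv1, ← hE] at hD
  have hgu := h.intervalIntegrable_energy hu fun t _ => hub' t
  have hle : ∫ t in (0 : ℝ)..1, G (v t) (deriv v t) (deriv v t) ≤
      ∫ t in (0 : ℝ)..1, (G (u t) (deriv u t) (deriv u t) + s * l t + s ^ 2 * Q) := by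
    apply intervalIntegral.integral_mono_ae_restrict zero_le_one
      (h.intervalIntegrable_energy hvK hvb)
      ((hgu.add (hlint.const_mul s)).add intervalIntegrable_const)
    rw [Filter.EventuallyLE, ae_restrict_iff' measurableSet_Icc]
    filter_upwards [hu.ae_differentiableAt_real, hζ.ae_differentiableAt_real] with t ht1 ht2 ht
    have hd : deriv v t = deriv u t + (s * deriv ζ t) • e := by
      apply HasDerivAt.deriv
      exact ht1.hasDerivAt.add ((ht2.hasDerivAt.const_mul s).smul_const e)
    rw [hd]
    have hfd : ‖G (v t) - G (u t) - (s * ζ t) • fderiv ℝ G (u t) e‖ ≤ C * (s * k * ‖e‖) ^ 2 := by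
      have e1 : v t - u t = (s * ζ t) • e := by simp [hv]
      have h3 := h.norm_taylor_le (hub' t) (hvb t ht)
      have h4 := hvsub t ht
      rw [e1, map_smul, ← e1] at h3
      refine h3.trans ?_
      calc C * ‖v t - u t‖ ^ 2 ≤ C * (|s| * (k * ‖e‖)) ^ 2 := by gcongr
        _ = C * (|s| ^ 2 * (k * ‖e‖) ^ 2) := by ring
        _ = _ := by rw [sq_abs]; ring
    exact bilin_variation_le (h.symm _) (h.norm_le _ (hub' t))
      (h.norm_fderiv_apply_le (hub' t) e) le_rfl hfd
      (norm_deriv_le_of_lipschitz hu) (hζk t ht) (hζ' t) hs1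
  rw [intervalIntegral.integral_add (hgu.add (hlint.const_mul s)) intervalIntegrable_const,
    intervalIntegral.integral_add hgu (hlint.const_mul s),
    intervalIntegral.integral_const_mul] at hle
  simp only [intervalIntegral.integral_const, sub_zero, one_smul] at hle
  linarith

theorem exists_euler_lagrange_apply {u : ℝ → E} (hmin : IsMinGeodesic (X ∘ u)) {K : ℝ≥0}
    (hu : LipschitzWith K u) (hub : ∀ t, u t ∈ Metric.ball a₀ (R / 2)) (e : E) :
    ∃ κ, ∀ᵐ t, t ∈ Icc (0 : ℝ) 1 → 2 * G (u t) (deriv u t) e =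
      κ + ∫ s in (0 : ℝ)..t, fderiv ℝ G (u s) e (deriv u s) (deriv u s) := by
  have hR := h.pos_radius
  have hC := h.nonneg_const
  have hub' : ∀ t, u t ∈ Metric.ball a₀ R := fun t =>
    Metric.ball_subset_ball (by linarith) (hub t)
  apply ae_eq_const_add_integral_of_forall_integral_eq_zero
    (A := max (2 * (C * K * ‖e‖)) (C * ‖e‖ * K * K))
    ((h.stronglyMeasurable_bilin hu hub' e).const_mul 2).measurable
    (h.stronglyMeasurable_fderiv_bilin hu hub' e).measurable
  · intro t
    refine le_trans ?_ (le_max_left _ _)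
    rw [abs_mul, abs_two]
    gcongr
    exact h.abs_bilin_le hu hub' e t
  · intro t
    exact (h.abs_fderiv_bilin_le hu hub' e t).trans (le_max_right _ _)
  · intro ζ k hζ h0 h1
    exact h.integral_first_variation_eq_zero hmin hu hub e hζ h0 h1

/-- The exceptional null set must not depend on `e`. Both sides are linear in `e`, so the finitely
many null sets of a basis suffice. -/
theorem ae_euler_lagrange {u : ℝ → E} (hmin : IsMinGeodesic (X ∘ u)) {K : ℝ≥0}
    (hu : LipschitzWith K u) (hub : ∀ t, u t ∈ Metric.ball a₀ (R / 2)) :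
    ∃ κ : E → ℝ, ∀ᵐ t, t ∈ Icc (0 : ℝ) 1 → ∀ e, 2 * G (u t) (deriv u t) e =
      κ e + ∫ s in (0 : ℝ)..t, fderiv ℝ G (u s) e (deriv u s) (deriv u s) := by
  have hub' : ∀ t, u t ∈ Metric.ball a₀ R := fun t =>
    Metric.ball_subset_ball (by linarith [h.pos_radius]) (hub t)
  choose κ hκ using h.exists_euler_lagrange_apply hmin hu hub
  set b := Module.finBasis ℝ E
  refine ⟨fun e => ∑ i, b.repr e i * κ (b i), ?_⟩
  filter_upwards [ae_all_iff.2 fun i => hκ (b i)] with t ht htI e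
  have h1 : e = ∑ i, b.repr e i • b i := (b.sum_repr e).symm
  have h2 : ∀ s, fderiv ℝ G (u s) e (deriv u s) (deriv u s) =
      ∑ i, b.repr e i * fderiv ℝ G (u s) (b i) (deriv u s) (deriv u s) := by
    intro s
    conv_lhs => rw [h1, map_sum]
    simp only [_root_.sum_apply, map_smul, smul_apply, smul_eq_mul]
  simp_rw [h2]
  rw [intervalIntegral.integral_finsetSum fun i _ =>
      (h.intervalIntegrable_fderiv_bilin hu hub' (b i) 0 t).const_mul _, ← Finset.sum_add_distrib]
  simp_rw [intervalIntegral.integral_const_mul, ← mul_add]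
  conv_lhs => rw [h1]
  rw [map_sum, Finset.mul_sum]
  refine Finset.sum_congr rfl fun i _ => ?_
  rw [← ht i htI, map_smul, smul_eq_mul]
  ring

end IsMetricBall
end EulerLagrange

/-! ### Dependence of short geodesics on their endpoints. -/

section BoundaryValue

variable {E : Type*} [NormedAddCommGroup E] [NormedSpace ℝ E]

theorem IsMinGeodesic.congr {Y : Type*} [MetricSpace Y] {c c' : ℝ → Y} (hc : IsMinGeodesic c)
    (h : EqOn c' c (Icc 0 1)) : IsMinGeodesic c' := by
  intro s hs t ht
  rw [h hs, h ht, h (left_mem_Icc.2 zero_le_one), h (right_mem_Icc.2 zero_le_one)]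
  exact hc s hs t ht

theorem LipschitzWith.norm_sub_le_of_ae_hasDerivAt {f : ℝ → E} {K : ℝ≥0} (hf : LipschitzWith K f)
    {a b σ : ℝ} (hab : a ≤ b) (hd : ∀ᵐ x, x ∈ Icc a b → ∃ f', HasDerivAt f f' x ∧ ‖f'‖ ≤ σ) :
    ‖f b - f a‖ ≤ σ * (b - a) :=
  AbsolutelyContinuousOnInterval.norm_sub_le hab
    (hf.lipschitzOnWith (s := uIcc a b)).absolutelyContinuousOnInterval hd

namespace IsMetricBall

variable {M : Type*} [MetricSpace M] {X : E → M} {G : E → E →L[ℝ] E →L[ℝ] ℝ}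
    {a₀ : E} {R c C : ℝ} (h : IsMetricBall X G a₀ R c C)
include h

theorem abs_fderiv_bilin_sub_le {a b x y e : E} (ha : a ∈ Metric.ball a₀ R)
    (hb : b ∈ Metric.ball a₀ R) {K w Z : ℝ} (hx : ‖x‖ ≤ K) (hy : ‖y‖ ≤ K) (hab : ‖a - b‖ ≤ w)
    (hxy : ‖x - y‖ ≤ Z) :
    |fderiv ℝ G a e x x - fderiv ℝ G b e y y| ≤ (C * w * K ^ 2 + 2 * C * K * Z) * ‖e‖ := by
  have hC := h.nonneg_const
  have hK : 0 ≤ K := (norm_nonneg _).trans hx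
  have hw : 0 ≤ w := (norm_nonneg _).trans hab
  have hZ : 0 ≤ Z := (norm_nonneg _).trans hxy
  have e1 : fderiv ℝ G a e x x - fderiv ℝ G b e y y =
      (fderiv ℝ G a - fderiv ℝ G b) e x x + fderiv ℝ G b e (x - y) x +
        fderiv ℝ G b e y (x - y) := by
    simp only [sub_apply, map_sub]; ring
  have h1 : |(fderiv ℝ G a - fderiv ℝ G b) e x x| ≤ C * w * ‖e‖ * K * K := by
    refine (((fderiv ℝ G a - fderiv ℝ G b) e).le_opNorm₂ _ _).trans ?_
    have : ‖(fderiv ℝ G a - fderiv ℝ G b) e‖ ≤ C * w * ‖e‖ := by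
      refine ((fderiv ℝ G a - fderiv ℝ G b).le_opNorm _).trans ?_
      gcongr
      exact (h.norm_fderiv_sub_le a ha b hb).trans (by gcongr)
    gcongr
  have hn := h.norm_fderiv_apply_le hb e
  have h2 : |fderiv ℝ G b e (x - y) x| ≤ C * ‖e‖ * Z * K :=
    ((fderiv ℝ G b e).le_opNorm₂ _ _).trans (by gcongr)
  have h3 : |fderiv ℝ G b e y (x - y)| ≤ C * ‖e‖ * K * Z :=
    ((fderiv ℝ G b e).le_opNorm₂ _ _).trans (by gcongr)
  rw [e1]
  calc _ ≤ C * w * ‖e‖ * K * K + C * ‖e‖ * Z * K + C * ‖e‖ * K * Z :=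
        (abs_add_three _ _ _).trans (by gcongr)
    _ = _ := by ring

variable [FiniteDimensional ℝ E]

/-- The difference of the velocities of two geodesics oscillates little. The two Euler-Lagrange
equations are subtracted at the times `s` and `t`, and tested with the increment `e` itself;
coercivity bounds `‖e‖²`. The gain is the factor `K`, small for slow geodesics. -/
theorem norm_velocity_sub_le {u₁ u₂ : ℝ → E} {K : ℝ≥0} (hu₁ : LipschitzWith K u₁)
    (hu₂ : LipschitzWith K u₂) (hub₁ : ∀ t, u₁ t ∈ Metric.ball a₀ R)
    (hub₂ : ∀ t, u₂ t ∈ Metric.ball a₀ R) (hK : K ≤ 1) {κ₁ κ₂ : E → ℝ} {S : Set ℝ}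
    (hS : S ⊆ Icc 0 1) (hae : ∀ᵐ t, t ∈ Icc (0 : ℝ) 1 → t ∈ S)
    (hEL₁ : ∀ t ∈ S, ∀ e, 2 * G (u₁ t) (deriv u₁ t) e =
      κ₁ e + ∫ s in (0 : ℝ)..t, fderiv ℝ G (u₁ s) e (deriv u₁ s) (deriv u₁ s))
    (hEL₂ : ∀ t ∈ S, ∀ e, 2 * G (u₂ t) (deriv u₂ t) e =
      κ₂ e + ∫ s in (0 : ℝ)..t, fderiv ℝ G (u₂ s) e (deriv u₂ s) (deriv u₂ s))
    {w Z : ℝ} (hw : ∀ t ∈ Icc (0 : ℝ) 1, ‖u₁ t - u₂ t‖ ≤ w)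
    (hZ : ∀ t ∈ S, ‖deriv u₁ t - deriv u₂ t‖ ≤ Z) {s t : ℝ} (hs : s ∈ S) (ht : t ∈ S) :
    ‖(deriv u₁ t - deriv u₂ t) - (deriv u₁ s - deriv u₂ s)‖ ≤ C / c * K * (3 * w + 2 * Z) := by
  have hC := h.nonneg_const
  have hc := h.pos_const
  have hK1 : (K : ℝ) ≤ 1 := hK
  set e := (deriv u₁ t - deriv u₂ t) - (deriv u₁ s - deriv u₂ s) with he
  have hw0 : 0 ≤ w := (norm_nonneg _).trans (hw t (hS ht))
  have hZ0 : 0 ≤ Z := (norm_nonneg _).trans (hZ t ht)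
  have hd₁ : ∀ r, ‖deriv u₁ r‖ ≤ K := fun r => norm_deriv_le_of_lipschitz hu₁
  have hd₂ : ∀ r, ‖deriv u₂ r‖ ≤ K := fun r => norm_deriv_le_of_lipschitz hu₂
  have i₁ := h.intervalIntegrable_fderiv_bilin hu₁ hub₁ e
  have i₂ := h.intervalIntegrable_fderiv_bilin hu₂ hub₂ e
  set I := ∫ r in s..t, (fderiv ℝ G (u₁ r) e (deriv u₁ r) (deriv u₁ r) -
    fderiv ℝ G (u₂ r) e (deriv u₂ r) (deriv u₂ r)) with hI
  have hIeq : I = (2 * G (u₁ t) (deriv u₁ t) e - 2 * G (u₂ t) (deriv u₂ t) e) -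
      (2 * G (u₁ s) (deriv u₁ s) e - 2 * G (u₂ s) (deriv u₂ s) e) := by
    rw [hI, intervalIntegral.integral_sub (i₁ _ _) (i₂ _ _), hEL₁ t ht, hEL₂ t ht, hEL₁ s hs,
      hEL₂ s hs, ← intervalIntegral.integral_interval_sub_left (i₁ 0 t) (i₁ 0 s),
      ← intervalIntegral.integral_interval_sub_left (i₂ 0 t) (i₂ 0 s)]
    ring
  have hts : |t - s| ≤ 1 := by
    have := hS hs; have := hS ht
    simp only [mem_Icc] at *
    rw [abs_le]; constructor <;> linarith
  have hIle : |I| ≤ (C * w * K ^ 2 + 2 * C * K * Z) * ‖e‖ := by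
    have h1 : ‖I‖ ≤ (C * w * K ^ 2 + 2 * C * K * Z) * ‖e‖ * |t - s| := by
      apply intervalIntegral.norm_integral_le_of_norm_le_const_ae
      filter_upwards [hae] with r hr hrI
      have hrI' : r ∈ Icc (0 : ℝ) 1 :=
        (ordConnected_Icc.uIcc_subset (hS hs) (hS ht)) (uIoc_subset_uIcc hrI)
      exact h.abs_fderiv_bilin_sub_le (hub₁ r) (hub₂ r) (hd₁ r) (hd₂ r) (hw r hrI')
        (hZ r (hr hrI'))
    exact h1.trans (mul_le_of_le_one_right (by positivity) hts)
  -- The integral accounts for the change of the momenta `G(u) u'`; the other three terms come from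
  -- freezing the base point at `u₁ t`.
  have hkey : G (u₁ t) e e = I / 2 - (G (u₁ t) - G (u₂ t)) (deriv u₂ t) e +
      (G (u₁ s) - G (u₂ s)) (deriv u₂ s) e - (G (u₁ t) - G (u₁ s)) (deriv u₁ s - deriv u₂ s) e := by
    rw [hIeq]
    conv_lhs => rw [show G (u₁ t) e e = G (u₁ t) ((deriv u₁ t - deriv u₂ t) -
      (deriv u₁ s - deriv u₂ s)) e from rfl]
    simp only [sub_apply, map_sub]
    ring
  have b1 : ∀ r ∈ S, |(G (u₁ r) - G (u₂ r)) (deriv u₂ r) e| ≤ C * w * K * ‖e‖ := by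
    intro r hr
    have h1 := h.norm_sub_le (hub₂ r) (hub₁ r)
    have h2 := hw r (hS hr)
    have h3 := hd₂ r
    exact ((G (u₁ r) - G (u₂ r)).le_opNorm₂ _ _).trans (by
      gcongr
      exact h1.trans (by gcongr))
  have b2 : |(G (u₁ t) - G (u₁ s)) (deriv u₁ s - deriv u₂ s) e| ≤ C * K * Z * ‖e‖ := by
    have h1 := h.norm_sub_le (hub₁ s) (hub₁ t)
    have h2 := hu₁.dist_le_mul t s
    rw [dist_eq_norm, Real.dist_eq] at h2
    have h3 := hZ s hs
    refine ((G (u₁ t) - G (u₁ s)).le_opNorm₂ _ _).trans ?_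
    gcongr
    refine h1.trans ?_
    gcongr
    exact h2.trans (mul_le_of_le_one_right K.2 hts)
  have hmain : c * ‖e‖ ^ 2 ≤ C * K * (3 * w + 2 * Z) * ‖e‖ := by
    refine (h.coercive _ (hub₁ t) e).trans ?_
    rw [hkey]
    have h1 := abs_le.1 hIle
    have h2 := abs_le.1 (b1 t ht)
    have h3 := abs_le.1 (b1 s hs)
    have h4 := abs_le.1 b2
    have h5 : C * w * K ^ 2 * ‖e‖ ≤ C * w * K * ‖e‖ := by
      gcongr
      rw [sq]
      exact mul_le_of_le_one_right K.2 hK1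
    nlinarith [mul_nonneg (mul_nonneg (mul_nonneg hC hw0) K.2) (norm_nonneg e)]
  rcases (norm_nonneg e).eq_or_lt with h0 | h0
  · rw [← h0]; positivity
  have h6 : c * ‖e‖ ≤ C * K * (3 * w + 2 * Z) := by
    refine le_of_mul_le_mul_right ?_ h0
    calc c * ‖e‖ * ‖e‖ = c * ‖e‖ ^ 2 := by ring
      _ ≤ _ := hmain
  calc ‖e‖ = c * ‖e‖ / c := by field_simp
    _ ≤ C * K * (3 * w + 2 * Z) / c := div_le_div_of_nonneg_right h6 hc.le
    _ = _ := by ring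

/-- A bootstrap for `B = sup ‖z - δ‖`, where `z` is the difference of the velocities and `δ` its
mean. `B` is at most the oscillation of `z`, which is `K` times a quantity containing `B` again.
When `C / c * K` is small that term is absorbed. -/
theorem norm_sub_sub_smul_le_of_lipschitz {u₁ u₂ : ℝ → E} (hm₁ : IsMinGeodesic (X ∘ u₁))
    (hm₂ : IsMinGeodesic (X ∘ u₂)) {K : ℝ≥0} (hu₁ : LipschitzWith K u₁)
    (hu₂ : LipschitzWith K u₂) (hub₁ : ∀ t, u₁ t ∈ Metric.ball a₀ (R / 2))
    (hub₂ : ∀ t, u₂ t ∈ Metric.ball a₀ (R / 2)) (hK : K ≤ 1) (hK' : 10 * (C / c * K) ≤ 1)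
    {s t : ℝ} (hs : s ∈ Icc (0 : ℝ) 1) (ht : t ∈ Icc (0 : ℝ) 1) (hst : s ≤ t) :
    ‖(u₁ t - u₂ t) - (u₁ s - u₂ s) - (t - s) • ((u₁ 1 - u₂ 1) - (u₁ 0 - u₂ 0))‖ ≤
      10 * (C / c * K) * (‖u₁ 0 - u₂ 0‖ + ‖(u₁ 1 - u₂ 1) - (u₁ 0 - u₂ 0)‖) * (t - s) := by
  have hC := h.nonneg_const
  have hc := h.pos_const
  have hR := h.pos_radius
  have hball : Metric.ball a₀ (R / 2) ⊆ Metric.ball a₀ R :=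
    Metric.ball_subset_ball (by linarith)
  obtain ⟨κ₁, h₁⟩ := h.ae_euler_lagrange hm₁ hu₁ hub₁
  obtain ⟨κ₂, h₂⟩ := h.ae_euler_lagrange hm₂ hu₂ hub₂
  set P : ℝ → Prop := fun t => (∀ e, 2 * G (u₁ t) (deriv u₁ t) e =
      κ₁ e + ∫ s in (0 : ℝ)..t, fderiv ℝ G (u₁ s) e (deriv u₁ s) (deriv u₁ s)) ∧
      (∀ e, 2 * G (u₂ t) (deriv u₂ t) e =
      κ₂ e + ∫ s in (0 : ℝ)..t, fderiv ℝ G (u₂ s) e (deriv u₂ s) (deriv u₂ s)) ∧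
      DifferentiableAt ℝ u₁ t ∧ DifferentiableAt ℝ u₂ t with hP
  set S : Set ℝ := {t | t ∈ Icc (0 : ℝ) 1 ∧ P t} with hSdef
  have hSI : S ⊆ Icc 0 1 := fun t ht => ht.1
  have hae : ∀ᵐ t, t ∈ Icc (0 : ℝ) 1 → t ∈ S := by
    filter_upwards [h₁, h₂, hu₁.ae_differentiableAt_real, hu₂.ae_differentiableAt_real]
      with t a1 a2 a3 a4 htI
    exact ⟨htI, a1 htI, a2 htI, a3, a4⟩
  have hSne : S.Nonempty := by
    by_contra hne
    rw [not_nonempty_iff_eq_empty] at hne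
    rw [hne] at hae
    have h3 : volume (Icc (0 : ℝ) 1) = 0 := by
      refine measure_mono_null (fun t ht => ?_) hae
      simpa using ht
    simp at h3
  set w : ℝ → E := fun t => u₁ t - u₂ t with hw
  set z : ℝ → E := fun t => deriv u₁ t - deriv u₂ t with hz
  set δ := w 1 - w 0 with hδ
  have hwd : ∀ t ∈ S, HasDerivAt w (z t) t := fun t ht =>
    ht.2.2.2.1.hasDerivAt.sub ht.2.2.2.2.hasDerivAt
  have hwl : ∀ e : E, LipschitzWith (K + K + ‖e‖₊) fun t => w t - t • e := fun e =>
    (hu₁.sub hu₂).sub (LipschitzWith.of_dist_le_mul fun s t => by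
      rw [dist_eq_norm, dist_eq_norm, ← sub_smul, norm_smul, mul_comm]; rfl)
  have hsub : ∀ (e : E) (B : ℝ), (∀ t ∈ S, ‖z t - e‖ ≤ B) → ∀ a ∈ Icc (0 : ℝ) 1,
      ∀ b ∈ Icc (0 : ℝ) 1, a ≤ b → ‖w b - w a - (b - a) • e‖ ≤ B * (b - a) := by
    intro e B hB a ha b hb hab
    have := (hwl e).norm_sub_le_of_ae_hasDerivAt (σ := B) hab (by
      filter_upwards [hae] with t ht htab
      have htS := ht ⟨ha.1.trans htab.1, htab.2.trans hb.2⟩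
      refine ⟨z t - e, ?_, hB t htS⟩
      have := (hwd t htS).sub ((hasDerivAt_id t).smul_const e)
      rwa [one_smul] at this)
    convert this using 2
    module
  have h01 : (0 : ℝ) ∈ Icc (0 : ℝ) 1 := by simp
  have h11 : (1 : ℝ) ∈ Icc (0 : ℝ) 1 := by simp
  have hzK : ∀ t, ‖z t - δ‖ ≤ K + K + ‖δ‖ := fun t =>
    (_root_.norm_sub_le _ _).trans (by
      gcongr
      exact (_root_.norm_sub_le _ _).trans
        (add_le_add (norm_deriv_le_of_lipschitz hu₁) (norm_deriv_le_of_lipschitz hu₂)))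
  set B := sSup ((fun t => ‖z t - δ‖) '' S) with hB
  have hBle : ∀ t ∈ S, ‖z t - δ‖ ≤ B := fun t ht =>
    le_csSup ⟨K + K + ‖δ‖, by rintro _ ⟨t, -, rfl⟩; exact hzK t⟩ ⟨t, ht, rfl⟩
  have hZ : ∀ t ∈ S, ‖z t‖ ≤ ‖δ‖ + B := fun t ht => by
    have := norm_add_le δ (z t - δ)
    rw [add_sub_cancel] at this
    linarith [hBle t ht]
  have hB0 : 0 ≤ B := by
    obtain ⟨t, ht⟩ := hSne
    exact (norm_nonneg _).trans (hBle t ht)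
  have hω : ∀ t ∈ Icc (0 : ℝ) 1, ‖w t‖ ≤ ‖w 0‖ + (‖δ‖ + B) := by
    intro t ht
    have h3 := hsub 0 (‖δ‖ + B) (by simpa using hZ) 0 h01 t ht ht.1
    rw [smul_zero, sub_zero, sub_zero] at h3
    have h4 := norm_add_le (w 0) (w t - w 0)
    rw [add_sub_cancel] at h4
    have h5 : (‖δ‖ + B) * t ≤ ‖δ‖ + B := mul_le_of_le_one_right (by positivity) ht.2
    linarith
  set q := C / c * K with hq
  have hq0 : 0 ≤ q := by positivity
  -- `δ` is the mean of `z`, so its distance to any value `z t` is at most the oscillation.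
  have hosc : ∀ t ∈ S, ‖z t - δ‖ ≤ q * (3 * (‖w 0‖ + (‖δ‖ + B)) + 2 * (‖δ‖ + B)) := by
    intro t ht
    have h3 := hsub (z t) (q * (3 * (‖w 0‖ + (‖δ‖ + B)) + 2 * (‖δ‖ + B)))
      (fun s hs => h.norm_velocity_sub_le hu₁ hu₂ (fun t => hball (hub₁ t))
        (fun t => hball (hub₂ t)) hK hSI hae (fun t ht => ht.2.1) (fun t ht => ht.2.2.1) hω hZ
        ht hs) 0 h01 1 h11 zero_le_one
    rw [sub_zero, one_smul, mul_one, ← hδ, norm_sub_rev] at h3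
    exact h3
  have hBB : B ≤ q * (3 * (‖w 0‖ + (‖δ‖ + B)) + 2 * (‖δ‖ + B)) := by
    apply csSup_le (hSne.image _)
    rintro _ ⟨t, ht, rfl⟩
    exact hosc t ht
  -- The hypothesis `10 q ≤ 1` bounds the term `5 q B` on the right by `B / 2`.
  have hBfin : B ≤ 10 * q * (‖w 0‖ + ‖δ‖) := by
    have h6 : q * (5 * B) ≤ B / 2 := by nlinarith
    have h7 : 0 ≤ q * ‖w 0‖ := by positivity
    nlinarith
  have h8 := hsub δ B hBle s hs t ht hst
  refine h8.trans ?_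
  have : 0 ≤ t - s := sub_nonneg.2 hst
  gcongr

theorem norm_sub_sub_smul_le {u₁ u₂ : ℝ → E} (hm₁ : IsMinGeodesic (X ∘ u₁))
    (hm₂ : IsMinGeodesic (X ∘ u₂)) (hub₁ : ∀ t ∈ Icc (0 : ℝ) 1, u₁ t ∈ Metric.ball a₀ (R / 2))
    (hub₂ : ∀ t ∈ Icc (0 : ℝ) 1, u₂ t ∈ Metric.ball a₀ (R / 2)) {r : ℝ}
    (hr₁ : ‖u₁ 1 - u₁ 0‖ ≤ r) (hr₂ : ‖u₂ 1 - u₂ 0‖ ≤ r) (hr : C / c * r ≤ 1)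
    (hr' : 10 * (C / c * (C / c * r)) ≤ 1)
    {s t : ℝ} (hs : s ∈ Icc (0 : ℝ) 1) (ht : t ∈ Icc (0 : ℝ) 1) (hst : s ≤ t) :
    ‖(u₁ t - u₂ t) - (u₁ s - u₂ s) - (t - s) • ((u₁ 1 - u₂ 1) - (u₁ 0 - u₂ 0))‖ ≤
      10 * (C / c * (C / c * r)) *
        (‖u₁ 0 - u₂ 0‖ + ‖(u₁ 1 - u₂ 1) - (u₁ 0 - u₂ 0)‖) * (t - s) := by
  have hC := h.nonneg_const
  have hc := h.pos_const
  have hR := h.pos_radius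
  have hr0 : 0 ≤ r := (norm_nonneg _).trans hr₁
  have hball : Metric.ball a₀ (R / 2) ⊆ Metric.ball a₀ R :=
    Metric.ball_subset_ball (by linarith)
  -- Stopping the curves outside `[0, 1]` makes them Lipschitz on the whole line without changing
  -- the geodesics.
  set p : ℝ → ℝ := fun t => projIcc (0 : ℝ) 1 zero_le_one t with hp
  have hpI : ∀ t, p t ∈ Icc (0 : ℝ) 1 := fun t => (projIcc (0 : ℝ) 1 zero_le_one t).2
  have hpe : ∀ t ∈ Icc (0 : ℝ) 1, p t = t := fun t ht => by
    simp only [hp, projIcc_of_mem zero_le_one ht]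
  have hpl : ∀ s t, |p s - p t| ≤ |s - t| := fun s t => by
    simpa [Real.dist_eq, Subtype.dist_eq, hp] using
      (LipschitzWith.projIcc (zero_le_one (α := ℝ))).dist_le_mul s t
  have hlip : ∀ u : ℝ → E, IsMinGeodesic (X ∘ u) →
      (∀ t ∈ Icc (0 : ℝ) 1, u t ∈ Metric.ball a₀ (R / 2)) → ‖u 1 - u 0‖ ≤ r →
      LipschitzWith (C / c * r).toNNReal (u ∘ p) := by
    intro u hu hub hur
    apply LipschitzWith.of_dist_le_mul
    intro s t
    rw [Real.coe_toNNReal _ (by positivity), dist_eq_norm, Real.dist_eq]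
    refine (h.lipschitzOnWith_of_isMinGeodesic hu (fun t ht => hball (hub t ht)) (hpI s)
      (hpI t)).trans ?_
    have := hpl s t
    gcongr
  have hco : ((C / c * r).toNNReal : ℝ) = C / c * r := Real.coe_toNNReal _ (by positivity)
  have key := h.norm_sub_sub_smul_le_of_lipschitz (u₁ := u₁ ∘ p) (u₂ := u₂ ∘ p)
    (hm₁.congr fun t ht => by simp [hpe t ht]) (hm₂.congr fun t ht => by simp [hpe t ht])
    (hlip u₁ hm₁ hub₁ hr₁) (hlip u₂ hm₂ hub₂ hr₂) (fun t => hub₁ _ (hpI t))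
    (fun t => hub₂ _ (hpI t)) (by rw [← NNReal.coe_le_coe, hco]; exact hr) (by rw [hco]; exact hr')
    hs ht hst
  simpa only [Function.comp_apply, hpe s hs, hpe t ht, hpe 0 (by simp), hpe 1 (by simp), hco]
    using key

/-- The comparison with the constant geodesic at `u 0`. For `r = ‖u 1 - u 0‖` the deviation from the
segment is quadratic. -/
theorem norm_sub_sub_smul_le_of_isMinGeodesic {u : ℝ → E} (hm : IsMinGeodesic (X ∘ u))
    (hub : ∀ t ∈ Icc (0 : ℝ) 1, u t ∈ Metric.ball a₀ (R / 2)) {r : ℝ}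
    (hr₁ : ‖u 1 - u 0‖ ≤ r) (hr : C / c * r ≤ 1) (hr' : 10 * (C / c * (C / c * r)) ≤ 1)
    {s t : ℝ} (hs : s ∈ Icc (0 : ℝ) 1) (ht : t ∈ Icc (0 : ℝ) 1) (hst : s ≤ t) :
    ‖u t - u s - (t - s) • (u 1 - u 0)‖ ≤
      10 * (C / c * (C / c * r)) * ‖u 1 - u 0‖ * (t - s) := by
  have h0 : ‖u 0 - u 0‖ ≤ r := by
    rw [sub_self, norm_zero]
    exact (norm_nonneg _).trans hr₁
  have h1 := h.norm_sub_sub_smul_le (u₂ := fun _ => u 0) hm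
    (by intro s _ t _; simp) hub (fun _ _ => hub 0 (by simp)) hr₁ h0 hr hr' hs ht hst
  simpa using h1

end IsMetricBall
end BoundaryValue

/-! ### Charts in which geodesics behave like segments. -/

section GeodesicChart

/-- `g a b` is a minimizing geodesic from `a` to `b`, read in the chart `X`; on the ball
`B(a₀, R)` these geodesics are close to segments, and depend on their endpoints as segments do. -/
structure IsGeodesicChart {E : Type*} [NormedAddCommGroup E] [NormedSpace ℝ E]
    {M : Type*} [MetricSpace M] (X : E → M) (a₀ : E) (R C : ℝ) (g : E → E → ℝ → E) : Prop where
  pos_radius : 0 < R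
  one_le_const : 1 ≤ C
  zero : ∀ a ∈ Metric.ball a₀ R, ∀ b ∈ Metric.ball a₀ R, g a b 0 = a
  one : ∀ a ∈ Metric.ball a₀ R, ∀ b ∈ Metric.ball a₀ R, g a b 1 = b
  isMinGeodesic : ∀ a ∈ Metric.ball a₀ R, ∀ b ∈ Metric.ball a₀ R, IsMinGeodesic (X ∘ g a b)
  dist_le : ∀ a ∈ Metric.ball a₀ R, ∀ b ∈ Metric.ball a₀ R, dist (X a) (X b) ≤ C * ‖a - b‖
  le_dist : ∀ a ∈ Metric.ball a₀ R, ∀ b ∈ Metric.ball a₀ R, ‖a - b‖ ≤ C * dist (X a) (X b)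
  norm_sub_le : ∀ a ∈ Metric.ball a₀ R, ∀ b ∈ Metric.ball a₀ R, ∀ s ∈ Icc (0 : ℝ) 1,
    ∀ t ∈ Icc (0 : ℝ) 1, ‖g a b t - g a b s - (t - s) • (b - a)‖ ≤ C * ‖b - a‖ ^ 2 * |t - s|
  norm_sub_sub_le : ∀ a ∈ Metric.ball a₀ R, ∀ b ∈ Metric.ball a₀ R, ∀ a' ∈ Metric.ball a₀ R,
    ∀ b' ∈ Metric.ball a₀ R, ∀ t ∈ Icc (0 : ℝ) 1,
    ‖(g a b t - g a' b' t) - (a - a') - t • ((b - b') - (a - a'))‖ ≤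
      1 / 4 * (‖a - a'‖ + ‖(b - b') - (a - a')‖) * t

variable {E : Type*} [NormedAddCommGroup E] [NormedSpace ℝ E] [FiniteDimensional ℝ E]
    {M : Type*} [MetricSpace M]

theorem exists_isMetricBall [ChartedSpace E M] [IsManifold 𝓘(ℝ, E) ∞ M]
    [RiemannianBundle (fun x : M => TangentSpace 𝓘(ℝ, E) x)]
    [IsContMDiffRiemannianBundle 𝓘(ℝ, E) ∞ E (fun x : M => TangentSpace 𝓘(ℝ, E) x)]
    [IsRiemannianManifold 𝓘(ℝ, E) M] {x₀ : M} {a₀ : E}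
    (ha₀ : a₀ ∈ (extChartAt 𝓘(ℝ, E) x₀).target) : ∃ R c C,
    IsMetricBall (extChartAt 𝓘(ℝ, E) x₀).symm (metricCoord (E := E) x₀) a₀ R c C ∧
      Metric.ball a₀ R ⊆ (extChartAt 𝓘(ℝ, E) x₀).target := by
  set G := metricCoord (E := E) x₀ with hG
  have hopen := isOpen_extChartAt_target (I := 𝓘(ℝ, E)) x₀
  have hcd : ContDiffAt ℝ ∞ G a₀ := (contDiffOn_metricCoord x₀).contDiffAt (hopen.mem_nhds ha₀)
  obtain ⟨c₀, hc₀, hcoer⟩ := exists_pos_forall_le_bilin fun v hv => metricCoord_pos ha₀ hv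
  have hsqrt : 0 < √c₀ := Real.sqrt_pos.2 hc₀
  obtain ⟨δ, hδ, hδt, hδd⟩ := exists_ball_abs_dist_sub_le ha₀ (half_pos hsqrt)
  have hfd : ContDiffAt ℝ 1 (fderiv ℝ G) a₀ := hcd.fderiv_right (by norm_cast)
  obtain ⟨K, s, hs, hK⟩ := hfd.exists_lipschitzOnWith
  have e1 : ∀ᶠ a in 𝓝 a₀, ‖G a - G a₀‖ < c₀ / 2 :=
    (tendsto_iff_norm_sub_tendsto_zero.1 hcd.continuousAt).eventually (gt_mem_nhds (half_pos hc₀))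
  have e2 : ∀ᶠ a in 𝓝 a₀, ‖fderiv ℝ G a‖ < ‖fderiv ℝ G a₀‖ + 1 :=
    hfd.continuousAt.norm.eventually (gt_mem_nhds (lt_add_one _))
  have e3 : ∀ᶠ a in 𝓝 a₀, a ∈ s := hs
  obtain ⟨R₁, hR₁, hball⟩ := Metric.eventually_nhds_iff_ball.1 (e1.and (e2.and e3))
  set C : ℝ := (‖G a₀‖ + c₀) + (‖fderiv ℝ G a₀‖ + 1) + K + (√‖G a₀‖ + √c₀) with hC
  have hRb : Metric.ball a₀ (min δ R₁) ⊆ Metric.ball a₀ δ :=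
    Metric.ball_subset_ball (min_le_left _ _)
  have hRb' : Metric.ball a₀ (min δ R₁) ⊆ Metric.ball a₀ R₁ :=
    Metric.ball_subset_ball (min_le_right _ _)
  have hK0 : (0 : ℝ) ≤ K := K.2
  have hn1 := norm_nonneg (G a₀)
  have hn2 := norm_nonneg (fderiv ℝ G a₀)
  have hn3 := Real.sqrt_nonneg ‖G a₀‖
  have hGle : ∀ v, √(G a₀ v v) ≤ √‖G a₀‖ * ‖v‖ := by
    intro v
    rw [← Real.sqrt_sq (norm_nonneg v), ← Real.sqrt_mul (norm_nonneg _)]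
    apply Real.sqrt_le_sqrt
    rw [sq, ← mul_assoc]
    exact (le_abs_self _).trans ((G a₀).le_opNorm₂ v v)
  have hGge : ∀ v, √c₀ * ‖v‖ ≤ √(G a₀ v v) := by
    intro v
    rw [← Real.sqrt_sq (norm_nonneg v), ← Real.sqrt_mul hc₀.le]
    apply Real.sqrt_le_sqrt
    exact hcoer v
  -- Half of the coercivity survives for nearby metrics, and an error `√c₀ / 2` in the distance
  -- estimate leaves `√c₀ / 2`.
  refine ⟨min δ R₁, min (c₀ / 2) (√c₀ / 2), C, ⟨lt_min hδ hR₁,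
    lt_min (half_pos hc₀) (half_pos hsqrt), metricCoord_comm x₀, ?_, ?_, ?_, ?_, ?_, ?_, ?_, ?_⟩,
    hRb.trans hδt⟩
  · intro a ha v
    have h1 := (hball a (hRb' ha)).1.le
    have h2 : |(G a - G a₀) v v| ≤ c₀ / 2 * ‖v‖ * ‖v‖ :=
      ((G a - G a₀).le_opNorm₂ v v).trans (by gcongr)
    have h3 : (G a - G a₀) v v = G a v v - G a₀ v v := by simp only [sub_apply]
    rw [h3] at h2
    have h4 := hcoer v
    have h5 : min (c₀ / 2) (√c₀ / 2) * ‖v‖ ^ 2 ≤ c₀ / 2 * ‖v‖ ^ 2 := by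
      gcongr; exact min_le_left _ _
    have h6 := (abs_le.1 h2).1
    nlinarith
  · intro a ha
    have h1 := (hball a (hRb' ha)).1.le
    have h2 := norm_le_norm_add_norm_sub' (G a) (G a₀)
    linarith
  · intro a ha
    exact ((contDiffOn_metricCoord x₀).contDiffAt
      (hopen.mem_nhds (hδt (hRb ha)))).differentiableAt (by simp)
  · intro a ha
    have := (hball a (hRb' ha)).2.1.le
    linarith
  · intro a ha b hb
    have h1 := hK.dist_le_mul a (hball a (hRb' ha)).2.2 b (hball b (hRb' hb)).2.2
    rw [dist_eq_norm, dist_eq_norm] at h1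
    refine h1.trans ?_
    gcongr
    linarith
  · intro a ha b hb
    have h1 := (abs_le.1 (hδd a (hRb ha) b (hRb hb))).1
    have h2 := hGge (b - a)
    have h3 : min (c₀ / 2) (√c₀ / 2) * ‖b - a‖ ≤ √c₀ / 2 * ‖b - a‖ := by
      gcongr; exact min_le_right _ _
    rw [norm_sub_rev a b]
    linarith
  · intro a ha b hb
    have h1 := (abs_le.1 (hδd a (hRb ha) b (hRb hb))).2
    have h2 := hGle (b - a)
    rw [norm_sub_rev a b]
    have h3 : (√‖G a₀‖ + √c₀) * ‖b - a‖ ≤ C * ‖b - a‖ := by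
      gcongr; linarith
    have h4 := mul_nonneg hsqrt.le (norm_nonneg (b - a))
    linarith
  · intro a ha ε hε
    obtain ⟨δ', hδ', -, h⟩ := exists_ball_abs_dist_sub_le (hδt (hRb ha)) hε
    exact ⟨δ', hδ', h⟩

theorem IsMetricBall.exists_isGeodesicChart {X : E → M} {G : E → E →L[ℝ] E →L[ℝ] ℝ} {a₀ : E}
    {R c C : ℝ} (h : IsMetricBall X G a₀ R c C) {r₁ : ℝ} (hr₁ : 0 < r₁)
    (hgeod : ∀ a ∈ Metric.ball a₀ r₁, ∀ b ∈ Metric.ball a₀ r₁, ∃ u : ℝ → E,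
      u 0 = a ∧ u 1 = b ∧ IsMinGeodesic (X ∘ u) ∧
        ∀ t ∈ Icc (0 : ℝ) 1, u t ∈ Metric.ball a₀ (R / 2)) :
    ∃ R' C' g, IsGeodesicChart X a₀ R' C' g ∧ R' ≤ R := by
  have hc := h.pos_const
  have hR := h.pos_radius
  have hC := h.nonneg_const
  choose! g hg0 hg1 hgm hgb using hgeod
  set k := C / c with hk
  have hk0 : 0 ≤ k := by positivity
  -- With this radius, any two points are at most `2 R'` apart, and `r ≤ 2 R'` gives both `k r ≤ 1`
  -- and `10 k² r ≤ 1 / 4`. The latter is the factor `1 / 4` in `norm_sub_sub_le`.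
  set R' := min (min r₁ R) (1 / (80 * (k + 1) ^ 2)) with hR'
  have hR'1 : Metric.ball a₀ R' ⊆ Metric.ball a₀ r₁ :=
    Metric.ball_subset_ball ((min_le_left _ _).trans (min_le_left _ _))
  have hR'2 : R' ≤ R := (min_le_left _ _).trans (min_le_right _ _)
  have hR'R : Metric.ball a₀ R' ⊆ Metric.ball a₀ R := Metric.ball_subset_ball hR'2
  have hR'0 : 0 < R' := lt_min (lt_min hr₁ hR) (by positivity)
  have hR'3 : (k + 1) ^ 2 * (80 * R') ≤ 1 := by
    have h1 : R' ≤ 1 / (80 * (k + 1) ^ 2) := min_le_right _ _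
    rw [le_div_iff₀ (by positivity)] at h1
    linarith
  have hkr : ∀ r, 0 ≤ r → r ≤ 2 * R' → k * r ≤ 1 ∧ 10 * (k * (k * r)) ≤ 1 / 4 := by
    intro r hr hr2
    have h1 : (k + 1) ^ 2 * r ≤ (k + 1) ^ 2 * (2 * R') := by gcongr
    constructor <;> nlinarith [mul_nonneg hk0 hr]
  have hdiam : ∀ a ∈ Metric.ball a₀ R', ∀ b ∈ Metric.ball a₀ R', ‖b - a‖ ≤ 2 * R' := by
    intro a ha b hb
    rw [Metric.mem_ball] at ha hb
    rw [← dist_eq_norm]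
    linarith [dist_triangle_right b a a₀]
  refine ⟨R', 10 * (k * k) + C + 1 / c + 1, g, ⟨hR'0, ?_, ?_, ?_, ?_, ?_, ?_, ?_, ?_⟩, hR'2⟩
  · have : 0 ≤ 1 / c := by positivity
    have : 0 ≤ k * k := by positivity
    linarith
  · exact fun a ha b hb => hg0 a (hR'1 ha) b (hR'1 hb)
  · exact fun a ha b hb => hg1 a (hR'1 ha) b (hR'1 hb)
  · exact fun a ha b hb => hgm a (hR'1 ha) b (hR'1 hb)
  · intro a ha b hb
    refine (h.dist_le a (hR'R ha) b (hR'R hb)).trans ?_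
    gcongr
    have : 0 ≤ 1 / c := by positivity
    have : 0 ≤ k * k := by positivity
    linarith
  · intro a ha b hb
    have h1 := h.le_dist a (hR'R ha) b (hR'R hb)
    have h2 : ‖a - b‖ ≤ 1 / c * dist (X a) (X b) := by
      rw [one_div, inv_mul_eq_div, le_div_iff₀ hc]; linarith
    refine h2.trans ?_
    gcongr
    have : 0 ≤ k * k := by positivity
    linarith
  · intro a ha b hb
    have key : ∀ s ∈ Icc (0 : ℝ) 1, ∀ t ∈ Icc (0 : ℝ) 1, s ≤ t →
        ‖g a b t - g a b s - (t - s) • (b - a)‖ ≤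
          (10 * (k * k) + C + 1 / c + 1) * ‖b - a‖ ^ 2 * |t - s| := by
      intro s hs t ht hst
      obtain ⟨k1, k2⟩ := hkr ‖b - a‖ (norm_nonneg _) (hdiam a ha b hb)
      have e0 := hg0 a (hR'1 ha) b (hR'1 hb)
      have e1 := hg1 a (hR'1 ha) b (hR'1 hb)
      have h1 := h.norm_sub_sub_smul_le_of_isMinGeodesic (u := g a b) (r := ‖b - a‖)
        (hgm a (hR'1 ha) b (hR'1 hb)) (hgb a (hR'1 ha) b (hR'1 hb)) (by rw [e0, e1]) k1
        (k2.trans (by norm_num)) hs ht hst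
      rw [e0, e1, ← hk] at h1
      refine h1.trans ?_
      rw [abs_of_nonneg (sub_nonneg.2 hst)]
      have h2 : 0 ≤ t - s := sub_nonneg.2 hst
      have h3 : 10 * (k * k) ≤ 10 * (k * k) + C + 1 / c + 1 := by
        have : 0 ≤ 1 / c := by positivity
        linarith
      calc _ = 10 * (k * k) * ‖b - a‖ ^ 2 * (t - s) := by ring
        _ ≤ _ := by gcongr
    intro s hs t ht
    rcases le_total s t with hst | hst
    · exact key s hs t ht hst
    · have := key t ht s hs hst
      rw [abs_sub_comm, ← norm_neg]
      have e : -(g a b t - g a b s - (t - s) • (b - a)) =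
        g a b s - g a b t - (s - t) • (b - a) := by module
      rwa [e]
  · intro a ha b hb a' ha' b' hb' t ht
    obtain ⟨k1, k2⟩ := hkr (2 * R') (by positivity) le_rfl
    have e0 := hg0 a (hR'1 ha) b (hR'1 hb)
    have e1 := hg1 a (hR'1 ha) b (hR'1 hb)
    have e0' := hg0 a' (hR'1 ha') b' (hR'1 hb')
    have e1' := hg1 a' (hR'1 ha') b' (hR'1 hb')
    have h1 := h.norm_sub_sub_smul_le (u₁ := g a b) (u₂ := g a' b') (r := 2 * R')
        (hgm a (hR'1 ha) b (hR'1 hb)) (hgm a' (hR'1 ha') b' (hR'1 hb'))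
        (hgb a (hR'1 ha) b (hR'1 hb)) (hgb a' (hR'1 ha') b' (hR'1 hb'))
        (by rw [e0, e1]; exact hdiam a ha b hb) (by rw [e0', e1']; exact hdiam a' ha' b' hb') k1
        (k2.trans (by norm_num)) (left_mem_Icc.2 zero_le_one) ht ht.1
    rw [e0, e1, e0', e1', ← hk, sub_zero] at h1
    refine h1.trans ?_
    have := ht.1
    gcongr

theorem exists_isGeodesicChart [CompactSpace M] [ChartedSpace E M] [IsManifold 𝓘(ℝ, E) ∞ M]
    [RiemannianBundle (fun x : M => TangentSpace 𝓘(ℝ, E) x)]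
    [IsContMDiffRiemannianBundle 𝓘(ℝ, E) ∞ E (fun x : M => TangentSpace 𝓘(ℝ, E) x)]
    [IsRiemannianManifold 𝓘(ℝ, E) M] (x₀ : M) : ∃ R C g,
    IsGeodesicChart (extChartAt 𝓘(ℝ, E) x₀).symm (extChartAt 𝓘(ℝ, E) x₀ x₀) R C g ∧
      Metric.ball (extChartAt 𝓘(ℝ, E) x₀ x₀) R ⊆ (extChartAt 𝓘(ℝ, E) x₀).target := by
  obtain ⟨R, c, C, h, hRt⟩ := exists_isMetricBall (E := E) (mem_extChartAt_target (I := 𝓘(ℝ, E)) x₀)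
  set ψ := extChartAt 𝓘(ℝ, E) x₀ with hψ
  set a₀ := ψ x₀ with ha₀
  have hR := h.pos_radius
  have hC := h.nonneg_const
  have hXa₀ : ψ.symm a₀ = x₀ := extChartAt_to_inv x₀
  have hev : ∀ᶠ y in 𝓝 x₀, y ∈ ψ.source ∧ ψ y ∈ Metric.ball a₀ (R / 2) :=
    Filter.Eventually.and (extChartAt_source_mem_nhds x₀)
      ((continuousAt_extChartAt x₀).eventually (Metric.ball_mem_nhds _ (half_pos hR)))
  obtain ⟨ρ, hρ, hρ'⟩ := Metric.eventually_nhds_iff.1 hev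
  -- A geodesic between points of this ball has length at most `2 C r₁` and starts within `C r₁` of
  -- `x₀`, so it stays within `3 C r₁ < ρ` of `x₀`, inside the chart.
  set r₁ := min R (ρ / (3 * C + 1)) with hr₁
  have hr₁0 : 0 < r₁ := lt_min hR (by positivity)
  have hr₁R : Metric.ball a₀ r₁ ⊆ Metric.ball a₀ R := Metric.ball_subset_ball (min_le_left _ _)
  have hr₁ρ : 3 * C * r₁ < ρ := by
    have : r₁ ≤ ρ / (3 * C + 1) := min_le_right _ _
    rw [le_div_iff₀ (by positivity)] at this
    linarith
  obtain ⟨R', C', g, hg, hR'⟩ := h.exists_isGeodesicChart hr₁0 fun a ha b hb => by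
    obtain ⟨γ, h0, h1, hγ⟩ := exists_isMinGeodesic E (ψ.symm a) (ψ.symm b)
    have hγt : ∀ t ∈ Icc (0 : ℝ) 1, γ t ∈ ψ.source ∧ ψ (γ t) ∈ Metric.ball a₀ (R / 2) := by
      intro t ht
      apply hρ'
      have d1 := hγ t ht 0 (by simp)
      rw [sub_zero, h0, h1, abs_of_nonneg ht.1] at d1
      have d2 := h.dist_le a (hr₁R ha) b (hr₁R hb)
      have d3 := h.dist_le a (hr₁R ha) a₀ (Metric.mem_ball_self hR)
      rw [hXa₀] at d3
      rw [Metric.mem_ball, dist_eq_norm] at ha hb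
      have d4 : ‖a - b‖ ≤ 2 * r₁ := by
        have := norm_sub_le_norm_sub_add_norm_sub a a₀ b
        rw [norm_sub_rev a₀ b] at this
        linarith
      have d5 : t * dist (ψ.symm a) (ψ.symm b) ≤ C * (2 * r₁) :=
        (mul_le_of_le_one_left dist_nonneg ht.2).trans (d2.trans (by gcongr))
      have d6 : C * ‖a - a₀‖ ≤ C * r₁ := by gcongr
      linarith [dist_triangle (γ t) (ψ.symm a) x₀]
    refine ⟨ψ ∘ γ, ?_, ?_, hγ.congr fun t ht => ?_, fun t ht => (hγt t ht).2⟩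
    · simp only [Function.comp_apply, h0]
      exact ψ.right_inv (hRt (hr₁R ha))
    · simp only [Function.comp_apply, h1]
      exact ψ.right_inv (hRt (hr₁R hb))
    · exact ψ.left_inv (hγt t ht).1
  exact ⟨R', C', g, hg, (Metric.ball_subset_ball hR').trans hRt⟩

end GeodesicChart

/-! ### Geodesic hulls of finitely many points contain balls. -/

section GeodesicHull

variable {E : Type*} [NormedAddCommGroup E] [NormedSpace ℝ E] {M : Type*} [MetricSpace M]

/-- A perturbation of the identity by a map with Lipschitz constant `1 / 2` still covers the ball of
half the radius, by the quantitative inverse function theorem. -/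
theorem closedBall_subset_image_of_norm_sub_sub_le [CompleteSpace E] {F : E → E} {b : E} {ε : ℝ}
    (hε : 0 ≤ ε) (hF : ∀ x ∈ Metric.closedBall b ε, ∀ y ∈ Metric.closedBall b ε,
      ‖F x - F y - (x - y)‖ ≤ 1 / 2 * ‖x - y‖) :
    Metric.closedBall (F b) (ε / 2) ⊆ F '' Metric.closedBall b ε := by
  have h1 : ApproximatesLinearOn F (ContinuousLinearMap.id ℝ E) (Metric.closedBall b ε)
      (1 / 2 : ℝ≥0) := by
    intro x hx y hy
    simpa using hF x hx y hy
  let inv : (ContinuousLinearMap.id ℝ E).NonlinearRightInverse :=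
    ⟨id, 1, fun y => by simp, fun y => rfl⟩
  have h2 := h1.surjOn_closedBall_of_nonlinearRightInverse inv hε subset_rfl
  have h3 : (((inv.nnnorm : ℝ)⁻¹ - ((1 / 2 : ℝ≥0) : ℝ)) * ε) = ε / 2 := by
    simp only [inv]; push_cast; ring
  rw [h3] at h2
  exact h2

/-- A basis and its dual basis, padded by zero to families over `ℕ` so that constructions can
recurse on the index. -/
theorem exists_dual_families (E : Type*) [NormedAddCommGroup E] [NormedSpace ℝ E]
    [FiniteDimensional ℝ E] : ∃ (b : ℕ → E) (β : ℕ → E →L[ℝ] ℝ) (B : ℝ), 1 ≤ B ∧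
      (∀ i, ‖b i‖ ≤ B) ∧ (∀ i, ‖β i‖ ≤ B) ∧
      ∀ x, ∑ i ∈ Finset.range (Module.finrank ℝ E), β i x • b i = x := by
  set n := Module.finrank ℝ E with hn
  set e := Module.finBasis ℝ E with he
  set b : ℕ → E := fun i => if hi : i < n then e ⟨i, hi⟩ else 0 with hb
  set β : ℕ → E →L[ℝ] ℝ := fun i => if hi : i < n then
    LinearMap.toContinuousLinearMap (e.coord ⟨i, hi⟩) else 0 with hβ
  have hsum : ∀ x, ∑ i ∈ Finset.range n, β i x • b i = x := by
    intro x
    rw [Finset.sum_range]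
    conv_rhs => rw [← e.sum_repr x]
    refine Finset.sum_congr rfl fun i _ => ?_
    simp [hb, hβ]
  have h1 : ∀ i, 0 ≤ ‖b i‖ := fun i => norm_nonneg _
  have h2 : ∀ i, 0 ≤ ‖β i‖ := fun i => norm_nonneg _
  refine ⟨b, β, 1 + ∑ i ∈ Finset.range n, ‖b i‖ + ∑ i ∈ Finset.range n, ‖β i‖,
    ?_, ?_, ?_, hsum⟩
  · have := Finset.sum_nonneg fun i (_ : i ∈ Finset.range n) => h1 i
    have := Finset.sum_nonneg fun i (_ : i ∈ Finset.range n) => h2 i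
    linarith
  · intro i
    have h4 := Finset.sum_nonneg fun i (_ : i ∈ Finset.range n) => h2 i
    have h5 := Finset.sum_nonneg fun i (_ : i ∈ Finset.range n) => h1 i
    by_cases hi : i < n
    · have := Finset.single_le_sum (fun i _ => h1 i) (Finset.mem_range.2 hi)
      linarith
    · have : ‖b i‖ = 0 := by simp [hb, hi]
      linarith
  · intro i
    have h4 := Finset.sum_nonneg fun i (_ : i ∈ Finset.range n) => h2 i
    have h5 := Finset.sum_nonneg fun i (_ : i ∈ Finset.range n) => h1 i
    by_cases hi : i < n
    · have := Finset.single_le_sum (fun i _ => h2 i) (Finset.mem_range.2 hi)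
      linarith
    · have : ‖β i‖ = 0 := by simp [hβ, hi]
      linarith

namespace IsGeodesicChart

variable {X : E → M} {a₀ : E} {R C : ℝ} {g : E → E → ℝ → E} (h : IsGeodesicChart X a₀ R C g)
include h

theorem const_pos : 0 < C := one_pos.trans_le h.one_le_const

/-- Geodesics can be prolonged: the equation `g a y t = b` is solved for `y`, because `y ↦ t⁻¹ g a y
t` is a small Lipschitz perturbation of the identity fixing `a`. -/
theorem exists_extension [CompleteSpace E] {a b : E} {t : ℝ} (ha : a ∈ Metric.ball a₀ (R / 2))
    (ht : t ∈ Ioc (0 : ℝ) 1) (hab : ‖b - a‖ ≤ t * (R / 8)) :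
    ∃ y ∈ Metric.ball a₀ R, g a y t = b := by
  have hR := h.pos_radius
  have ht0 := ht.1
  have htI : t ∈ Icc (0 : ℝ) 1 := ⟨ht.1.le, ht.2⟩
  have hsub : Metric.closedBall a (R / 4) ⊆ Metric.ball a₀ R := by
    intro y hy
    rw [Metric.mem_closedBall] at hy
    rw [Metric.mem_ball] at ha ⊢
    linarith [dist_triangle y a a₀]
  have haR : a ∈ Metric.ball a₀ R := Metric.ball_subset_ball (by linarith) ha
  have key := closedBall_subset_image_of_norm_sub_sub_le (F := fun y => t⁻¹ • g a y t) (b := a)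
    (ε := R / 4) (by positivity) (fun x hx y hy => by
      have h1 := h.norm_sub_sub_le a haR x (hsub hx) a haR y (hsub hy) t htI
      rw [sub_self, norm_zero, sub_zero, sub_zero, zero_add] at h1
      have h2 : t⁻¹ • g a x t - t⁻¹ • g a y t - (x - y) =
          t⁻¹ • (g a x t - g a y t - t • (x - y)) := by
        rw [smul_sub, smul_sub, smul_smul, inv_mul_cancel₀ ht0.ne', one_smul]
      rw [h2, norm_smul, norm_inv, Real.norm_of_nonneg ht0.le, inv_mul_le_iff₀ ht0]
      have := mul_nonneg ht0.le (norm_nonneg (x - y))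
      linarith)
  have hga : g a a t = a := by
    have h1 := h.norm_sub_le a haR a haR 0 (by simp) t htI
    rw [h.zero a haR a haR] at h1
    simpa [sub_eq_zero] using h1
  have hb : t⁻¹ • b ∈ Metric.closedBall (t⁻¹ • g a a t) (R / 4 / 2) := by
    rw [hga, Metric.mem_closedBall, dist_eq_norm, ← smul_sub, norm_smul, norm_inv,
      Real.norm_of_nonneg ht0.le, inv_mul_le_iff₀ ht0]
    linarith
  obtain ⟨y, hy, hyb⟩ := key hb
  exact ⟨y, hsub hy, smul_right_injective E (inv_ne_zero ht0.ne') hyb⟩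

/-- One step of `geodesicChain`: up to a small Lipschitz error it adds `β ξ • e` to the moving point
`p ξ`. The error `4 τ L` comes from the motion of the starting point, which also changes the
direction of the geodesic; the term with `C` comes from the deviation of geodesics from segments.
The radius `τ r / B` keeps `|β ξ / r| ≤ τ`, so that the stopping time stays in `[0, 2 τ]`. -/
theorem norm_step_le {p : E → E} {e v : E} {β : E →L[ℝ] ℝ} {B L r τ : ℝ} (hB : 1 ≤ B)
    (hr : 0 < r) (hτ : 0 < τ) (hτ' : τ ≤ 1 / 2) (he : ‖e‖ ≤ B) (hβ : ‖β‖ ≤ B) (hL : 0 ≤ L)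
    (hp : ∀ ξ ∈ Metric.closedBall (0 : E) (τ * r / B), p ξ ∈ Metric.ball a₀ R)
    (hv : v ∈ Metric.ball a₀ R) (hve : v = p 0 + r • e)
    (hpL : ∀ ξ ∈ Metric.closedBall (0 : E) (τ * r / B),
      ∀ ξ' ∈ Metric.closedBall (0 : E) (τ * r / B), ‖p ξ - p ξ'‖ ≤ L * ‖ξ - ξ'‖) :
    (∀ ξ ∈ Metric.closedBall (0 : E) (τ * r / B), τ + β ξ / r ∈ Icc (0 : ℝ) 1) ∧
    ‖g (p 0) v τ - p 0 - (τ * r) • e‖ ≤ C * (r * B) ^ 2 * τ ∧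
    ∀ ξ ∈ Metric.closedBall (0 : E) (τ * r / B), ∀ ξ' ∈ Metric.closedBall (0 : E) (τ * r / B),
      ‖g (p ξ) v (τ + β ξ / r) - g (p ξ') v (τ + β ξ' / r) - (p ξ - p ξ') - β (ξ - ξ') • e‖ ≤
        (4 * τ * L + C * r * (B + L) ^ 2 * B) * ‖ξ - ξ'‖ := by
  have hB0 : 0 < B := by linarith
  have hC := h.const_pos
  have h0 : (0 : E) ∈ Metric.closedBall (0 : E) (τ * r / B) :=
    Metric.mem_closedBall_self (by positivity)
  have hβξ : ∀ ξ ∈ Metric.closedBall (0 : E) (τ * r / B), |β ξ / r| ≤ τ := by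
    intro ξ hξ
    rw [mem_closedBall_zero_iff] at hξ
    rw [abs_div, abs_of_pos hr, div_le_iff₀ hr]
    calc |β ξ| ≤ B * (τ * r / B) := (β.le_opNorm ξ).trans (by gcongr)
      _ = τ * r := by field_simp
  have htI : ∀ ξ ∈ Metric.closedBall (0 : E) (τ * r / B), τ + β ξ / r ∈ Icc (0 : ℝ) 1 := by
    intro ξ hξ
    have := abs_le.1 (hβξ ξ hξ)
    constructor <;> linarith
  refine ⟨htI, ?_, fun ξ hξ ξ' hξ' => ?_⟩
  · have h1 := h.norm_sub_le _ (hp 0 h0) v hv 0 (by simp) τ ⟨hτ.le, by linarith⟩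
    rw [h.zero _ (hp 0 h0) v hv, sub_zero, abs_of_pos hτ] at h1
    have e1 : v - p 0 = r • e := by rw [hve]; module
    rw [e1, smul_smul] at h1
    refine h1.trans ?_
    rw [norm_smul, Real.norm_of_nonneg hr.le]
    gcongr
  · set t := τ + β ξ / r with ht
    set t' := τ + β ξ' / r with ht'
    have htt : t - t' = β (ξ - ξ') / r := by rw [ht, ht', map_sub]; ring
    have htle : t ≤ 2 * τ := by linarith [(abs_le.1 (hβξ ξ hξ)).2]
    have hd := hpL ξ hξ ξ' hξ'
    have h1 := h.norm_sub_sub_le _ (hp ξ hξ) v hv _ (hp ξ' hξ') v hv t (htI ξ hξ)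
    have h1' : ‖(g (p ξ) v t - g (p ξ') v t) - (p ξ - p ξ')‖ ≤ 3 * τ * L * ‖ξ - ξ'‖ := by
      have e1 : (g (p ξ) v t - g (p ξ') v t) - (p ξ - p ξ') =
        ((g (p ξ) v t - g (p ξ') v t) - (p ξ - p ξ') - t • ((v - v) - (p ξ - p ξ'))) -
          t • (p ξ - p ξ') := by module
      rw [e1]
      refine (_root_.norm_sub_le _ _).trans ?_
      rw [norm_smul, Real.norm_of_nonneg (htI ξ hξ).1]
      rw [sub_self, zero_sub, norm_neg] at h1
      rw [sub_self, zero_sub]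
      have h2 : t * ‖p ξ - p ξ'‖ ≤ 2 * τ * (L * ‖ξ - ξ'‖) := by
        have := (htI ξ hξ).1
        gcongr
      linarith
    have hpv : ‖(v - p ξ') - r • e‖ ≤ L * (τ * r / B) := by
      have e1 : (v - p ξ') - r • e = p 0 - p ξ' := by rw [hve]; module
      rw [e1]
      refine (hpL 0 h0 ξ' hξ').trans ?_
      rw [mem_closedBall_zero_iff] at hξ'
      rw [zero_sub, norm_neg]
      gcongr
    have hre : ‖r • e‖ ≤ r * B := by
      rw [norm_smul, Real.norm_of_nonneg hr.le]; gcongr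
    have hpv' : ‖v - p ξ'‖ ≤ r * (B + L) := by
      have h2 := norm_add_le ((v - p ξ') - r • e) (r • e)
      rw [sub_add_cancel] at h2
      have h3 : L * (τ * r / B) ≤ L * (1 * r) := by
        gcongr
        refine (div_le_self (by positivity) hB).trans ?_
        gcongr
        linarith
      linarith
    have htt' : |t - t'| ≤ B * ‖ξ - ξ'‖ / r := by
      rw [htt, abs_div, abs_of_pos hr]
      gcongr
      exact (β.le_opNorm _).trans (by gcongr)
    have h4 := h.norm_sub_le _ (hp ξ' hξ') v hv t' (htI ξ' hξ') t (htI ξ hξ)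
    have h4' : ‖g (p ξ') v t - g (p ξ') v t' - (t - t') • (v - p ξ')‖ ≤
        C * r * (B + L) ^ 2 * B * ‖ξ - ξ'‖ := by
      refine h4.trans ?_
      calc C * ‖v - p ξ'‖ ^ 2 * |t - t'| ≤ C * (r * (B + L)) ^ 2 * (B * ‖ξ - ξ'‖ / r) := by gcongr
        _ = _ := by field_simp
    have h5 : ‖(t - t') • ((v - p ξ') - r • e)‖ ≤ τ * L * ‖ξ - ξ'‖ := by
      rw [norm_smul, Real.norm_eq_abs]
      calc |t - t'| * ‖(v - p ξ') - r • e‖ ≤ B * ‖ξ - ξ'‖ / r * (L * (τ * r / B)) := by gcongr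
        _ = _ := by field_simp
    have e2 : (t - t') * r = β (ξ - ξ') := by rw [htt]; field_simp
    have e3 : g (p ξ) v t - g (p ξ') v t' - (p ξ - p ξ') - β (ξ - ξ') • e =
        ((g (p ξ) v t - g (p ξ') v t) - (p ξ - p ξ')) +
        (g (p ξ') v t - g (p ξ') v t' - (t - t') • (v - p ξ')) +
        (t - t') • ((v - p ξ') - r • e) := by rw [← e2]; module
    rw [e3]
    refine (norm_add₃_le).trans ?_
    linarith

/-- The endpoints of the `i`-th of the geodesics that start from `a₁` and move in turn by about
`r b_j`, `j < i`, each of them stopped at time `τ + β_j(ξ) / r`. -/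
def _root_.geodesicChain (g : E → E → ℝ → E) (a₁ : E) (r τ : ℝ) (b : ℕ → E) (β : ℕ → E →L[ℝ] ℝ) :
    ℕ → E → E
  | 0 => fun _ => a₁
  | i + 1 => fun ξ => g (geodesicChain g a₁ r τ b β i ξ)
      (geodesicChain g a₁ r τ b β i 0 + r • b i) (τ + β i ξ / r)

/-- Three facts carried through one induction. At `ξ = 0` the chain moves by about `τ r b_j` at each
step, which explains the starting point: after `n` steps it is back near `a₀`. Its dependence on `ξ`
is nearly the partial sum of `β_j ξ • b_j`. And each new point lies on a geodesic from the previous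
one to a vertex independent of `ξ`, so a lower bound for `f` survives each step, using one more
value of `f`. -/
theorem geodesicChain_spec {n : ℕ} {b : ℕ → E} {β : ℕ → E →L[ℝ] ℝ} {B L r τ : ℝ} (hB : 1 ≤ B)
    (hr : 0 < r) (hτ : 0 < τ) (hτ' : τ ≤ 1 / 2) (he : ∀ i, ‖b i‖ ≤ B) (hβ : ∀ i, ‖β i‖ ≤ B)
    (hL : 1 + n * (B * B) ≤ L) (hσ : n * (4 * τ * L + C * r * (B + L) ^ 2 * B) ≤ 1 / 2)
    (hCr : n * (C * (r * B) ^ 2) ≤ r) (hrR : (n * B + 1 + L + B) * r < R) :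
    ∀ i ≤ n, 
      ‖geodesicChain g (a₀ - (τ * r) • ∑ j ∈ Finset.range n, b j) r τ b β i 0 -
        (a₀ - (τ * r) • ∑ j ∈ Finset.range n, b j) - (τ * r) • ∑ j ∈ Finset.range i, b j‖ ≤
          i * (C * (r * B) ^ 2 * τ) ∧
      (∀ ξ ∈ Metric.closedBall (0 : E) (τ * r / B), ∀ ξ' ∈ Metric.closedBall (0 : E) (τ * r / B),
        ‖geodesicChain g (a₀ - (τ * r) • ∑ j ∈ Finset.range n, b j) r τ b β i ξ -
          geodesicChain g (a₀ - (τ * r) • ∑ j ∈ Finset.range n, b j) r τ b β i ξ' -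
          ∑ j ∈ Finset.range i, β j (ξ - ξ') • b j‖ ≤
          i * (4 * τ * L + C * r * (B + L) ^ 2 * B) * ‖ξ - ξ'‖) ∧
      ∀ f : E → ℝ, (∀ A, ∀ x ∈ Metric.ball a₀ R, ∀ y ∈ Metric.ball a₀ R, -A ≤ f x → -A ≤ f y →
          ∀ t ∈ Icc (0 : ℝ) 1, -(A + 1) ≤ f (g x y t)) →
        ∃ A, ∀ ξ ∈ Metric.closedBall (0 : E) (τ * r / B),
          -A ≤ f (geodesicChain g (a₀ - (τ * r) • ∑ j ∈ Finset.range n, b j) r τ b β i ξ) := by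
  have hB0 : 0 < B := by linarith
  have hC := h.const_pos
  have hL0 : 0 ≤ L := by
    have : (0 : ℝ) ≤ n * (B * B) := by positivity
    linarith
  set a₁ := a₀ - (τ * r) • ∑ j ∈ Finset.range n, b j with ha₁
  set F := geodesicChain g a₁ r τ b β with hF
  set σ := 4 * τ * L + C * r * (B + L) ^ 2 * B with hσdef
  have hσ0 : 0 ≤ σ := by positivity
  have h0 : (0 : E) ∈ Metric.closedBall (0 : E) (τ * r / B) :=
    Metric.mem_closedBall_self (by positivity)
  have hsum : ∀ i ≤ n, ‖∑ j ∈ Finset.range i, b j‖ ≤ n * B := by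
    intro i hi
    refine (norm_sum_le_of_le _ fun j _ => he j).trans ?_
    rw [Finset.sum_const, Finset.card_range, nsmul_eq_mul]
    gcongr
  have hsumβ : ∀ i ≤ n, ∀ ξ, ‖∑ j ∈ Finset.range i, β j ξ • b j‖ ≤ n * (B * B) * ‖ξ‖ := by
    intro i hi ξ
    refine (norm_sum_le_of_le (n := fun _ => B * B * ‖ξ‖) _ fun j _ => ?_).trans ?_
    · rw [norm_smul]
      calc ‖β j ξ‖ * ‖b j‖ ≤ (B * ‖ξ‖) * B := by
            gcongr
            · exact (β j).le_of_opNorm_le (hβ j) ξ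
            · exact he j
        _ = _ := by ring
    · rw [Finset.sum_const, Finset.card_range, nsmul_eq_mul, ← mul_assoc]
      gcongr
  intro i
  induction i with
  | zero =>
    intro _
    refine ⟨by simp [hF, geodesicChain], by simp [hF, geodesicChain], fun f _ => ?_⟩
    exact ⟨|f a₁|, fun ξ _ => neg_abs_le _⟩
  | succ i ih =>
    intro hi
    have hi' : i ≤ n := by omega
    have hin : (i : ℝ) ≤ n := by exact_mod_cast hi'
    obtain ⟨ih1, ih2, ih3⟩ := ih hi'
    have hL' : ∀ ξ ∈ Metric.closedBall (0 : E) (τ * r / B),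
        ∀ ξ' ∈ Metric.closedBall (0 : E) (τ * r / B), ‖F i ξ - F i ξ'‖ ≤ L * ‖ξ - ξ'‖ := by
      intro ξ hξ ξ' hξ'
      have h1 := ih2 ξ hξ ξ' hξ'
      have h2 := hsumβ i hi' (ξ - ξ')
      have h3 : i * σ * ‖ξ - ξ'‖ ≤ 1 / 2 * ‖ξ - ξ'‖ := by
        gcongr
        exact (mul_le_mul_of_nonneg_right hin hσ0).trans hσ
      have h4 := norm_add_le (F i ξ - F i ξ' - ∑ j ∈ Finset.range i, β j (ξ - ξ') • b j)
        (∑ j ∈ Finset.range i, β j (ξ - ξ') • b j)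
      rw [sub_add_cancel] at h4
      have h5 : (1 + n * (B * B)) * ‖ξ - ξ'‖ ≤ L * ‖ξ - ξ'‖ := by gcongr
      nlinarith [norm_nonneg (ξ - ξ')]
    have hbase : ‖F i 0 - a₀‖ ≤ (n * B + 1) * r := by
      have e1 : F i 0 - a₀ = (F i 0 - a₁ - (τ * r) • ∑ j ∈ Finset.range i, b j) +
          ((τ * r) • ∑ j ∈ Finset.range i, b j - (τ * r) • ∑ j ∈ Finset.range n, b j) := by
        rw [ha₁]; module
      have e2 : (τ * r) • ∑ j ∈ Finset.range i, b j - (τ * r) • ∑ j ∈ Finset.range n, b j =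
          -((τ * r) • ∑ j ∈ Finset.Ico i n, b j) := by
        rw [← Finset.sum_range_add_sum_Ico _ hi']; module
      rw [e1, e2]
      refine (norm_add_le _ _).trans ?_
      rw [norm_neg, norm_smul, Real.norm_of_nonneg (by positivity)]
      have h2 : ‖∑ j ∈ Finset.Ico i n, b j‖ ≤ n * B := by
        refine (norm_sum_le_of_le _ fun j _ => he j).trans ?_
        rw [Finset.sum_const, Nat.card_Ico, nsmul_eq_mul]
        gcongr
        omega
      have h3 : i * (C * (r * B) ^ 2 * τ) ≤ r := by
        calc i * (C * (r * B) ^ 2 * τ) ≤ n * (C * (r * B) ^ 2 * 1) := by gcongr; linarith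
          _ ≤ r := by rw [mul_one]; exact hCr
      have h4 : τ * r * ‖∑ j ∈ Finset.Ico i n, b j‖ ≤ 1 * r * (n * B) := by
        gcongr; linarith
      linarith
    have hmem : ∀ ξ ∈ Metric.closedBall (0 : E) (τ * r / B), F i ξ ∈ Metric.ball a₀ R := by
      intro ξ hξ
      have h1 := hL' ξ hξ 0 h0
      rw [sub_zero] at h1
      rw [mem_closedBall_zero_iff] at hξ
      have h2 : L * ‖ξ‖ ≤ L * r := by
        gcongr
        refine hξ.trans ((div_le_self (by positivity) hB).trans ?_)
        exact mul_le_of_le_one_left hr.le (by linarith)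
      rw [Metric.mem_ball, dist_eq_norm]
      have := norm_sub_le_norm_sub_add_norm_sub (F i ξ) (F i 0) a₀
      have : 0 < B * r := by positivity
      linarith
    have hvmem : F i 0 + r • b i ∈ Metric.ball a₀ R := by
      rw [Metric.mem_ball, dist_eq_norm]
      have e1 : F i 0 + r • b i - a₀ = (F i 0 - a₀) + r • b i := by module
      rw [e1]
      refine (norm_add_le _ _).trans_lt ?_
      rw [norm_smul, Real.norm_of_nonneg hr.le]
      have : r * ‖b i‖ ≤ r * B := by gcongr; exact he i
      have : 0 ≤ L * r := by positivity
      linarith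
    obtain ⟨s1, s2, s3⟩ := h.norm_step_le (p := F i) hB hr hτ hτ' (he i) (hβ i) hL0 hmem hvmem
      rfl hL'
    have hsucc : ∀ ξ, F (i + 1) ξ = g (F i ξ) (F i 0 + r • b i) (τ + β i ξ / r) := fun ξ => rfl
    refine ⟨?_, ?_, ?_⟩
    · rw [hsucc, map_zero, zero_div, add_zero, Finset.sum_range_succ]
      have e1 : g (F i 0) (F i 0 + r • b i) τ - a₁ -
          (τ * r) • (∑ j ∈ Finset.range i, b j + b i) =
        (F i 0 - a₁ - (τ * r) • ∑ j ∈ Finset.range i, b j) +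
          (g (F i 0) (F i 0 + r • b i) τ - F i 0 - (τ * r) • b i) := by module
      rw [e1]
      refine (norm_add_le _ _).trans ?_
      push_cast
      linarith
    · intro ξ hξ ξ' hξ'
      rw [hsucc, hsucc, Finset.sum_range_succ]
      have h1 := s3 ξ hξ ξ' hξ'
      have h2 := ih2 ξ hξ ξ' hξ'
      have h3 := norm_add_le (F i ξ - F i ξ' - ∑ j ∈ Finset.range i, β j (ξ - ξ') • b j)
        (g (F i ξ) (F i 0 + r • b i) (τ + β i ξ / r) -
          g (F i ξ') (F i 0 + r • b i) (τ + β i ξ' / r) - (F i ξ - F i ξ') - β i (ξ - ξ') • b i)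
      push_cast
      have e1 : (i + 1) * σ * ‖ξ - ξ'‖ = i * σ * ‖ξ - ξ'‖ + σ * ‖ξ - ξ'‖ := by ring
      rw [e1]
      refine le_trans (le_of_eq ?_) (h3.trans (add_le_add h2 h1))
      congr 1
      module
    · intro f hf
      obtain ⟨A, hA⟩ := ih3 f hf
      refine ⟨max A |f (F i 0 + r • b i)| + 1, fun ξ hξ => ?_⟩
      rw [hsucc]
      refine hf _ _ (hmem ξ hξ) _ hvmem ?_ ?_ _ (s1 ξ hξ)
      · exact (neg_le_neg (le_max_left _ _)).trans (hA ξ hξ)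
      · exact (neg_le_neg (le_max_right _ _)).trans (neg_abs_le _)

set_option maxHeartbeats 400000 in
-- After `dim E` steps the chain is a perturbation of the identity in `ξ`, so its endpoints fill a
-- ball around `a₀`, while `f` is bounded below on them by means of finitely many of its values. No
-- continuity of `f` enters.
theorem exists_ball_bddBelow [FiniteDimensional ℝ E] {f : E → ℝ}
    (hf : ∀ A, ∀ x ∈ Metric.ball a₀ R, ∀ y ∈ Metric.ball a₀ R, -A ≤ f x → -A ≤ f y →
      ∀ t ∈ Icc (0 : ℝ) 1, -(A + 1) ≤ f (g x y t)) :
    ∃ δ > 0, ∃ A, ∀ a ∈ Metric.ball a₀ δ, -A ≤ f a := by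
  have hR := h.pos_radius
  have hC := h.one_le_const
  set n := Module.finrank ℝ E with hn
  obtain ⟨b, β, B, hB, hBb, hBβ, hsum⟩ := exists_dual_families E
  rw [← hn] at hsum
  set L : ℝ := 1 + n * (B * B) with hL
  have hn0 : (0 : ℝ) ≤ n := n.cast_nonneg
  have hL1 : 1 ≤ L := by
    have : (0 : ℝ) ≤ n * (B * B) := by positivity
    linarith
  set S := B + L with hS
  have hS2 : 2 ≤ S := by linarith
  -- `τ` makes the part `4 τ L` of the `n` errors at most `1 / 4`. The choice of `r` below then
  -- makes the curvature part at most `1 / 8`, and keeps the chain inside the ball of radius `R`.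
  set τ : ℝ := 1 / (16 * (n + 1) * L) with hτ
  have hτ0 : 0 < τ := by positivity
  have hτL : (n + 1) * (16 * L * τ) = 1 := by rw [hτ]; field_simp
  set r : ℝ := min R 1 / (8 * (n + 1) * C * S ^ 3) with hr
  have hmin : 0 < min R 1 := lt_min hR one_pos
  have hr0 : 0 < r := by positivity
  have hrr : r * (8 * (n + 1) * C * S ^ 3) = min R 1 := by rw [hr]; field_simp
  have hS23 : S ^ 2 * B ≤ S ^ 3 := by
    have : S ^ 2 * B ≤ S ^ 2 * S := by gcongr; linarith
    linarith [pow_succ S 2]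
  have hB2 : B ^ 2 ≤ S ^ 2 * B := by
    have : B ≤ S := by linarith
    nlinarith [pow_le_pow_left₀ (by linarith) this 2]
  have hkey : (n + 1) * (C * r * S ^ 3) ≤ 1 / 8 := by
    have : min R 1 ≤ 1 := min_le_right _ _
    nlinarith
  have hkey' : n * (C * r * (S ^ 2 * B)) ≤ 1 / 8 := by
    refine le_trans ?_ hkey
    gcongr
    linarith
  have hτ2 : τ ≤ 1 / 2 := by
    have : 1 * (16 * 1 * τ) ≤ (n + 1) * (16 * L * τ) := by gcongr; linarith
    linarith
  have hspec := h.geodesicChain_spec (n := n) (b := b) (β := β) hB hr0 hτ0 hτ2 hBb hBβ le_rfl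
    (by
      have : n * (16 * L * τ) ≤ 1 := by rw [← hτL]; gcongr; linarith
      rw [mul_add]
      linarith) (by
      have h1 : n * (C * r * B ^ 2) ≤ n * (C * r * (S ^ 2 * B)) := by gcongr
      have h2 : n * (C * (r * B) ^ 2) = n * (C * r * B ^ 2) * r := by ring
      rw [h2]
      exact mul_le_of_le_one_left hr0.le (by linarith)) (by
      have h1 : min R 1 ≤ R := min_le_left _ _
      have h2 : n * B + 1 + L + B ≤ (n + 1) * (2 * S) := by nlinarith
      have h3 : 2 * S ≤ 4 * (1 * S ^ 3) := by nlinarith [sq_nonneg S]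
      have h4 : (n + 1) * (2 * S) ≤ (n + 1) * (4 * (C * S ^ 3)) := by
        refine mul_le_mul_of_nonneg_left (h3.trans ?_) (by positivity)
        gcongr
      have h5 : (n * B + 1 + L + B) * r ≤ (n + 1) * (4 * (C * S ^ 3)) * r :=
        mul_le_mul_of_nonneg_right (h2.trans h4) hr0.le
      have h6 : (n + 1) * (4 * (C * S ^ 3)) * r = min R 1 / 2 := by rw [← hrr]; ring
      linarith)
  obtain ⟨c1, c2, c3⟩ := hspec n le_rfl
  obtain ⟨A, hA⟩ := c3 f hf
  set F := geodesicChain g (a₀ - (τ * r) • ∑ j ∈ Finset.range n, b j) r τ b β with hF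
  have hcov := closedBall_subset_image_of_norm_sub_sub_le (F := F n) (b := 0) (ε := τ * r / B)
    (by positivity) (fun x hx y hy => by
      have h1 := c2 x hx y hy
      rw [hsum] at h1
      refine h1.trans ?_
      gcongr
      have : n * (16 * L * τ) ≤ 1 := by rw [← hτL]; gcongr; linarith
      rw [mul_add]
      linarith)
  have e1 : F n 0 - (a₀ - (τ * r) • ∑ j ∈ Finset.range n, b j) -
    (τ * r) • ∑ j ∈ Finset.range n, b j = F n 0 - a₀ := by module
  rw [e1] at c1
  have hc1 : ‖F n 0 - a₀‖ ≤ τ * r / B / 8 := by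
    refine c1.trans ?_
    rw [div_div, le_div_iff₀ (by positivity)]
    have h2 : B ^ 2 * B ≤ S ^ 3 := by
      have : B ≤ S := by linarith
      calc B ^ 2 * B = B ^ 3 := by ring
        _ ≤ S ^ 3 := by gcongr
    have h3 : n * (C * r * (B ^ 2 * B)) ≤ 1 / 8 := by
      refine le_trans ?_ hkey
      gcongr
      linarith
    calc n * (C * (r * B) ^ 2 * τ) * (B * 8) = n * (C * r * (B ^ 2 * B)) * 8 * (τ * r) := by ring
      _ ≤ 1 / 8 * 8 * (τ * r) := by gcongr
      _ = _ := by ring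
  have hρ : 0 < τ * r / B := by positivity
  refine ⟨τ * r / B / 8, by positivity, A, fun a ha => ?_⟩
  obtain ⟨ξ, hξ, rfl⟩ := hcov (by
    rw [Metric.mem_ball] at ha
    rw [Metric.mem_closedBall]
    rw [← dist_eq_norm] at hc1
    linarith [dist_triangle_right a (F n 0) a₀] : a ∈ _)
  exact hA ξ hξ

end IsGeodesicChart
end GeodesicHull

/-! ### Semiconcave functions in a chart: bounds, Lipschitz constants, superdifferentials. -/

section SemiconcaveChart

variable {E : Type*} [NormedAddCommGroup E] [NormedSpace ℝ E] {M : Type*} [MetricSpace M]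

/-- Lipschitz constant, in a chart, of a semiconcave function bounded by `A`. -/
def semiconcaveLip (θ : ℝ≥0 → ℝ≥0) (R C A : ℝ) : ℝ :=
  8 / R * (2 * A + C * (2 * R) * θ (C * (2 * R)).toNNReal)

/-- Modulus of the superdifferential, in a chart, of a semiconcave function bounded by `A`. -/
def superModulus (θ : ℝ≥0 → ℝ≥0) (R C A r : ℝ) : ℝ :=
  semiconcaveLip θ R C A * C * r + C * θ (C * r).toNNReal

/-- The linear forms that touch `f` from above at `a` up to first order. -/
def frechetSuper (f : E → ℝ) (a : E) : Set (E →L[ℝ] ℝ) :=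
  {P | ∀ ε > 0, ∀ᶠ b in 𝓝 a, f b ≤ f a + P (b - a) + ε * ‖b - a‖}

/-- The linear forms that touch `f` from above at `a`, on the ball `B(a₀, ρ)`, up to an error
controlled by the modulus `m`. -/
def uniformSuper (m : ℝ → ℝ) (a₀ : E) (ρ : ℝ) (f : E → ℝ) (a : E) : Set (E →L[ℝ] ℝ) :=
  {P | ∀ b ∈ Metric.ball a₀ ρ, f b ≤ f a + P (b - a) + ‖b - a‖ * m ‖b - a‖}

theorem frechetSuper_of_tendsto_zero {m : ℝ → ℝ} (hm : Tendsto m (𝓝[>] 0) (𝓝 0)) {f : E → ℝ}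
    {a : E} {P : E →L[ℝ] ℝ} (h : ∀ᶠ b in 𝓝 a, f b ≤ f a + P (b - a) + ‖b - a‖ * m ‖b - a‖) :
    P ∈ frechetSuper f a := by
  intro ε hε
  obtain ⟨δ, hδ, hδ'⟩ := (mem_nhdsGT_iff_exists_Ioo_subset (a := (0 : ℝ))).1
    (hm.eventually (gt_mem_nhds hε))
  filter_upwards [h, Metric.ball_mem_nhds a hδ] with b hb hba
  rcases eq_or_ne b a with rfl | hne
  · simp
  have h1 : 0 < ‖b - a‖ := norm_pos_iff.2 (sub_ne_zero.2 hne)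
  rw [Metric.mem_ball, dist_eq_norm] at hba
  have h2 : m ‖b - a‖ < ε := hδ' ⟨h1, hba⟩
  nlinarith

theorem HasFDerivAt.mem_frechetSuper {f : E → ℝ} {a : E} {P : E →L[ℝ] ℝ}
    (h : HasFDerivAt f P a) : P ∈ frechetSuper f a := by
  intro ε hε
  filter_upwards [(hasFDerivAt_iff_isLittleO.1 h).def hε] with b hb
  have := (abs_le.1 hb).2
  linarith

theorem norm_le_of_mem_frechetSuper {f : E → ℝ} {a : E} {P : E →L[ℝ] ℝ} {L : ℝ} (hL : 0 ≤ L)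
    (hf : ∀ᶠ b in 𝓝 a, f a - f b ≤ L * ‖b - a‖) (hP : P ∈ frechetSuper f a) : ‖P‖ ≤ L := by
  have key : ∀ v, -(L * ‖v‖) ≤ P v := by
    intro v
    apply le_of_forall_pos_le_add
    intro ε hε
    have h1 := hf.and (hP (ε / (‖v‖ + 1)) (by positivity))
    have h2 : Tendsto (fun s : ℝ => a + s • v) (𝓝[>] 0) (𝓝 a) := by
      have : Continuous fun s : ℝ => a + s • v := by fun_prop
      have := this.tendsto 0
      rw [zero_smul, add_zero] at this
      exact this.mono_left nhdsWithin_le_nhds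
    obtain ⟨s, ⟨hs1, hs2⟩, hs⟩ := ((h2.eventually h1).and self_mem_nhdsWithin).exists
    have hs0 : 0 < s := hs
    rw [add_sub_cancel_left, norm_smul, Real.norm_of_nonneg hs0.le] at hs1 hs2
    rw [map_smul, smul_eq_mul] at hs2
    have h3 : 0 ≤ s * (P v + ε / (‖v‖ + 1) * ‖v‖ + L * ‖v‖) := by linarith
    have h4 := nonneg_of_mul_nonneg_right h3 hs0
    have h5 : ε / (‖v‖ + 1) * ‖v‖ ≤ ε := by
      rw [div_mul_eq_mul_div, div_le_iff₀ (by positivity)]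
      nlinarith [norm_nonneg v]
    linarith
  refine P.opNorm_le_bound hL fun v => ?_
  rw [Real.norm_eq_abs, abs_le]
  refine ⟨key v, ?_⟩
  have := key (-v)
  rw [map_neg, norm_neg] at this
  linarith

theorem convex_uniformSuper (m : ℝ → ℝ) (a₀ : E) (ρ : ℝ) (f : E → ℝ) (a : E) :
    Convex ℝ (uniformSuper m a₀ ρ f a) := by
  intro P hP Q hQ s t hs ht hst b hb
  have h1 := mul_le_mul_of_nonneg_left (hP b hb) hs
  have h2 := mul_le_mul_of_nonneg_left (hQ b hb) ht
  simp only [add_apply, smul_apply, smul_eq_mul]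
  have e : ∀ x : ℝ, x = s * x + t * x := fun x => by rw [← add_mul, hst, one_mul]
  rw [e (f b), e (f a), e (‖b - a‖ * m ‖b - a‖)]
  linarith

theorem isClosed_uniformSuper (m : ℝ → ℝ) (a₀ : E) (ρ : ℝ) (f : E → ℝ) (a : E) :
    IsClosed (uniformSuper m a₀ ρ f a) := by
  simp only [uniformSuper, ofPred_forall]
  refine isClosed_biInter fun b _ => isClosed_le continuous_const ?_
  fun_prop

/-- The scale `s` is there for the passage to the limit in `uniformSuper_of_tendsto`, where the
modulus is evaluated at `2 ‖b - a‖`. -/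
theorem tendsto_superModulus {θ : ℝ≥0 → ℝ≥0} (hθ : IsModulus θ) {R C A : ℝ} (hC : 0 < C) (s : ℝ)
    (hs : 0 < s) : Tendsto (fun r => superModulus θ R C A (s * r)) (𝓝[>] 0) (𝓝 0) := by
  have h0 : Tendsto (fun r : ℝ => C * (s * r)) (𝓝[>] 0) (𝓝[>] 0) := by
    apply tendsto_nhdsWithin_iff.2
    constructor
    · have : Continuous fun r : ℝ => C * (s * r) := by fun_prop
      have := this.tendsto 0
      simp only [mul_zero] at this
      exact this.mono_left nhdsWithin_le_nhds
    · filter_upwards [self_mem_nhdsWithin] with r hr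
      have : 0 < r := hr
      exact mul_pos hC (mul_pos hs this)
  have h1 : Tendsto (fun r : ℝ => (C * (s * r)).toNNReal) (𝓝[>] 0) (𝓝[>] 0) := by
    apply tendsto_nhdsWithin_iff.2
    constructor
    · have := (continuous_real_toNNReal.tendsto 0).comp
        (h0.mono_right (nhdsWithin_le_nhds (s := Ioi (0 : ℝ))))
      simpa using! this
    · filter_upwards [h0 self_mem_nhdsWithin] with r hr
      exact Real.toNNReal_pos.2 hr
  have h2 : Tendsto (fun r : ℝ => (θ (C * (s * r)).toNNReal : ℝ)) (𝓝[>] 0) (𝓝 0) := by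
    have := NNReal.tendsto_coe.2 (hθ.tendsto_zero.comp h1)
    simpa using! this
  have h3 := ((h0.mono_right (nhdsWithin_le_nhds (s := Ioi (0 : ℝ)))).const_mul
    (semiconcaveLip θ R C A)).add (h2.const_mul C)
  simp only [mul_zero, add_zero] at h3
  refine h3.congr fun r => ?_
  rw [superModulus]; ring

namespace IsGeodesicChart

variable {X : E → M} {a₀ : E} {R C : ℝ} {g : E → E → ℝ → E} (h : IsGeodesicChart X a₀ R C g)
  {θ : ℝ≥0 → ℝ≥0} (hθ : IsModulus θ) {φ : M → ℝ} (hφ : IsSemiconcave θ φ) {A : ℝ}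

include h hθ hφ

theorem semiconcave_le {a b : E} (ha : a ∈ Metric.ball a₀ R) (hb : b ∈ Metric.ball a₀ R) {t : ℝ}
    (ht : t ∈ Icc (0 : ℝ) 1) : (1 - t) * φ (X a) + t * φ (X b) ≤
      φ (X (g a b t)) + t * (1 - t) * (C * ‖a - b‖ * θ (C * ‖a - b‖).toNNReal) := by
  have h1 := hφ _ (h.isMinGeodesic a ha b hb) t ht
  simp only [Function.comp_apply, h.zero a ha b hb, h.one a ha b hb] at h1
  have h2 := h.dist_le a ha b hb
  have h3 : (θ (nndist (X a) (X b)) : ℝ) ≤ θ (C * ‖a - b‖).toNNReal := by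
    refine NNReal.coe_le_coe.2 (hθ.monotone ?_)
    rw [← NNReal.coe_le_coe, coe_nndist, Real.coe_toNNReal _ (dist_nonneg.trans h2)]
    exact h2
  have h4 : 0 ≤ t * (1 - t) := mul_nonneg ht.1 (by linarith [ht.2])
  have h5 : t * (1 - t) * (dist (X a) (X b) * θ (nndist (X a) (X b))) ≤
      t * (1 - t) * (C * ‖a - b‖ * θ (C * ‖a - b‖).toNNReal) := by
    have := dist_nonneg.trans h2
    gcongr
  linarith

omit hφ in
theorem modulus_le {a b : E} (ha : a ∈ Metric.ball a₀ R) (hb : b ∈ Metric.ball a₀ R) :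
    C * ‖a - b‖ * θ (C * ‖a - b‖).toNNReal ≤ C * (2 * R) * θ (C * (2 * R)).toNNReal := by
  have hC := h.const_pos
  have hR := h.pos_radius
  rw [Metric.mem_ball] at ha hb
  have h1 : ‖a - b‖ ≤ 2 * R := by
    rw [← dist_eq_norm]; linarith [dist_triangle_right a b a₀]
  have h2 : (C * ‖a - b‖).toNNReal ≤ (C * (2 * R)).toNNReal :=
    Real.toNNReal_le_toNNReal (by gcongr)
  have h3 := hθ.monotone h2
  gcongr

theorem exists_ball_bddBelow_of_isSemiconcave [FiniteDimensional ℝ E] :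
    ∃ δ > 0, ∃ A, ∀ a ∈ Metric.ball a₀ δ, -A ≤ φ (X a) := by
  -- Division by `B` makes the defect of concavity at most `1`, as `exists_ball_bddBelow` requires;
  -- the summand `1` keeps `B` positive.
  set B := C * (2 * R) * θ (C * (2 * R)).toNNReal + 1 with hB
  have hC := h.const_pos
  have hR := h.pos_radius
  have hB0 : 0 < B := by positivity
  obtain ⟨δ, hδ, A, hA⟩ := h.exists_ball_bddBelow (f := fun a => φ (X a) / B)
    (by
      intro A x hx y hy hAx hAy t ht
      have h1 := h.semiconcave_le hθ hφ hx hy ht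
      have h2 := h.modulus_le hθ hx hy
      rw [le_div_iff₀ hB0] at hAx hAy ⊢
      have ht' : 0 ≤ 1 - t := by linarith [ht.2]
      have h3 : t * (1 - t) ≤ 1 := by nlinarith [ht.1]
      have h4 : 0 ≤ t * (1 - t) := mul_nonneg ht.1 ht'
      have h5 : t * (1 - t) * (C * ‖x - y‖ * θ (C * ‖x - y‖).toNNReal) ≤ 1 * B := by
        gcongr
        linarith
      have h6 := mul_le_mul_of_nonneg_left hAx ht'
      have h7 := mul_le_mul_of_nonneg_left hAy ht.1
      linarith)
  refine ⟨δ, hδ, A * B, fun a ha => ?_⟩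
  have := hA a ha
  rw [le_div_iff₀ hB0] at this
  linarith

/-- Reflection: `a₀` is made the midpoint of a geodesic from `a` to some `y`, and the lower bound at
`y` becomes an upper bound at `a`. -/
theorem le_of_forall_neg_le [CompleteSpace E] (hA : ∀ x, -A ≤ φ x) {a : E}
    (ha : a ∈ Metric.ball a₀ (R / 16)) :
    φ (X a) ≤ 2 * φ (X a₀) + A + C * (2 * R) * θ (C * (2 * R)).toNNReal := by
  have hR := h.pos_radius
  have hC := h.const_pos
  have haR : a ∈ Metric.ball a₀ R := Metric.ball_subset_ball (by linarith) ha
  obtain ⟨y, hy, hyb⟩ := h.exists_extension (a := a) (b := a₀) (t := 1 / 2)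
    (Metric.ball_subset_ball (by linarith) ha) (by norm_num) (by
      rw [Metric.mem_ball, dist_eq_norm, norm_sub_rev] at ha
      linarith)
  have h1 := h.semiconcave_le hθ hφ haR hy (t := 1 / 2) (by norm_num)
  rw [hyb] at h1
  have h2 := h.modulus_le hθ haR hy
  have h3 := hA (X y)
  have h4 : 0 ≤ C * ‖a - y‖ * θ (C * ‖a - y‖).toNNReal := by positivity
  linarith

variable (hA : ∀ x, |φ x| ≤ A)
include hA

omit hθ hφ in
theorem semiconcaveLip_nonneg : 0 ≤ semiconcaveLip θ R C A := by
  have hR := h.pos_radius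
  have hC := h.const_pos
  have := (abs_nonneg _).trans (hA (X a₀))
  unfold semiconcaveLip
  positivity

/-- The geodesic from `a` to `b` is prolonged to a point `y` that it would reach at time `1`, with
`b` at a time `t` proportional to `‖b - a‖`. Semiconcavity between `a` and `y` then bounds the
decrease from `a` to `b` by `t` times a constant. -/
theorem sub_le_semiconcaveLip [CompleteSpace E] {a b : E} (ha : a ∈ Metric.ball a₀ (R / 16))
    (hb : b ∈ Metric.ball a₀ (R / 16)) :
    φ (X a) - φ (X b) ≤ semiconcaveLip θ R C A * ‖b - a‖ := by
  have hR := h.pos_radius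
  have hC := h.const_pos
  rcases eq_or_ne b a with rfl | hne
  · simp
  have hpos : 0 < ‖b - a‖ := norm_pos_iff.2 (sub_ne_zero.2 hne)
  have haR : a ∈ Metric.ball a₀ R := Metric.ball_subset_ball (by linarith) ha
  set t := ‖b - a‖ / (R / 8) with ht
  have htI : t ∈ Ioc (0 : ℝ) 1 := by
    refine ⟨by positivity, ?_⟩
    rw [ht, div_le_one (by positivity)]
    rw [Metric.mem_ball] at ha hb
    rw [← dist_eq_norm]
    linarith [dist_triangle_right b a a₀]
  obtain ⟨y, hy, hyb⟩ := h.exists_extension (a := a) (b := b) (t := t)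
    (Metric.ball_subset_ball (by linarith) ha) htI (by rw [ht]; field_simp; rfl)
  have htI' : t ∈ Icc (0 : ℝ) 1 := ⟨htI.1.le, htI.2⟩
  have h1 := h.semiconcave_le hθ hφ haR hy htI'
  rw [hyb] at h1
  have h2 := h.modulus_le hθ haR hy
  have h3 := abs_le.1 (hA (X y))
  have h4 := abs_le.1 (hA (X a))
  have h5 : t * (1 - t) * (C * ‖a - y‖ * θ (C * ‖a - y‖).toNNReal) ≤
      t * 1 * (C * (2 * R) * θ (C * (2 * R)).toNNReal) := by
    have := htI.1.le
    gcongr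
    linarith
  have h6 : semiconcaveLip θ R C A * ‖b - a‖ =
      t * (2 * A + C * (2 * R) * θ (C * (2 * R)).toNNReal) := by
    rw [semiconcaveLip, ht]; field_simp
  rw [h6]
  have h7 : t * (φ (X a) - φ (X y)) ≤ t * (2 * A) := by
    have := htI.1.le
    gcongr
    linarith
  linarith

theorem lipschitzOnWith_of_isSemiconcave [CompleteSpace E] :
    LipschitzOnWith (semiconcaveLip θ R C A).toNNReal (φ ∘ X) (Metric.ball a₀ (R / 16)) := by
  apply LipschitzOnWith.of_dist_le_mul
  intro a ha b hb
  rw [Real.coe_toNNReal _ (h.semiconcaveLip_nonneg hA), Real.dist_eq, dist_eq_norm, abs_le]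
  have h1 := h.sub_le_semiconcaveLip hθ hφ hA ha hb
  have h2 := h.sub_le_semiconcaveLip hθ hφ hA hb ha
  rw [norm_sub_rev] at h1
  simp only [Function.comp_apply]
  constructor <;> linarith

theorem continuousAt_of_isSemiconcave [CompleteSpace E] {a : E}
    (ha : a ∈ Metric.ball a₀ (R / 16)) : ContinuousAt (φ ∘ X) a :=
  (h.lipschitzOnWith_of_isSemiconcave hθ hφ hA).continuousOn.continuousAt
    (Metric.isOpen_ball.mem_nhds ha)

theorem norm_le_semiconcaveLip [CompleteSpace E] {a : E} (ha : a ∈ Metric.ball a₀ (R / 16))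
    {P : E →L[ℝ] ℝ} (hP : P ∈ frechetSuper (φ ∘ X) a) : ‖P‖ ≤ semiconcaveLip θ R C A := by
  refine norm_le_of_mem_frechetSuper (h.semiconcaveLip_nonneg hA) ?_ hP
  filter_upwards [Metric.isOpen_ball.mem_nhds ha] with b hb
  exact h.sub_le_semiconcaveLip hθ hφ hA ha hb

/-- Semiconcavity makes first order information at `a` uniform: it is used near `a` on the geodesic
to `b`, inserted in the semiconcavity inequality, and divided by `t`. In `superModulus`, the linear
term pays for the deviation of the geodesic from the segment, tested by `P`, and the other one for
semiconcavity. -/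
theorem uniformSuper_of_frechetSuper [CompleteSpace E] {a : E} (ha : a ∈ Metric.ball a₀ (R / 16))
    {P : E →L[ℝ] ℝ} (hP : P ∈ frechetSuper (φ ∘ X) a) :
    P ∈ uniformSuper (superModulus θ R C A) a₀ (R / 16) (φ ∘ X) a := by
  intro b hb
  have hR := h.pos_radius
  have hC := h.const_pos
  have haR : a ∈ Metric.ball a₀ R := Metric.ball_subset_ball (by linarith) ha
  have hbR : b ∈ Metric.ball a₀ R := Metric.ball_subset_ball (by linarith) hb
  have hPn := h.norm_le_semiconcaveLip hθ hφ hA ha hP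
  set K := ‖b - a‖ + C * ‖b - a‖ ^ 2 with hK
  have hK0 : 0 ≤ K := by positivity
  apply le_of_forall_pos_le_add
  intro ε hε
  have hgt : ∀ t ∈ Icc (0 : ℝ) 1, ‖g a b t - a - t • (b - a)‖ ≤ C * ‖b - a‖ ^ 2 * t := by
    intro t ht
    have := h.norm_sub_le a haR b hbR 0 (by simp) t ht
    rwa [h.zero a haR b hbR, sub_zero, abs_of_nonneg ht.1] at this
  have hgt' : ∀ t ∈ Icc (0 : ℝ) 1, ‖g a b t - a‖ ≤ K * t := by
    intro t ht
    have h1 := norm_add_le (g a b t - a - t • (b - a)) (t • (b - a))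
    rw [sub_add_cancel, norm_smul, Real.norm_of_nonneg ht.1] at h1
    have := hgt t ht
    linarith
  have hI : ∀ᶠ t : ℝ in 𝓝[>] 0, t ∈ Ioc (0 : ℝ) 1 := Ioc_mem_nhdsGT one_pos
  have htend : Tendsto (g a b) (𝓝[>] 0) (𝓝 a) := by
    rw [tendsto_iff_norm_sub_tendsto_zero]
    have h0 : Tendsto (fun t : ℝ => K * t) (𝓝[>] 0) (𝓝 0) := by
      have : Continuous fun t : ℝ => K * t := by fun_prop
      have := this.tendsto 0
      rw [mul_zero] at this
      exact this.mono_left nhdsWithin_le_nhds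
    refine squeeze_zero' (Eventually.of_forall fun t => norm_nonneg _) ?_ h0
    filter_upwards [hI] with t ht
    exact hgt' t ⟨ht.1.le, ht.2⟩
  obtain ⟨t, ht1, ht2⟩ := ((htend.eventually (hP (ε / (K + 1)) (by positivity))).and hI).exists
  have htI : t ∈ Icc (0 : ℝ) 1 := ⟨ht2.1.le, ht2.2⟩
  have h1 := h.semiconcave_le hθ hφ haR hbR htI
  simp only [Function.comp_apply] at ht1 ⊢
  have h2 : P (g a b t - a) ≤ t * P (b - a) + semiconcaveLip θ R C A * (C * ‖b - a‖ ^ 2 * t) := by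
    have e1 : P (g a b t - a) = P (g a b t - a - t • (b - a)) + t * P (b - a) := by
      rw [map_sub P (g a b t - a), map_smul, smul_eq_mul]; ring
    have e2 : P (g a b t - a - t • (b - a)) ≤
        semiconcaveLip θ R C A * (C * ‖b - a‖ ^ 2 * t) := by
      refine (le_abs_self _).trans ((P.le_opNorm _).trans ?_)
      have := hgt t htI
      have := (norm_nonneg P).trans hPn
      gcongr
    linarith
  have h3 : ε / (K + 1) * ‖g a b t - a‖ ≤ ε * t := by
    have h4 := hgt' t htI
    calc ε / (K + 1) * ‖g a b t - a‖ ≤ ε / (K + 1) * (K * t) := by gcongr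
      _ ≤ ε / (K + 1) * ((K + 1) * t) := by
        have := ht2.1.le
        gcongr
        linarith
      _ = ε * t := by field_simp
  rw [norm_sub_rev a b] at h1
  have h5 : t * (1 - t) * (C * ‖b - a‖ * θ (C * ‖b - a‖).toNNReal) ≤
      t * 1 * (C * ‖b - a‖ * θ (C * ‖b - a‖).toNNReal) := by
    have := ht2.1.le
    gcongr
    linarith
  have h6 : t * φ (X b) ≤ t * (φ (X a) + P (b - a) +
      ‖b - a‖ * superModulus θ R C A ‖b - a‖ + ε) := by
    rw [superModulus]
    linarith
  exact le_of_mul_le_mul_left h6 ht2.1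

omit hφ hA in
theorem frechetSuper_of_uniformSuper {a : E} (ha : a ∈ Metric.ball a₀ (R / 16)) {P : E →L[ℝ] ℝ}
    (hP : P ∈ uniformSuper (superModulus θ R C A) a₀ (R / 16) (φ ∘ X) a) :
    P ∈ frechetSuper (φ ∘ X) a := by
  have h1 := tendsto_superModulus hθ (R := R) (A := A) h.const_pos 1 one_pos
  simp only [one_mul] at h1
  exact frechetSuper_of_tendsto_zero h1
    (eventually_of_mem (Metric.isOpen_ball.mem_nhds ha) fun b hb => hP b hb)

omit hθ hφ hA in
theorem superModulus_mono (hθ : IsModulus θ) (hA : 0 ≤ semiconcaveLip θ R C A) :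
    Monotone (superModulus θ R C A) := by
  intro r s hrs
  have hC := h.const_pos
  have h3 := hθ.monotone (Real.toNNReal_le_toNNReal (mul_le_mul_of_nonneg_left hrs hC.le))
  unfold superModulus
  gcongr

/-- Closedness of the graph of the superdifferential, also when the functions vary. The modulus is
monotone but perhaps not continuous, so `m ‖b - ak‖` is first replaced by `m (2 ‖b - a‖)`. The limit
then satisfies a weaker inequality, which still makes it a Fréchet supergradient, and
`uniformSuper_of_frechetSuper` restores the original modulus. -/
theorem uniformSuper_of_tendsto [CompleteSpace E] {ι : Type*} {l : Filter ι} [l.NeBot]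
    {φk : ι → M → ℝ} {ak : ι → E} {Pk : ι → E →L[ℝ] ℝ}
    {a : E} {P : E →L[ℝ] ℝ} (ha : a ∈ Metric.ball a₀ (R / 16))
    (hφk : TendstoUniformly φk φ l) (hak : Tendsto ak l (𝓝 a)) (hPk : Tendsto Pk l (𝓝 P))
    (hmem : ∀ᶠ k in l, Pk k ∈ uniformSuper (superModulus θ R C A) a₀ (R / 16) (φk k ∘ X) (ak k)) :
    P ∈ uniformSuper (superModulus θ R C A) a₀ (R / 16) (φ ∘ X) a := by
  apply h.uniformSuper_of_frechetSuper hθ hφ hA ha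
  have hL := h.semiconcaveLip_nonneg (θ := θ) hA
  have hcont := h.continuousAt_of_isSemiconcave hθ hφ hA ha
  apply frechetSuper_of_tendsto_zero (tendsto_superModulus hθ (R := R) (A := A) h.const_pos 2
    two_pos)
  filter_upwards [Metric.isOpen_ball.mem_nhds ha] with b hb
  rcases eq_or_ne b a with rfl | hne
  · simp
  have hpos : 0 < ‖b - a‖ := norm_pos_iff.2 (sub_ne_zero.2 hne)
  have h1 : Tendsto (fun k => (φk k ∘ X) b) l (𝓝 ((φ ∘ X) b)) := hφk.tendsto_at (X b)
  have h2 : Tendsto (fun k => (φk k ∘ X) (ak k)) l (𝓝 ((φ ∘ X) a)) :=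
    (hφk.comp X).tendsto_comp hcont hak
  have h3 : Tendsto (fun k => b - ak k) l (𝓝 (b - a)) := tendsto_const_nhds.sub hak
  have h4 : Tendsto (fun k => Pk k (b - ak k)) l (𝓝 (P (b - a))) :=
    (isBoundedBilinearMap_apply.continuous.tendsto (P, b - a)).comp (hPk.prodMk_nhds h3)
  have h5 : Tendsto (fun k => ‖b - ak k‖ * superModulus θ R C A (2 * ‖b - a‖)) l
      (𝓝 (‖b - a‖ * superModulus θ R C A (2 * ‖b - a‖))) := h3.norm.mul_const _
  have h6 : ∀ᶠ k in l, ‖b - ak k‖ < 2 * ‖b - a‖ :=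
    h3.norm.eventually (gt_mem_nhds (by linarith))
  refine le_of_tendsto_of_tendsto h1 ((h2.add h4).add h5) ?_
  filter_upwards [hmem, h6] with k hk hk6
  refine (hk b hb).trans ?_
  gcongr
  exact h.superModulus_mono hθ hL hk6.le

/-- By Rademacher's theorem points of differentiability are dense; a cluster point of the
derivatives there is a supergradient. -/
theorem nonempty_uniformSuper [FiniteDimensional ℝ E] {a : E}
    (ha : a ∈ Metric.ball a₀ (R / 16)) :
    (uniformSuper (superModulus θ R C A) a₀ (R / 16) (φ ∘ X) a).Nonempty := by
  borelize E
  have hL := h.semiconcaveLip_nonneg (θ := θ) hA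
  have hlip := h.lipschitzOnWith_of_isSemiconcave hθ hφ hA
  have hae := hlip.ae_differentiableWithinAt_of_mem (μ := Measure.addHaar)
  have hdense := Measure.dense_of_ae hae
  obtain ⟨x, hx, hxa⟩ := mem_closure_iff_seq_limit.1 (hdense a)
  have hxb : ∀ᶠ n in atTop, x n ∈ Metric.ball a₀ (R / 16) :=
    hxa.eventually (Metric.isOpen_ball.mem_nhds ha)
  have hxd : ∀ᶠ n in atTop, fderiv ℝ (φ ∘ X) (x n) ∈ frechetSuper (φ ∘ X) (x n) := by
    filter_upwards [hxb] with n hn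
    exact (((hx n) hn).differentiableAt
      (Metric.isOpen_ball.mem_nhds hn)).hasFDerivAt.mem_frechetSuper
  have hc : IsCompact (Metric.closedBall (0 : E →L[ℝ] ℝ) (semiconcaveLip θ R C A)) :=
    isCompact_closedBall _ _
  obtain ⟨P, -, σ, hσ, hP⟩ := hc.tendsto_subseq' (x := fun n => fderiv ℝ (φ ∘ X) (x n))
    (Eventually.frequently (by
      filter_upwards [hxb, hxd] with n hn hn'
      rw [mem_closedBall_zero_iff]
      exact h.norm_le_semiconcaveLip hθ hφ hA hn hn'))
  refine ⟨P, h.uniformSuper_of_tendsto hθ hφ hA ha (l := atTop) (φk := fun _ => φ)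
    (ak := x ∘ σ) ?_ (hxa.comp hσ.tendsto_atTop) hP ?_⟩
  · rw [Metric.tendstoUniformly_iff]
    exact fun ε hε => Eventually.of_forall fun n x => by simpa using hε
  · filter_upwards [hσ.tendsto_atTop.eventually (hxb.and hxd)] with n hn
    exact h.uniformSuper_of_frechetSuper hθ hφ hA hn.1 hn.2

end IsGeodesicChart

theorem IsSemiconcave.of_tendstoUniformly {θ : ℝ≥0 → ℝ≥0} {φk : ℕ → M → ℝ} {φ : M → ℝ}
    (hφk : ∀ k, IsSemiconcave θ (φk k)) (hlim : TendstoUniformly φk φ atTop) :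
    IsSemiconcave θ φ := by
  intro c hc t ht
  have h1 := ((((hlim.tendsto_at (c 0)).const_mul (1 - t)).add
    ((hlim.tendsto_at (c 1)).const_mul t)).sub (hlim.tendsto_at (c t)))
  exact le_of_tendsto h1 (Eventually.of_forall fun k => hφk k c hc t ht)

/-- The lower bound comes first, from geodesic hulls and compactness; being global, it controls the
reflected point in `le_of_forall_neg_le`, whence the upper bound. -/
theorem IsSemiconcave.exists_abs_le [FiniteDimensional ℝ E] [CompactSpace M] [ChartedSpace E M]
    [IsManifold 𝓘(ℝ, E) ∞ M]
    [RiemannianBundle (fun x : M => TangentSpace 𝓘(ℝ, E) x)]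
    [IsContMDiffRiemannianBundle 𝓘(ℝ, E) ∞ E (fun x : M => TangentSpace 𝓘(ℝ, E) x)]
    [IsRiemannianManifold 𝓘(ℝ, E) M] {θ : ℝ≥0 → ℝ≥0} (hθ : IsModulus θ) {φ : M → ℝ}
    (hφ : IsSemiconcave θ φ) : ∃ A, ∀ x, |φ x| ≤ A := by
  have hglob : ∀ f : M → ℝ, (∀ x₀ : M, ∃ A, ∀ᶠ y in 𝓝 x₀, f y ≤ A) → ∃ A, ∀ x, f x ≤ A := by
    intro f hf
    have := isCompact_univ.induction_on (p := fun s : Set M => ∃ A, ∀ x ∈ s, f x ≤ A)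
      ⟨0, by simp⟩ (fun s t hst ⟨A, hA⟩ => ⟨A, fun x hx => hA x (hst hx)⟩)
      (fun s t ⟨A, hA⟩ ⟨B, hB⟩ => ⟨max A B, fun x hx => hx.elim
        (fun h => (hA x h).trans (le_max_left _ _)) (fun h => (hB x h).trans (le_max_right _ _))⟩)
      (fun x₀ _ => by
        obtain ⟨A, hA⟩ := hf x₀
        exact ⟨{y | f y ≤ A}, mem_nhdsWithin_of_mem_nhds hA, A, fun x hx => hx⟩)
    simpa using this
  have hchart : ∀ (x₀ : M) (δ : ℝ), 0 < δ → ∀ᶠ y in 𝓝 x₀,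
      extChartAt 𝓘(ℝ, E) x₀ y ∈ Metric.ball (extChartAt 𝓘(ℝ, E) x₀ x₀) δ ∧
        (extChartAt 𝓘(ℝ, E) x₀).symm (extChartAt 𝓘(ℝ, E) x₀ y) = y := by
    intro x₀ δ hδ
    filter_upwards [extChartAt_source_mem_nhds (I := 𝓘(ℝ, E)) x₀,
      (continuousAt_extChartAt (I := 𝓘(ℝ, E)) x₀).eventually (Metric.ball_mem_nhds _ hδ)] with y h1 h2
    exact ⟨h2, (extChartAt 𝓘(ℝ, E) x₀).left_inv h1⟩
  obtain ⟨A, hA⟩ := hglob (fun x => -φ x) fun x₀ => by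
    obtain ⟨R, C, g, h, -⟩ := exists_isGeodesicChart (E := E) x₀
    obtain ⟨δ, hδ, A, hA⟩ := h.exists_ball_bddBelow_of_isSemiconcave hθ hφ
    refine ⟨A, ?_⟩
    filter_upwards [hchart x₀ δ hδ] with y hy
    have := hA _ hy.1
    rw [hy.2] at this
    linarith
  obtain ⟨B, hB⟩ := hglob φ fun x₀ => by
    obtain ⟨R, C, g, h, -⟩ := exists_isGeodesicChart (E := E) x₀
    refine ⟨2 * φ ((extChartAt 𝓘(ℝ, E) x₀).symm (extChartAt 𝓘(ℝ, E) x₀ x₀)) + A +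
      C * (2 * R) * θ (C * (2 * R)).toNNReal, ?_⟩
    filter_upwards [hchart x₀ (R / 16) (by have := h.pos_radius; positivity)] with y hy
    have := h.le_of_forall_neg_le hθ hφ (A := A) (fun x => by linarith [hA x]) hy.1
    rwa [hy.2] at this
  refine ⟨max A B, fun x => abs_le.2 ⟨?_, (hB x).trans (le_max_right _ _)⟩⟩
  have := le_max_left A B
  linarith [hA x]

end SemiconcaveChart

/-! ### A `C¹` majorant of a modulus. -/

section Majorant

theorem contDiff_sqrt_norm_sq_add {F : Type*} [NormedAddCommGroup F] [InnerProductSpace ℝ F]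
    {δ : ℝ} (hδ : 0 < δ) : ContDiff ℝ 1 fun w : F => √(‖w‖ ^ 2 + δ ^ 2) := by
  refine ContDiff.sqrt ((contDiff_norm_sq ℝ).add contDiff_const) fun w => ?_
  positivity

theorem lipschitzWith_sqrt_norm_sq_add {F : Type*} [NormedAddCommGroup F]
    (δ : ℝ) : LipschitzWith 1 fun w : F => √(‖w‖ ^ 2 + δ ^ 2) := by
  apply LipschitzWith.of_le_add
  intro v w
  have h1 := dist_eq_norm v w
  have h2 := norm_sub_norm_le v w
  rw [← h1] at h2
  have h3 : (0 : ℝ) ≤ dist v w := dist_nonneg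
  have h4 : 0 ≤ √(‖w‖ ^ 2 + δ ^ 2) := Real.sqrt_nonneg _
  have h5 : ‖w‖ ≤ √(‖w‖ ^ 2 + δ ^ 2) := Real.le_sqrt_of_sq_le (by nlinarith [sq_nonneg δ])
  rw [Real.sqrt_le_left (by positivity)]
  have h6 : √(‖w‖ ^ 2 + δ ^ 2) ^ 2 = ‖w‖ ^ 2 + δ ^ 2 := Real.sq_sqrt (by positivity)
  have h7 : ‖v‖ ^ 2 ≤ (‖w‖ + dist v w) ^ 2 := by
    have := norm_nonneg v
    gcongr
    linarith
  nlinarith [mul_le_mul_of_nonneg_right h5 h3]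

/-- The superdifferential is defined by `C¹` test functions, while semiconcavity yields only an
error `‖v‖ m ‖v‖`. The majorant is a series of smoothed cones of geometrically decreasing slopes,
the `j`-th smoothed at a scale `δ j` below which `m < 2⁻ʲ`. -/
theorem exists_contDiff_majorant {E : Type*} [NormedAddCommGroup E] [NormedSpace ℝ E]
    [FiniteDimensional ℝ E] {m : ℝ → ℝ} (hm : Tendsto m (𝓝[>] 0) (𝓝 0)) :
    ∃ η : E → ℝ, ContDiff ℝ 1 η ∧ η 0 = 0 ∧ HasFDerivAt η (0 : E →L[ℝ] ℝ) 0 ∧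
      ∀ᶠ v in 𝓝 0, ‖v‖ * m ‖v‖ ≤ η v := by
  have hδ : ∀ j : ℕ, ∃ δ > 0, ∀ r, 0 < r → r < δ → m r < (1 / 2) ^ j := by
    intro j
    obtain ⟨δ, hδ, hδ'⟩ := (mem_nhdsGT_iff_exists_Ioo_subset (a := (0 : ℝ))).1
      (hm.eventually (gt_mem_nhds (by positivity : (0 : ℝ) < (1 / 2) ^ j)))
    exact ⟨δ, hδ, fun r h1 h2 => hδ' ⟨h1, h2⟩⟩
  choose δ hδ hδm using hδ
  -- The norm of `E` need not be differentiable off the origin; a Euclidean norm is, and scaling by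
  -- `k` makes it dominate.
  set T : E ≃L[ℝ] EuclideanSpace ℝ (Fin (Module.finrank ℝ E)) := toEuclidean
  set k : ℝ := ‖(T.symm : EuclideanSpace ℝ (Fin (Module.finrank ℝ E)) →L[ℝ] E)‖ with hk
  set S : E →L[ℝ] EuclideanSpace ℝ (Fin (Module.finrank ℝ E)) := k • (T : E →L[ℝ] _) with hS
  have hSn : ∀ v, ‖v‖ ≤ ‖S v‖ := by
    intro v
    have h1 := (T.symm : EuclideanSpace ℝ (Fin (Module.finrank ℝ E)) →L[ℝ] E).le_opNorm (T v)
    rw [hS, smul_apply, norm_smul, Real.norm_of_nonneg (norm_nonneg _)]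
    simpa using h1
  set f : ℕ → E → ℝ := fun j v => 8 * (1 / 2) ^ j * (√(‖S v‖ ^ 2 + δ j ^ 2) - δ j) with hf
  have hfc : ∀ j, ContDiff ℝ 1 (f j) := fun j =>
    contDiff_const.mul (((contDiff_sqrt_norm_sq_add (hδ j)).comp S.contDiff).sub contDiff_const)
  set u : ℕ → ℝ := fun j => (1 / 2 : ℝ) ^ j * (8 * ‖S‖) with hu
  have hus : Summable u := summable_geometric_two.mul_right _
  have hfd : ∀ j v, ‖fderiv ℝ (f j) v‖ ≤ u j := by
    intro j v
    have h1 : LipschitzWith (u j).toNNReal (f j) := by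
      apply LipschitzWith.of_dist_le_mul
      intro v w
      have h2 := ((lipschitzWith_sqrt_norm_sq_add (δ j)).comp S.lipschitz).dist_le_mul v w
      rw [Real.coe_toNNReal _ (by positivity)]
      have h3 : dist (f j v) (f j w) = 8 * (1 / 2) ^ j *
          dist (√(‖S v‖ ^ 2 + δ j ^ 2)) (√(‖S w‖ ^ 2 + δ j ^ 2)) := by
        rw [Real.dist_eq, Real.dist_eq, hf]
        simp only
        rw [← mul_sub, sub_sub_sub_cancel_right, abs_mul, abs_of_pos (by positivity)]
      rw [h3]
      have h4 : dist (√(‖S v‖ ^ 2 + δ j ^ 2)) (√(‖S w‖ ^ 2 + δ j ^ 2)) ≤ ‖S‖ * dist v w := by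
        simpa using! h2
      calc _ ≤ 8 * (1 / 2) ^ j * (‖S‖ * dist v w) := by gcongr
        _ = _ := by rw [hu]; ring
    have h2 := norm_fderiv_le_of_lipschitz ℝ (x₀ := v) h1
    rwa [Real.coe_toNNReal _ (by positivity)] at h2
  have hf0 : ∀ j, f j 0 = 0 := fun j => by
    simp only [hf, map_zero, norm_zero]
    rw [zero_pow two_ne_zero, zero_add, Real.sqrt_sq (hδ j).le, sub_self, mul_zero]
  have hfnn : ∀ j v, 0 ≤ f j v := fun j v => by
    have : δ j ≤ √(‖S v‖ ^ 2 + δ j ^ 2) := Real.le_sqrt_of_sq_le (by nlinarith [sq_nonneg ‖S v‖])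
    have : 0 ≤ √(‖S v‖ ^ 2 + δ j ^ 2) - δ j := by linarith
    simp only [hf]
    positivity
  have hs0 : Summable fun j => f j 0 := by simp [hf0]
  have hfdiff : ∀ j, Differentiable ℝ (f j) := fun j => (hfc j).differentiable (by simp)
  have hsum : ∀ v, Summable fun j => f j v := fun v =>
    summable_of_summable_hasFDerivAt hus (fun j x => (hfdiff j x).hasFDerivAt) hfd hs0 v
  have hηd : ∀ v, HasFDerivAt (fun v => ∑' j, f j v) (∑' j, fderiv ℝ (f j) v) v := fun v =>
    hasFDerivAt_tsum hus (fun j x => (hfdiff j x).hasFDerivAt) hfd hs0 v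
  have hη0 : ∑' j, f j 0 = 0 := by simp [hf0]
  refine ⟨fun v => ∑' j, f j v, ?_, hη0, ?_, ?_⟩
  · rw [contDiff_one_iff_fderiv]
    refine ⟨fun v => (hηd v).differentiableAt, ?_⟩
    rw [fderiv_tsum hus hfdiff hfd hs0]
    exact continuous_tsum (fun j => (hfc j).continuous_fderiv (by simp)) hus hfd
  -- All summands are nonnegative and vanish at `0`, so the derivative at this minimum is zero.
  · have hmin : IsLocalMin (fun v => ∑' j, f j v) 0 :=
      Eventually.of_forall fun v => by
        simp only [hη0]
        exact tsum_nonneg fun j => hfnn j v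
    rw [← hmin.hasFDerivAt_eq_zero (hηd 0)]
    exact hηd 0
  · filter_upwards [Metric.ball_mem_nhds (0 : E) (hδ 0)] with v hv
    rw [mem_ball_zero_iff] at hv
    have hnn : 0 ≤ ∑' j, f j v := tsum_nonneg fun j => hfnn j v
    rcases (norm_nonneg v).eq_or_lt with h0 | hpos
    · rw [← h0, zero_mul]; exact hnn
    by_cases hex : ∃ j, δ j ≤ ‖v‖
    · classical
      -- For the first `j` with `δ j ≤ ‖v‖` the previous scale exceeds `‖v‖`, so `m ‖v‖ < 2 · 2⁻ʲ`,
      -- and the `j`-th cone alone is at least `2 · 2⁻ʲ ‖v‖`. If there is no such `j`, then `m ‖v‖ ≤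
      -- 0`.
      have hj := Nat.find_spec hex
      set j := Nat.find hex with hjdef
      have hj0 : j ≠ 0 := by
        intro h0
        rw [h0] at hj
        linarith
      obtain ⟨i, hi⟩ := Nat.exists_eq_succ_of_ne_zero hj0
      have hi' : ‖v‖ < δ i := not_le.1 (Nat.find_min hex (by omega))
      have h1 := hδm i _ hpos hi'
      have h2 : f j v ≤ ∑' j, f j v := (hsum v).le_tsum j fun i _ => hfnn i v
      have h3 : ‖v‖ / 4 + δ j ≤ √(‖S v‖ ^ 2 + δ j ^ 2) := by
        apply Real.le_sqrt_of_sq_le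
        have h4 : ‖v‖ ^ 2 ≤ ‖S v‖ ^ 2 := by gcongr; exact hSn v
        nlinarith [hδ j]
      have h5 : 8 * (1 / 2) ^ j * (‖v‖ / 4) ≤ f j v := by
        simp only [hf]
        gcongr
        linarith
      have h6 : (1 / 2 : ℝ) ^ j = (1 / 2) ^ i * (1 / 2) := by rw [hi, pow_succ]
      calc ‖v‖ * m ‖v‖ ≤ ‖v‖ * (1 / 2) ^ i := by gcongr
        _ = 8 * (1 / 2) ^ j * (‖v‖ / 4) := by rw [h6]; ring
        _ ≤ _ := h5.trans h2
    · push Not at hex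
      have hm0 : m ‖v‖ ≤ 0 := by
        have h1 : Tendsto (fun j : ℕ => (1 / 2 : ℝ) ^ j) atTop (𝓝 0) :=
          tendsto_pow_atTop_nhds_zero_of_lt_one (by norm_num) (by norm_num)
        exact ge_of_tendsto h1 (Eventually.of_forall fun j => (hδm j _ hpos (hex j)).le)
      nlinarith

end Majorant

/-! ### The superdifferential in coordinates. -/

section Superdiff

variable {E : Type*} [NormedAddCommGroup E] [NormedSpace ℝ E] [FiniteDimensional ℝ E]
    {M : Type*} [MetricSpace M] [ChartedSpace E M] [IsManifold 𝓘(ℝ, E) ∞ M]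

omit [FiniteDimensional ℝ E] in
theorem comp_frame_mem_frechetSuper {φ : M → ℝ} {x₀ : M} {a : E}
    (ha : a ∈ (extChartAt 𝓘(ℝ, E) x₀).target)
    {p : CotSpace E ((extChartAt 𝓘(ℝ, E) x₀).symm a)}
    (hp : p ∈ superdiff φ ((extChartAt 𝓘(ℝ, E) x₀).symm a)) :
    p.comp (frame x₀ ((extChartAt 𝓘(ℝ, E) x₀).symm a)) ∈
      frechetSuper (φ ∘ (extChartAt 𝓘(ℝ, E) x₀).symm) a := by
  obtain ⟨r, hr, ψ, -, hle, heq, hd⟩ := hp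
  have h1 := hd.comp a (hasMFDerivAt_extChartAt_symm_frame ha)
  have h2 : HasFDerivAt (ψ ∘ (extChartAt 𝓘(ℝ, E) x₀).symm)
      (p.comp (frame x₀ ((extChartAt 𝓘(ℝ, E) x₀).symm a))) a := h1.hasFDerivAt
  have h3 := h2.mem_frechetSuper
  have hcont : ContinuousAt (extChartAt 𝓘(ℝ, E) x₀).symm a :=
    (hasMFDerivAt_extChartAt_symm_frame ha).continuousAt
  intro ε hε
  filter_upwards [h3 ε hε, hcont.eventually (Metric.ball_mem_nhds _ hr)] with b hb hb'
  have := hle _ hb'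
  simp only [Function.comp_apply] at hb ⊢
  rw [heq] at hb
  linarith

theorem comp_coframe_mem_superdiff {φ : M → ℝ} {x₀ : M} {a : E}
    (ha : a ∈ (extChartAt 𝓘(ℝ, E) x₀).target) {P : E →L[ℝ] ℝ} {m : ℝ → ℝ}
    (hm : Tendsto m (𝓝[>] 0) (𝓝 0))
    (hP : ∀ᶠ b in 𝓝 a, (φ ∘ (extChartAt 𝓘(ℝ, E) x₀).symm) b ≤
      (φ ∘ (extChartAt 𝓘(ℝ, E) x₀).symm) a + P (b - a) + ‖b - a‖ * m ‖b - a‖) :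
    (P.comp (coframe x₀ ((extChartAt 𝓘(ℝ, E) x₀).symm a)) :
      CotSpace E ((extChartAt 𝓘(ℝ, E) x₀).symm a)) ∈
      superdiff φ ((extChartAt 𝓘(ℝ, E) x₀).symm a) := by
  set ψ := extChartAt 𝓘(ℝ, E) x₀ with hψ
  obtain ⟨η, hη, hη0, hηd, hηm⟩ := exists_contDiff_majorant (E := E) hm
  have hx : ψ.symm a ∈ ψ.source := ψ.map_target ha
  have hψa : ψ (ψ.symm a) = a := ψ.right_inv ha
  have hopen : IsOpen ψ.source := isOpen_extChartAt_source x₀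
  have hψc : ContinuousAt ψ (ψ.symm a) := (hasMFDerivAt_extChartAt_coframe hx).continuousAt
  have ht : Tendsto (fun b => b - a) (𝓝 a) (𝓝 0) := by
    have : Continuous fun b : E => b - a := by fun_prop
    simpa using this.tendsto a
  have hev : ∀ᶠ y in 𝓝 (ψ.symm a), y ∈ ψ.source ∧ φ y ≤ φ (ψ.symm a) + P (ψ y - a) + η (ψ y - a) := by
    have h1 : Tendsto ψ (𝓝 (ψ.symm a)) (𝓝 a) := by
      have := hψc.tendsto
      rwa [hψa] at this
    filter_upwards [hopen.mem_nhds hx, h1.eventually hP, h1.eventually (ht.eventually hηm)]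
      with y hy1 hy2 hy3
    refine ⟨hy1, ?_⟩
    simp only [Function.comp_apply, ψ.left_inv hy1] at hy2
    linarith
  obtain ⟨r, hr, hball⟩ := Metric.eventually_nhds_iff_ball.1 hev
  set F : E → ℝ := fun b => φ (ψ.symm a) + P (b - a) + η (b - a) with hF
  have hFc : ContDiff ℝ 1 F :=
    (contDiff_const.add (P.contDiff.comp (contDiff_id.sub contDiff_const))).add
      (hη.comp (contDiff_id.sub contDiff_const))
  have hFd : HasFDerivAt F P (ψ (ψ.symm a)) := by
    rw [hψa]
    have h1 : HasFDerivAt (fun b : E => b - a) (ContinuousLinearMap.id ℝ E) a :=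
      (hasFDerivAt_id a).sub_const a
    have h2 : HasFDerivAt (fun b => P (b - a)) (P.comp (ContinuousLinearMap.id ℝ E)) a :=
      P.hasFDerivAt.comp a h1
    have h3 : HasFDerivAt (fun b => η (b - a))
        ((0 : E →L[ℝ] ℝ).comp (ContinuousLinearMap.id ℝ E)) a := by
      refine HasFDerivAt.comp a ?_ h1
      rwa [sub_self]
    have h4 := (h2.const_add (φ (ψ.symm a))).add h3
    have e : P.comp (ContinuousLinearMap.id ℝ E) +
        (0 : E →L[ℝ] ℝ).comp (ContinuousLinearMap.id ℝ E) = P := by ext v; simp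
    rw [e] at h4
    exact h4
  refine ⟨r, hr, F ∘ ψ, ?_, fun y hy => (hball y hy).2, ?_, ?_⟩
  · refine hFc.contMDiff.comp_contMDiffOn ?_
    refine ((contMDiffOn_extChartAt (I := 𝓘(ℝ, E)) (x := x₀) (n := 1))).mono fun y hy => ?_
    have := (hball y hy).1
    simpa [hψ] using this
  · simp [hF, hψa, hη0]
  · exact hFd.hasMFDerivAt.comp _ (hasMFDerivAt_extChartAt_coframe hx)

/-- The coordinate description depends on `φ` only through the bound `A` and the modulus, hence it
is the same for a whole sequence. -/
theorem mem_superdiff_iff {x₀ : M} {R C : ℝ} {g : E → E → ℝ → E}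
    (h : IsGeodesicChart (extChartAt 𝓘(ℝ, E) x₀).symm (extChartAt 𝓘(ℝ, E) x₀ x₀) R C g)
    (hR : Metric.ball (extChartAt 𝓘(ℝ, E) x₀ x₀) R ⊆ (extChartAt 𝓘(ℝ, E) x₀).target)
    {θ : ℝ≥0 → ℝ≥0} (hθ : IsModulus θ) {φ : M → ℝ} (hφ : IsSemiconcave θ φ) {A : ℝ}
    (hA : ∀ x, |φ x| ≤ A) {a : E} (ha : a ∈ Metric.ball (extChartAt 𝓘(ℝ, E) x₀ x₀) (R / 16))
    (p : CotSpace E ((extChartAt 𝓘(ℝ, E) x₀).symm a)) :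
    p ∈ superdiff φ ((extChartAt 𝓘(ℝ, E) x₀).symm a) ↔
      p.comp (frame x₀ ((extChartAt 𝓘(ℝ, E) x₀).symm a)) ∈
        uniformSuper (superModulus θ R C A) (extChartAt 𝓘(ℝ, E) x₀ x₀) (R / 16)
          (φ ∘ (extChartAt 𝓘(ℝ, E) x₀).symm) a := by
  have hR0 := h.pos_radius
  have hat : a ∈ (extChartAt 𝓘(ℝ, E) x₀).target :=
    hR (Metric.ball_subset_ball (by linarith) ha)
  constructor
  · intro hp
    exact h.uniformSuper_of_frechetSuper hθ hφ hA ha (comp_frame_mem_frechetSuper hat hp)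
  · intro hp
    have h1 := tendsto_superModulus hθ (R := R) (A := A) h.const_pos 1 one_pos
    simp only [one_mul] at h1
    have h2 := comp_coframe_mem_superdiff (φ := φ) hat h1
      (eventually_of_mem (Metric.isOpen_ball.mem_nhds ha) fun b hb => hp b hb)
    convert h2 using 1
    ext v
    change p v = p (frame x₀ _ (coframe x₀ _ v))
    rw [frame_coframe ((extChartAt 𝓘(ℝ, E) x₀).map_target hat)]

end Superdiff

/-! ### Convex Hamiltonians in coordinates. -/

section CoordHamiltonian

/-- A convex Hamiltonian on an open set of a vector space, with fibre derivative `V`. -/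
structure IsCoordHamiltonian {E : Type*} [NormedAddCommGroup E] [NormedSpace ℝ E] (U : Set E)
    (H : E → (E →L[ℝ] ℝ) → ℝ) (V : E → (E →L[ℝ] ℝ) → E) : Prop where
  hasDerivAt : ∀ a ∈ U, ∀ P Q : E →L[ℝ] ℝ, HasDerivAt (fun s : ℝ => H a (P + s • Q)) (Q (V a P)) 0
  strictConvexOn : ∀ a ∈ U, StrictConvexOn ℝ univ (H a)
  continuousAt : ∀ a ∈ U, ∀ P, ContinuousAt (fun z : E × (E →L[ℝ] ℝ) => H z.1 z.2) (a, P)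

namespace IsCoordHamiltonian

variable {E : Type*} [NormedAddCommGroup E] [NormedSpace ℝ E] {U : Set E}
  {H : E → (E →L[ℝ] ℝ) → ℝ} {V : E → (E →L[ℝ] ℝ) → E}

theorem add_le (h : IsCoordHamiltonian U H V) {a : E} (ha : a ∈ U) (P Q : E →L[ℝ] ℝ) :
    H a P + Q (V a P) ≤ H a (P + Q) := by
  have h1 := (hasDerivAt_iff_tendsto_slope.1 (h.hasDerivAt a ha P Q)).mono_left
    (nhdsWithin_mono (0 : ℝ) fun s (hs : s ∈ Ioi (0 : ℝ)) => ne_of_gt hs)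
  have h2 : Q (V a P) ≤ H a (P + Q) - H a P := by
    refine le_of_tendsto h1 ?_
    filter_upwards [Ioc_mem_nhdsGT (zero_lt_one (α := ℝ))] with s hs
    rw [slope_def_field]
    simp only [zero_smul, add_zero, sub_zero]
    rw [div_le_iff₀ hs.1]
    have h3 := (h.strictConvexOn a ha).convexOn.2 (mem_univ P) (mem_univ (P + Q))
      (sub_nonneg.2 hs.2) hs.1.le (by ring)
    have e : (1 - s) • P + s • (P + Q) = P + s • Q := by module
    rw [e, smul_eq_mul, smul_eq_mul] at h3
    linarith
  linarith

/-- A convex function bounded on a unit ball has bounded slope at the centre. This turns uniform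
convergence of the `H_k` into a common bound on speeds. -/
theorem norm_le_of_forall_le [CompleteSpace E] (h : IsCoordHamiltonian U H V) {a : E} (ha : a ∈ U)
    {P : E →L[ℝ] ℝ} {N : ℝ} (hN : ∀ Q : E →L[ℝ] ℝ, ‖Q‖ ≤ 1 → |H a (P + Q)| ≤ N) :
    ‖V a P‖ ≤ 2 * N := by
  obtain ⟨Q, hQ, hQv⟩ := exists_dual_vector'' ℝ (V a P)
  have h1 := h.add_le ha P Q
  have h2 := (abs_le.1 (hN Q hQ)).2
  have h3 := (abs_le.1 (hN 0 (by simp))).1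
  rw [add_zero] at h3
  have h4 : Q (V a P) = ‖V a P‖ := hQv
  linarith

/-- By convexity `Q (V_k)` is at most a difference quotient of `H_k`. The quotient converges to that
of `H`, which is within `ε` of `Q V` for a small step. The reverse bound is the same statement for
`-Q`. -/
theorem tendsto_apply {ι : Type*} {l : Filter ι} {Hk : ι → E → (E →L[ℝ] ℝ) → ℝ}
    {Vk : ι → E → (E →L[ℝ] ℝ) → E} (hk : ∀ k, IsCoordHamiltonian U (Hk k) (Vk k))
    (h : IsCoordHamiltonian U H V) {ak : ι → E} {Pk : ι → E →L[ℝ] ℝ} {a : E} {P : E →L[ℝ] ℝ}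
    (ha : a ∈ U) (hak : ∀ᶠ k in l, ak k ∈ U)
    (hconv : ∀ (Rk : ι → E →L[ℝ] ℝ) (Q : E →L[ℝ] ℝ), Tendsto Rk l (𝓝 Q) →
      Tendsto (fun k => Hk k (ak k) (Rk k)) l (𝓝 (H a Q)))
    (hP : Tendsto Pk l (𝓝 P)) (Q : E →L[ℝ] ℝ) :
    Tendsto (fun k => Q (Vk k (ak k) (Pk k))) l (𝓝 (Q (V a P))) := by
  have key : ∀ (Q : E →L[ℝ] ℝ) (ε : ℝ), 0 < ε →
      ∀ᶠ k in l, Q (Vk k (ak k) (Pk k)) < Q (V a P) + ε := by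
    intro Q ε hε
    have h1 := (hasDerivAt_iff_tendsto_slope.1 (h.hasDerivAt a ha P Q)).mono_left
      (nhdsWithin_mono (0 : ℝ) fun s (hs : s ∈ Ioi (0 : ℝ)) => ne_of_gt hs)
    obtain ⟨s, hs1, hs2⟩ := ((h1.eventually (gt_mem_nhds (lt_add_of_pos_right _ hε))).and
      self_mem_nhdsWithin).exists
    have hs : 0 < s := hs2
    rw [slope_def_field] at hs1
    simp only [zero_smul, add_zero, sub_zero] at hs1
    rw [div_lt_iff₀ hs] at hs1
    have h2 := hconv (fun k => Pk k + s • Q) (P + s • Q) (hP.add_const _)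
    have h3 := (h2.sub (hconv Pk P hP)).eventually (gt_mem_nhds hs1)
    filter_upwards [h3, hak] with k hk3 hk4
    have h5 := (hk k).add_le hk4 (Pk k) (s • Q)
    rw [smul_apply, smul_eq_mul] at h5
    have h6 : s * Q (Vk k (ak k) (Pk k)) < s * (Q (V a P) + ε) := by linarith
    exact lt_of_mul_lt_mul_left h6 hs.le
  rw [Metric.tendsto_nhds]
  intro ε hε
  filter_upwards [key Q ε hε, key (-Q) ε hε] with k h1 h2
  simp only [neg_apply] at h2
  rw [Real.dist_eq, abs_lt]
  constructor <;> linarith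

theorem exists_unique_min (h : IsCoordHamiltonian U H V) {a : E} (ha : a ∈ U)
    {K : Set (E →L[ℝ] ℝ)} (hK : IsCompact K) (hne : K.Nonempty) (hconv : Convex ℝ K) :
    ∃ P ∈ K, (∀ Q ∈ K, H a P ≤ H a Q) ∧ ∀ Q ∈ K, H a Q ≤ H a P → Q = P := by
  have hc : Continuous (H a) := continuous_iff_continuousAt.2 fun P =>
    (h.continuousAt a ha P).comp (f := fun P => (a, P)) (by fun_prop)
  obtain ⟨P, hP, hmin⟩ := hK.exists_isMinOn hne hc.continuousOn
  refine ⟨P, hP, fun Q hQ => hmin hQ, fun Q hQ hle => ?_⟩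
  exact (((h.strictConvexOn a ha).subset (subset_univ K) hconv).eq_of_isMinOn
    (fun R hR => hle.trans (hmin hR)) hmin hQ hP)

end IsCoordHamiltonian

theorem tendsto_of_forall_clm_tendsto {E : Type*} [NormedAddCommGroup E] [NormedSpace ℝ E]
    [FiniteDimensional ℝ E] {ι : Type*} {l : Filter ι} {v : ι → E} {w : E}
    (h : ∀ Q : E →L[ℝ] ℝ, Tendsto (fun k => Q (v k)) l (𝓝 (Q w))) : Tendsto v l (𝓝 w) := by
  obtain ⟨b, β, -, -, -, -, hsum⟩ := exists_dual_families E
  have h1 := tendsto_finsetSum (Finset.range (Module.finrank ℝ E)) fun i _ =>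
    (h (β i)).smul_const (b i)
  simpa only [hsum] using h1

end CoordHamiltonian

/-! ### Coordinates on the cotangent bundle. -/

section CotangentChart

variable {E : Type*} [NormedAddCommGroup E] [NormedSpace ℝ E] [FiniteDimensional ℝ E]
    {M : Type*} [MetricSpace M] [ChartedSpace E M] [IsManifold 𝓘(ℝ, E) ∞ M]

/-- The point of `T*M` with coordinates `z`, in the chart at `x₀`. -/
def cotPoint (x₀ : M) (z : E × (E →L[ℝ] ℝ)) : CotBundle E M :=
  ⟨(extChartAt 𝓘(ℝ, E) x₀).symm z.1, z.2.comp (coframe x₀ ((extChartAt 𝓘(ℝ, E) x₀).symm z.1))⟩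

/-- The fibre derivative of `H` at the point with coordinates `(a, P)`, in coordinates. -/
def coordFiberDeriv (x₀ : M) (H : CotBundle E M → ℝ) (a : E) (P : E →L[ℝ] ℝ) : E :=
  coframe x₀ ((extChartAt 𝓘(ℝ, E) x₀).symm a) (fiberDeriv H ((extChartAt 𝓘(ℝ, E) x₀).symm a)
    (P.comp (coframe x₀ ((extChartAt 𝓘(ℝ, E) x₀).symm a))))

omit [FiniteDimensional ℝ E] in
theorem trivializationAt_comp_coframe {x₀ x : M} (hx : x ∈ (extChartAt 𝓘(ℝ, E) x₀).source)
    (P : E →L[ℝ] ℝ) : (trivializationAt (E →L[ℝ] ℝ) (fun x : M => CotSpace E x) x₀)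
      (⟨x, P.comp (coframe x₀ x)⟩ : CotBundle E M) = (x, P) := by
  rw [hom_trivializationAt_apply]
  ext1
  · rfl
  · ext v
    have h1 := coframe_frame (E := E) hx v
    change (Trivialization.continuousLinearMapAt ℝ
      (trivializationAt ℝ (Bundle.Trivial M ℝ) x₀) x) (P (coframe x₀ x (frame x₀ x v))) = P v
    rw [h1]
    simp

omit [FiniteDimensional ℝ E] in
theorem continuousAt_cotPoint {x₀ : M} {z : E × (E →L[ℝ] ℝ)}
    (hz : z.1 ∈ (extChartAt 𝓘(ℝ, E) x₀).target) : ContinuousAt (cotPoint x₀) z := by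
  set e := trivializationAt (E →L[ℝ] ℝ) (fun x : M => CotSpace E x) x₀ with he
  have hbase : ∀ x, x ∈ (extChartAt 𝓘(ℝ, E) x₀).source → x ∈ e.baseSet := by
    intro x hx
    rw [he, hom_trivializationAt_baseSet]
    simpa using hx
  have heq : ∀ w : E × (E →L[ℝ] ℝ), w.1 ∈ (extChartAt 𝓘(ℝ, E) x₀).target →
      cotPoint x₀ w = e.toOpenPartialHomeomorph.symm ((extChartAt 𝓘(ℝ, E) x₀).symm w.1, w.2) := by
    intro w hw
    have hx := (extChartAt 𝓘(ℝ, E) x₀).map_target hw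
    have h1 := trivializationAt_comp_coframe hx w.2
    rw [← h1]
    exact (e.toOpenPartialHomeomorph.left_inv (e.mem_source.2 (hbase _ hx))).symm
  have hopen := isOpen_extChartAt_target (I := 𝓘(ℝ, E)) x₀
  have hev : ∀ᶠ w in 𝓝 z, w.1 ∈ (extChartAt 𝓘(ℝ, E) x₀).target :=
    continuous_fst.continuousAt.eventually (hopen.mem_nhds hz)
  have h2 : ContinuousAt (fun w : E × (E →L[ℝ] ℝ) =>
      e.toOpenPartialHomeomorph.symm ((extChartAt 𝓘(ℝ, E) x₀).symm w.1, w.2)) z := by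
    refine ContinuousAt.comp (g := e.toOpenPartialHomeomorph.symm)
      (f := fun w : E × (E →L[ℝ] ℝ) => ((extChartAt 𝓘(ℝ, E) x₀).symm w.1, w.2)) ?_ ?_
    · apply e.toOpenPartialHomeomorph.continuousAt_symm
      rw [e.target_eq]
      exact ⟨hbase _ ((extChartAt 𝓘(ℝ, E) x₀).map_target hz), mem_univ _⟩
    · refine ContinuousAt.prodMk ?_ continuous_snd.continuousAt
      exact (hasMFDerivAt_extChartAt_symm_frame hz).continuousAt.comp continuous_fst.continuousAt
  exact h2.congr (hev.mono fun w hw => (heq w hw).symm)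

variable [RiemannianBundle (fun x : M => TangentSpace 𝓘(ℝ, E) x)]

theorem IsHamiltonian.continuous {H : CotBundle E M → ℝ} (hH : IsHamiltonian H) :
    Continuous H := by
  rw [continuous_iff_continuousAt]
  intro ξ
  obtain ⟨K, s, hs, hK⟩ := hH.locallyLipschitz ξ
  set ψ := extChartAt (𝓘(ℝ, E).prod 𝓘(ℝ, E →L[ℝ] ℝ)) ξ with hψ
  have h1 : ContinuousAt (H ∘ ψ.symm) (ψ ξ) := hK.continuousOn.continuousAt hs
  have h2 : ContinuousAt ψ ξ := continuousAt_extChartAt ξ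
  have h3 : ContinuousAt ((H ∘ ψ.symm) ∘ ψ) ξ := h1.comp h2
  refine h3.congr ?_
  filter_upwards [extChartAt_source_mem_nhds (I := 𝓘(ℝ, E).prod 𝓘(ℝ, E →L[ℝ] ℝ)) ξ] with y hy
  simp only [Function.comp_apply]
  rw [ψ.left_inv hy]

theorem IsHamiltonian.hasDerivAt {H : CotBundle E M → ℝ} (hH : IsHamiltonian H) (x : M)
    (p q : CotSpace E x) : HasDerivAt (fun s : ℝ => H ⟨x, p + s • q⟩) (q (fiberDeriv H x p)) 0 := by
  have h1 : HasFDerivAt (fun p : CotSpace E x => H ⟨x, p⟩)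
    (fderiv ℝ (fun p : CotSpace E x => H ⟨x, p⟩) p) p := (hH.differentiable x p).hasFDerivAt
  rw [apply_fiberDeriv]
  have h2 : HasFDerivAt (fun p : E →L[ℝ] ℝ => H ⟨x, p⟩)
    (fderiv ℝ (fun p : CotSpace E x => H ⟨x, p⟩) p : (E →L[ℝ] ℝ) →L[ℝ] ℝ) (p : E →L[ℝ] ℝ) := h1
  exact h2.hasLineDerivAt q

theorem IsHamiltonian.isCoordHamiltonian {H : CotBundle E M → ℝ} (hH : IsHamiltonian H) (x₀ : M) :
    IsCoordHamiltonian (extChartAt 𝓘(ℝ, E) x₀).target (fun a P => H (cotPoint x₀ (a, P)))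
      (coordFiberDeriv x₀ H) where
  hasDerivAt a _ P Q := hH.hasDerivAt ((extChartAt 𝓘(ℝ, E) x₀).symm a)
    (P.comp (coframe x₀ ((extChartAt 𝓘(ℝ, E) x₀).symm a)))
    (Q.comp (coframe x₀ ((extChartAt 𝓘(ℝ, E) x₀).symm a)))
  strictConvexOn a ha := by
    refine ⟨convex_univ, fun P _ Q _ hne s t hs ht hst => ?_⟩
    have hx := (extChartAt 𝓘(ℝ, E) x₀).map_target ha
    refine (hH.strictConvex ((extChartAt 𝓘(ℝ, E) x₀).symm a)).2
      (x := P.comp (coframe x₀ ((extChartAt 𝓘(ℝ, E) x₀).symm a)))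
      (y := Q.comp (coframe x₀ ((extChartAt 𝓘(ℝ, E) x₀).symm a)))
      (mem_univ _) (mem_univ _) (fun heq => hne ?_) hs ht hst
    ext v
    have h1 := DFunLike.congr_fun heq (frame x₀ _ v)
    change P (coframe x₀ _ (frame x₀ _ v)) = Q (coframe x₀ _ (frame x₀ _ v)) at h1
    rwa [coframe_frame hx] at h1
  continuousAt a ha P := hH.continuous.continuousAt.comp (continuousAt_cotPoint (z := (a, P)) ha)

omit [FiniteDimensional ℝ E] [RiemannianBundle fun x : M => TangentSpace 𝓘(ℝ, E) x] in
theorem isCompact_image_cotPoint {x₀ : M} {K : Set (E × (E →L[ℝ] ℝ))} (hK : IsCompact K)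
    (hKt : ∀ z ∈ K, z.1 ∈ (extChartAt 𝓘(ℝ, E) x₀).target) : IsCompact (cotPoint x₀ '' K) :=
  hK.image_of_continuousOn fun z hz => (continuousAt_cotPoint (hKt z hz)).continuousWithinAt

/-- Uniform convergence on compact sets to a continuous limit allows the argument to move; `σ`
prepares for subsequences. -/
theorem tendsto_cotPoint_of_tendstoUniformlyOn {Hk : ℕ → CotBundle E M → ℝ}
    {H : CotBundle E M → ℝ} (hH : IsHamiltonian H)
    (hlim : ∀ K : Set (CotBundle E M), IsCompact K → TendstoUniformlyOn Hk H atTop K) {x₀ : M}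
    {z : E × (E →L[ℝ] ℝ)} (hz : z.1 ∈ (extChartAt 𝓘(ℝ, E) x₀).target) {ι : Type*} {l : Filter ι}
    {σ : ι → ℕ} (hσ : Tendsto σ l atTop) {zk : ι → E × (E →L[ℝ] ℝ)} (hzk : Tendsto zk l (𝓝 z)) :
    Tendsto (fun k => Hk (σ k) (cotPoint x₀ (zk k))) l (𝓝 (H (cotPoint x₀ z))) := by
  have hopen := isOpen_extChartAt_target (I := 𝓘(ℝ, E)) x₀
  have hnhds : {w : E × (E →L[ℝ] ℝ) | w.1 ∈ (extChartAt 𝓘(ℝ, E) x₀).target} ∈ 𝓝 z :=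
    continuous_fst.continuousAt.eventually (hopen.mem_nhds hz)
  obtain ⟨K, hKz, hKt, hKc⟩ := local_compact_nhds hnhds
  have hunif := hlim _ (isCompact_image_cotPoint hKc hKt)
  have hcont : ContinuousAt (fun z => H (cotPoint x₀ z)) z :=
    hH.continuous.continuousAt.comp (continuousAt_cotPoint hz)
  rw [Metric.tendsto_nhds]
  intro ε hε
  have h1 := Metric.tendsto_nhds.1 (hcont.tendsto.comp hzk) (ε / 2) (half_pos hε)
  have h2 := hσ.eventually (Metric.tendstoUniformlyOn_iff.1 hunif (ε / 2) (half_pos hε))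
  filter_upwards [h1, h2, hzk.eventually hKz] with k hk1 hk2 hk3
  have hk4 := hk2 _ (mem_image_of_mem _ hk3)
  rw [dist_comm] at hk4
  simp only [Function.comp_apply] at hk1
  linarith [dist_triangle (Hk (σ k) (cotPoint x₀ (zk k))) (H (cotPoint x₀ (zk k)))
    (H (cotPoint x₀ z))]

theorem exists_eventually_abs_cotPoint_le {Hk : ℕ → CotBundle E M → ℝ}
    {H : CotBundle E M → ℝ} (hH : IsHamiltonian H)
    (hlim : ∀ K : Set (CotBundle E M), IsCompact K → TendstoUniformlyOn Hk H atTop K) {x₀ : M}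
    {K : Set (E × (E →L[ℝ] ℝ))} (hK : IsCompact K)
    (hKt : ∀ z ∈ K, z.1 ∈ (extChartAt 𝓘(ℝ, E) x₀).target) :
    ∃ N, ∀ᶠ k in atTop, ∀ z ∈ K, |Hk k (cotPoint x₀ z)| ≤ N := by
  have hc := isCompact_image_cotPoint hK hKt
  obtain ⟨N, hN⟩ := hc.exists_bound_of_continuousOn hH.continuous.continuousOn
  refine ⟨N + 1, ?_⟩
  filter_upwards [Metric.tendstoUniformlyOn_iff.1 (hlim _ hc) 1 one_pos] with k hk z hz
  have h1 := hk _ (mem_image_of_mem _ hz)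
  have h2 := hN _ (mem_image_of_mem _ hz)
  rw [dist_comm, Real.dist_eq] at h1
  rw [Real.norm_eq_abs] at h2
  have := abs_sub_abs_le_abs_sub (Hk k (cotPoint x₀ z)) (H (cotPoint x₀ z))
  linarith

end CotangentChart

/-! ### Weak convergence of derivatives of uniformly Lipschitz curves. -/

section WeakConvergence

theorem LipschitzOnWith.ae_norm_deriv_le {F : Type*} [NormedAddCommGroup F] [NormedSpace ℝ F]
    {w : ℝ → F} {α β : ℝ} {Λ : ℝ≥0} (hw : LipschitzOnWith Λ w (Icc α β)) :
    ∀ᵐ t, t ∈ Icc α β → ‖deriv w t‖ ≤ Λ := by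
  have h : ∀ᵐ t : ℝ, t ≠ α ∧ t ≠ β := by
    rw [eventually_and]; exact ⟨Measure.ae_ne volume α, Measure.ae_ne volume β⟩
  filter_upwards [h] with t ht htI
  exact norm_deriv_le_of_lipschitzOn
    (Icc_mem_nhds (lt_of_le_of_ne htI.1 ht.1.symm) (lt_of_le_of_ne htI.2 ht.2)) hw

theorem LipschitzOnWith.ae_differentiableAt_Icc {F : Type*} [NormedAddCommGroup F]
    [NormedSpace ℝ F] [FiniteDimensional ℝ F] {w : ℝ → F} {α β : ℝ} {Λ : ℝ≥0}
    (hw : LipschitzOnWith Λ w (Icc α β)) : ∀ᵐ t, t ∈ Icc α β → DifferentiableAt ℝ w t := by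
  have h : ∀ᵐ t : ℝ, t ≠ α ∧ t ≠ β := by
    rw [eventually_and]; exact ⟨Measure.ae_ne volume α, Measure.ae_ne volume β⟩
  filter_upwards [h, hw.ae_differentiableWithinAt_of_mem (μ := volume)] with t ht hd htI
  exact (hd htI).differentiableAt
    (Icc_mem_nhds (lt_of_le_of_ne htI.1 ht.1.symm) (lt_of_le_of_ne htI.2 ht.2))

/-- Against a polynomial, integration by parts moves the derivative off `d k`. A general `q` is
approximated in `L¹` by polynomials, which costs little because the derivatives are bounded by `Λ`.
-/
theorem tendsto_integral_mul_deriv_zero {d : ℕ → ℝ → ℝ} {α β : ℝ} (hαβ : α ≤ β) {Λ : ℝ≥0}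
    (hd : ∀ k, LipschitzOnWith Λ (d k) (Icc α β))
    (hlim : ∀ t ∈ Icc α β, Tendsto (fun k => d k t) atTop (𝓝 0)) {q : ℝ → ℝ}
    (hq : IntervalIntegrable q volume α β) :
    Tendsto (fun k => ∫ t in α..β, q t * deriv (d k) t) atTop (𝓝 0) := by
  have hα : α ∈ Icc α β := left_mem_Icc.2 hαβ
  have hβ : β ∈ Icc α β := right_mem_Icc.2 hαβ
  have hac : ∀ k, AbsolutelyContinuousOnInterval (d k) α β := fun k =>
    LipschitzOnWith.absolutelyContinuousOnInterval (K := Λ) (by rw [uIcc_of_le hαβ]; exact hd k)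
  have hpoly : ∀ p : Polynomial ℝ,
      Tendsto (fun k => ∫ t in α..β, p.eval t * deriv (d k) t) atTop (𝓝 0) := by
    intro p
    have hpac : AbsolutelyContinuousOnInterval (fun t => p.eval t) α β := by
      have h1 : ContDiff ℝ 1 fun t => p.eval t := by
        simpa using p.contDiff_aeval (R := ℝ) (𝕜 := ℝ) 1
      obtain ⟨K, hK⟩ := h1.contDiffOn.exists_lipschitzOnWith (by simp) (convex_uIcc α β)
        isCompact_uIcc
      exact hK.absolutelyContinuousOnInterval
    simp_rw [fun k => hpac.integral_mul_deriv_eq_deriv_mul (hac k)]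
    have h1 : Tendsto (fun k => ∫ t in α..β, deriv (fun t => p.eval t) t * d k t) atTop
        (𝓝 (∫ t in α..β, deriv (fun t => p.eval t) t * 0)) := by
      apply intervalIntegral.tendsto_integral_filter_of_dominated_convergence
        (fun t => |deriv (fun t => p.eval t) t| * (1 + Λ * (β - α)))
      · refine Eventually.of_forall fun k => ?_
        have h2 : ContinuousOn (fun t => deriv (fun t => p.eval t) t * d k t) (uIoc α β) := by
          have h3 : Continuous (deriv fun t => p.eval t) := by
            rw [show (deriv fun t => p.eval t) = fun t => p.derivative.eval t from
              funext fun t => p.deriv]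
            exact p.derivative.continuous
          rw [uIoc_of_le hαβ]
          exact h3.continuousOn.mul ((hd k).continuousOn.mono Ioc_subset_Icc_self)
        exact h2.aestronglyMeasurable measurableSet_uIoc
      · filter_upwards [(hlim α hα).norm.eventually (gt_mem_nhds (by simp : ‖(0 : ℝ)‖ < 1))]
          with k hk
        refine Eventually.of_forall fun t ht => ?_
        rw [uIoc_of_le hαβ] at ht
        have ht' := Ioc_subset_Icc_self ht
        rw [norm_mul, Real.norm_eq_abs, Real.norm_eq_abs]
        gcongr
        have h2 := (hd k).dist_le_mul t ht' α hα
        rw [Real.dist_eq, Real.dist_eq, abs_of_nonneg (sub_nonneg.2 ht'.1)] at h2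
        have h3 : (Λ : ℝ) * (t - α) ≤ Λ * (β - α) := by gcongr; exact ht'.2
        have h4 := abs_sub_abs_le_abs_sub (d k t) (d k α)
        rw [Real.norm_eq_abs] at hk
        linarith
      · apply Continuous.intervalIntegrable
        rw [show (fun t => |deriv (fun t => p.eval t) t| * (1 + Λ * (β - α))) =
          fun t => |p.derivative.eval t| * (1 + Λ * (β - α)) from funext fun t => by rw [p.deriv]]
        exact (p.derivative.continuous.abs).mul_const _
      · refine Eventually.of_forall fun t ht => ?_
        rw [uIoc_of_le hαβ] at ht
        exact (hlim t (Ioc_subset_Icc_self ht)).const_mul _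
    simp only [mul_zero, intervalIntegral.integral_zero] at h1
    have h2 := (((hlim β hβ).const_mul (p.eval β)).sub ((hlim α hα).const_mul (p.eval α))).sub h1
    simpa using h2
  rw [Metric.tendsto_nhds]
  intro ε hε
  -- `ε'` bounds both the `L¹` error of a continuous approximation and the uniform error of a
  -- polynomial one; times `Λ` the total is at most `ε / 2`. Using `Λ + 1` avoids division by zero.
  set ε' := ε / (2 * (Λ + 1) * (1 + (β - α))) with hε'
  have hβα : 0 ≤ β - α := sub_nonneg.2 hαβ
  have hε'0 : 0 < ε' := by positivity
  have hqi : Integrable q (volume.restrict (Ioc α β)) :=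
    (intervalIntegrable_iff_integrableOn_Ioc_of_le hαβ).1 hq
  obtain ⟨g, hg, hgi⟩ := hqi.exists_boundedContinuous_integral_sub_le hε'0
  obtain ⟨p, hp⟩ := exists_polynomial_near_of_continuousOn α β g g.continuous.continuousOn ε' hε'0
  have hpi : IntervalIntegrable (fun t => p.eval t) volume α β := p.continuous.intervalIntegrable _ _
  have hgi' : IntervalIntegrable g volume α β := g.continuous.intervalIntegrable _ _
  have hqp : ∫ t in α..β, |q t - p.eval t| ≤ ε' * (1 + (β - α)) := by
    calc ∫ t in α..β, |q t - p.eval t| ≤ ∫ t in α..β, (|q t - g t| + ε') := by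
          apply intervalIntegral.integral_mono_on hαβ (hq.sub hpi).abs
            ((hq.sub hgi').abs.add intervalIntegrable_const)
          intro t ht
          have h1 := abs_sub_le (q t) (g t) (p.eval t)
          have h2 := (hp t ht).le
          rw [abs_sub_comm] at h2
          linarith
      _ = (∫ t in α..β, |q t - g t|) + (β - α) * ε' := by
          rw [intervalIntegral.integral_add (hq.sub hgi').abs intervalIntegrable_const]
          simp
      _ ≤ _ := by
          rw [intervalIntegral.integral_of_le hαβ]
          simp only [Real.norm_eq_abs] at hg
          linarith
  filter_upwards [Metric.tendsto_nhds.1 (hpoly p) (ε / 2) (half_pos hε)] with k hk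
  rw [dist_zero_right] at hk ⊢
  have hdi := (hac k).intervalIntegrable_deriv
  have hdb := (hd k).ae_norm_deriv_le
  have hint : ∀ {r : ℝ → ℝ}, IntervalIntegrable r volume α β →
      IntervalIntegrable (fun t => r t * deriv (d k) t) volume α β := by
    intro r hr
    refine (hr.abs.const_mul Λ).mono_fun ?_ ?_
    · exact hr.def'.aestronglyMeasurable.mul (aestronglyMeasurable_deriv _ _)
    · rw [Filter.EventuallyLE, ae_restrict_iff' measurableSet_uIoc]
      filter_upwards [hdb] with t ht htI
      rw [uIoc_of_le hαβ] at htI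
      have := ht (Ioc_subset_Icc_self htI)
      rw [norm_mul, norm_mul, Real.norm_of_nonneg Λ.coe_nonneg, norm_abs_eq_norm, mul_comm]
      gcongr
  have e1 : ∫ t in α..β, q t * deriv (d k) t =
      (∫ t in α..β, (q t - p.eval t) * deriv (d k) t) + ∫ t in α..β, p.eval t * deriv (d k) t := by
    rw [← intervalIntegral.integral_add (hint (hq.sub hpi)) (hint hpi)]
    congr 1
    ext t
    ring
  have h2 : ‖∫ t in α..β, (q t - p.eval t) * deriv (d k) t‖ ≤
      ∫ t in α..β, Λ * |q t - p.eval t| := by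
    apply intervalIntegral.norm_integral_le_of_norm_le hαβ ?_ ((hq.sub hpi).abs.const_mul _)
    filter_upwards [hdb] with t ht htI
    have := ht (Ioc_subset_Icc_self htI)
    rw [norm_mul, mul_comm, Real.norm_eq_abs (q t - p.eval t)]
    gcongr
  rw [intervalIntegral.integral_const_mul] at h2
  have h3 : Λ * ∫ t in α..β, |q t - p.eval t| ≤ ε / 2 := by
    have h0 : 0 ≤ ∫ t in α..β, |q t - p.eval t| :=
      intervalIntegral.integral_nonneg hαβ fun _ _ => abs_nonneg _
    have hΛ : (Λ : ℝ) ≤ Λ + 1 := by linarith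
    calc Λ * ∫ t in α..β, |q t - p.eval t| ≤ (Λ + 1) * (ε' * (1 + (β - α))) := by
          gcongr
      _ = ε / 2 := by rw [hε']; field_simp
  rw [e1]
  linarith [norm_add_le (∫ t in α..β, (q t - p.eval t) * deriv (d k) t)
    (∫ t in α..β, p.eval t * deriv (d k) t)]

variable {E : Type*} [NormedAddCommGroup E] [NormedSpace ℝ E] [FiniteDimensional ℝ E]

theorem tendsto_integral_apply_deriv {w : ℕ → ℝ → E} {v : ℝ → E} {α β : ℝ} (hαβ : α ≤ β)
    {Λ : ℝ≥0} (hw : ∀ k, LipschitzOnWith Λ (w k) (Icc α β)) (hv : LipschitzOnWith Λ v (Icc α β))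
    (hlim : ∀ t ∈ Icc α β, Tendsto (fun k => w k t) atTop (𝓝 (v t))) {Q : ℝ → E →L[ℝ] ℝ}
    (hQ : AEStronglyMeasurable Q (volume.restrict (Icc α β))) {L : ℝ}
    (hQL : ∀ t ∈ Icc α β, ‖Q t‖ ≤ L) :
    Tendsto (fun k => ∫ t in α..β, (Q t (deriv (w k) t) - Q t (deriv v t))) atTop (𝓝 0) := by
  obtain ⟨b, ξ, B, hB, -, hξB, hsum⟩ := exists_dual_families E
  set n := Module.finrank ℝ E
  have hQm : AEStronglyMeasurable Q (volume.restrict (Ioc α β)) :=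
    hQ.mono_measure (Measure.restrict_mono Ioc_subset_Icc_self le_rfl)
  have hqi : ∀ i, IntervalIntegrable (fun t => Q t (b i)) volume α β := by
    intro i
    rw [intervalIntegrable_iff_integrableOn_Ioc_of_le hαβ]
    refine Integrable.of_bound (hQm.apply_continuousLinearMap (b i)) (L * ‖b i‖) ?_
    rw [ae_restrict_iff' measurableSet_Ioc]
    filter_upwards with t ht
    exact (Q t).le_of_opNorm_le (hQL t (Ioc_subset_Icc_self ht)) (b i)
  have hdl : ∀ i k, LipschitzOnWith ((B * (Λ + Λ)).toNNReal) (fun t => ξ i (w k t - v t))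
      (Icc α β) := by
    intro i k
    apply LipschitzOnWith.of_dist_le_mul
    intro s hs t ht
    have h1 := (hw k).dist_le_mul s hs t ht
    have h2 := hv.dist_le_mul s hs t ht
    rw [dist_eq_norm] at h1 h2
    have e : (w k s - v s) - (w k t - v t) = (w k s - w k t) - (v s - v t) := by abel
    rw [Real.coe_toNNReal _ (by positivity), dist_eq_norm, ← map_sub, e]
    calc ‖ξ i ((w k s - w k t) - (v s - v t))‖ ≤ B * ‖(w k s - w k t) - (v s - v t)‖ :=
          (ξ i).le_of_opNorm_le (hξB i) _
      _ ≤ B * (Λ * dist s t + Λ * dist s t) := by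
          gcongr
          exact (norm_sub_le _ _).trans (add_le_add h1 h2)
      _ = _ := by ring
  have hterm : ∀ i, Tendsto (fun k => ∫ t in α..β, Q t (b i) *
      deriv (fun t => ξ i (w k t - v t)) t) atTop (𝓝 0) := fun i =>
    tendsto_integral_mul_deriv_zero hαβ (hdl i) (fun t ht => by
      have h1 := ((ξ i).continuous.tendsto _).comp ((hlim t ht).sub_const (v t))
      rw [sub_self, map_zero] at h1
      exact h1) (hqi i)
  have htot := tendsto_finsetSum (Finset.range n) fun i _ => hterm i
  rw [Finset.sum_const_zero] at htot
  refine htot.congr fun k => ?_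
  rw [← intervalIntegral.integral_finsetSum]
  · apply intervalIntegral.integral_congr_ae
    filter_upwards [(hw k).ae_differentiableAt_Icc, hv.ae_differentiableAt_Icc] with t h1 h2 ht
    rw [uIoc_of_le hαβ] at ht
    have d1 := (h1 (Ioc_subset_Icc_self ht)).hasDerivAt
    have d2 := (h2 (Ioc_subset_Icc_self ht)).hasDerivAt
    have d3 : ∀ i, deriv (fun t => ξ i (w k t - v t)) t = ξ i (deriv (w k) t - deriv v t) :=
      fun i => ((ξ i).hasFDerivAt.comp_hasDerivAt t (d1.sub d2)).deriv
    simp_rw [d3]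
    rw [← map_sub]
    conv_rhs => rw [← hsum (deriv (w k) t - deriv v t), map_sum]
    refine Finset.sum_congr rfl fun i _ => ?_
    rw [map_smul, smul_eq_mul, mul_comm]
  · intro i _
    have hac : AbsolutelyContinuousOnInterval (fun t => ξ i (w k t - v t)) α β :=
      LipschitzOnWith.absolutelyContinuousOnInterval (by rw [uIcc_of_le hαβ]; exact hdl i k)
    rw [intervalIntegrable_iff_integrableOn_Ioc_of_le hαβ]
    refine Integrable.of_bound ((hQm.apply_continuousLinearMap (b i)).mul
      (aestronglyMeasurable_deriv _ _)) (L * ‖b i‖ * (B * (Λ + Λ)).toNNReal) ?_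
    rw [ae_restrict_iff' measurableSet_Ioc]
    filter_upwards [(hdl i k).ae_norm_deriv_le] with t ht htI
    have h1 := (Q t).le_of_opNorm_le (hQL t (Ioc_subset_Icc_self htI)) (b i)
    have h2 := ht (Ioc_subset_Icc_self htI)
    rw [norm_mul]
    gcongr
    exact (norm_nonneg _).trans h1

end WeakConvergence

/-! ### The chain rule for supergradients along a curve. -/

section ChainRule

variable {E : Type*} [NormedAddCommGroup E] [NormedSpace ℝ E]

/-- Up to `o(|s - t|)` the function `f ∘ u - P ∘ u` has a maximum at `t`, so its derivative there
vanishes. In particular all supergradients agree on the velocity. -/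
theorem HasDerivAt.eq_of_mem_frechetSuper {f : E → ℝ} {u : ℝ → E} {v : E} {d t : ℝ}
    (hu : HasDerivAt u v t) (hfu : HasDerivAt (f ∘ u) d t) {P : E →L[ℝ] ℝ}
    (hP : P ∈ frechetSuper f (u t)) : d = P v := by
  have h1 : HasDerivAt (fun s => f (u s) - P (u s)) (d - P v) t :=
    hfu.sub (P.hasFDerivAt.comp_hasDerivAt t hu)
  have hmax : ∀ ε > 0, |d - P v| ≤ ε * (‖v‖ + 2) := by
    intro ε hε
    have e1 := (hasDerivAt_iff_isLittleO.1 h1).def hε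
    have e2 := (hasDerivAt_iff_isLittleO.1 hu).def one_pos
    have e3 := hu.continuousAt.eventually (hP ε hε)
    have key : ∀ᶠ s in 𝓝 t, (s - t) * (d - P v) ≤ ε * (‖v‖ + 2) * |s - t| := by
      filter_upwards [e1, e2, e3] with s s1 s2 s3
      rw [map_sub] at s3
      rw [smul_eq_mul, Real.norm_eq_abs, Real.norm_eq_abs] at s1
      have s4 := (abs_le.1 s1).1
      have s5 : ‖u s - u t‖ ≤ (‖v‖ + 1) * |s - t| := by
        have := norm_add_le (u s - u t - (s - t) • v) ((s - t) • v)
        rw [sub_add_cancel, norm_smul, Real.norm_eq_abs] at this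
        rw [Real.norm_eq_abs] at s2
        linarith
      have s6 : ε * ‖u s - u t‖ ≤ ε * ((‖v‖ + 1) * |s - t|) := by gcongr
      linarith
    obtain ⟨δ, hδ, hball⟩ := Metric.eventually_nhds_iff.1 key
    have hδ2 : 0 < δ / 2 := half_pos hδ
    have k1 := hball (y := t + δ / 2) (by
      rw [Real.dist_eq, add_sub_cancel_left, abs_of_pos hδ2]; linarith)
    have k2 := hball (y := t - δ / 2) (by
      rw [Real.dist_eq, sub_sub_cancel_left, abs_neg, abs_of_pos hδ2]; linarith)
    rw [add_sub_cancel_left, abs_of_pos hδ2] at k1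
    rw [sub_sub_cancel_left, abs_neg, abs_of_pos hδ2] at k2
    rw [abs_le]
    constructor
    · refine le_of_mul_le_mul_left ?_ hδ2; linarith
    · refine le_of_mul_le_mul_left ?_ hδ2; linarith
  have h0 : |d - P v| ≤ 0 := by
    apply le_of_forall_pos_le_add
    intro ε hε
    have := hmax (ε / (‖v‖ + 2)) (by positivity)
    rwa [div_mul_cancel₀ _ (by positivity), ← zero_add ε] at this
  exact sub_eq_zero.1 (abs_nonpos_iff.1 h0)

end ChainRule

/-! ### Measurable minimizers and a common subsequence. -/

section Selection

/-- By compactness, the set of times at which some element of `S t ∩ K` has value at most `q` is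
closed. -/
theorem aemeasurable_of_unique_min {T F : Type*} [TopologicalSpace T] [FirstCountableTopology T]
    [SequentialSpace T] [MeasurableSpace T] [BorelSpace T] [NormedAddCommGroup F] [ProperSpace F]
    [MeasurableSpace F] [BorelSpace F] {S : T → Set F} {h : T → F → ℝ} {Q : T → F} {L : ℝ}
    (hL : ∀ t, ∀ P ∈ S t, ‖P‖ ≤ L)
    (hS : ∀ (s : ℕ → T) (t : T) (P : ℕ → F) (P' : F), Tendsto s atTop (𝓝 t) →
      Tendsto P atTop (𝓝 P') → (∀ n, P n ∈ S (s n)) → P' ∈ S t)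
    (hh : ∀ (s : ℕ → T) (t : T) (P : ℕ → F) (P' : F), Tendsto s atTop (𝓝 t) →
      Tendsto P atTop (𝓝 P') → Tendsto (fun n => h (s n) (P n)) atTop (𝓝 (h t P')))
    (hQ : ∀ t, Q t ∈ S t) (hmin : ∀ t, ∀ P ∈ S t, h t (Q t) ≤ h t P)
    (huniq : ∀ t, ∀ P ∈ S t, h t P ≤ h t (Q t) → P = Q t) : Measurable Q := by
  have hclosed : ∀ K : Set F, IsClosed K → ∀ q : ℝ, IsClosed {t | ∃ P ∈ S t ∩ K, h t P ≤ q} := by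
    intro K hK q
    apply IsSeqClosed.isClosed
    intro s t hs hst
    choose P hP hPq using hs
    obtain ⟨P', -, τ, hτ, hlim⟩ := (isCompact_closedBall (0 : F) L).tendsto_subseq (x := P)
      fun n => mem_closedBall_zero_iff.2 (hL _ _ (hP n).1)
    have hst' := hst.comp hτ.tendsto_atTop
    exact ⟨P', ⟨hS _ t _ P' hst' hlim fun n => (hP (τ n)).1,
      hK.mem_of_tendsto hlim (Eventually.of_forall fun n => (hP (τ n)).2)⟩,
      le_of_tendsto (hh _ t _ P' hst' hlim) (Eventually.of_forall fun n => hPq (τ n))⟩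
  apply measurable_of_isClosed
  intro K hK
  -- `Q t` lies in `K` exactly when the minimum over `S t ∩ K` does not exceed that over `S t`,
  -- which rational levels detect.
  have e : Q ⁻¹' K = ⋂ q : ℚ, ({t | ∃ P ∈ S t ∩ univ, h t P ≤ (q : ℝ)}ᶜ ∪
      {t | ∃ P ∈ S t ∩ K, h t P ≤ (q : ℝ)}) := by
    ext t
    simp only [mem_preimage, mem_iInter, mem_union, mem_compl_iff, mem_ofPred_eq]
    constructor
    · intro ht q
      by_cases hq : h t (Q t) ≤ q
      · exact Or.inr ⟨Q t, ⟨hQ t, ht⟩, hq⟩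
      · exact Or.inl fun ⟨P, hP, hPq⟩ => hq ((hmin t P hP.1).trans hPq)
    · intro ht
      have key : ∀ q : ℚ, h t (Q t) ≤ q → ∃ P ∈ S t ∩ K, h t P ≤ q := fun q hq =>
        (ht q).resolve_left fun hn => hn ⟨Q t, ⟨hQ t, mem_univ _⟩, hq⟩
      have hcomp : IsCompact (S t ∩ K) := by
        refine (isCompact_closedBall (0 : F) L).of_isClosed_subset ?_
          fun P hP => mem_closedBall_zero_iff.2 (hL t P hP.1)
        refine IsClosed.inter (IsSeqClosed.isClosed fun P P' hP hlim => ?_) hK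
        exact hS (fun _ => t) t P P' tendsto_const_nhds hlim hP
      have hcont : ContinuousOn (h t) (S t ∩ K) := by
        refine Continuous.continuousOn (SeqContinuous.continuous fun P P' hlim => ?_)
        exact hh (fun _ => t) t P P' tendsto_const_nhds hlim
      obtain ⟨q₀, hq₀⟩ := exists_rat_gt (h t (Q t))
      obtain ⟨P₀, hP₀, -⟩ := key q₀ hq₀.le
      obtain ⟨P, hP, hPmin⟩ := hcomp.exists_isMinOn ⟨P₀, hP₀⟩ hcont
      have hle : h t P ≤ h t (Q t) := by
        by_contra! hlt
        obtain ⟨q, hq1, hq2⟩ := exists_rat_btwn hlt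
        obtain ⟨P₁, hP₁, hle⟩ := key q hq1.le
        exact absurd ((hPmin hP₁).trans hle) (not_le.2 hq2)
      rw [← huniq t P hP.1 hle]
      exact hP.2
  rw [e]
  exact MeasurableSet.iInter fun q =>
    (hclosed univ isClosed_univ q).measurableSet.compl.union (hclosed K hK q).measurableSet

/-- A single subsequence for countably many measures: the `i`-th index makes the first `i + 1`
integrals at most `2⁻ⁱ`, and summable integrals give convergence almost everywhere. -/
theorem exists_strictMono_ae_tendsto_zero {T : Type*} [MeasurableSpace T] {μ : ℕ → Measure T}
    {g : ℕ → ℕ → T → ENNReal} (hg : ∀ n k, AEMeasurable (g n k) (μ n))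
    (hlim : ∀ n, Tendsto (fun k => ∫⁻ t, g n k t ∂μ n) atTop (𝓝 0)) :
    ∃ σ : ℕ → ℕ, StrictMono σ ∧
      ∀ n, ∀ᵐ t ∂μ n, Tendsto (fun i => g n (σ i) t) atTop (𝓝 0) := by
  have hev : ∀ i : ℕ, ∀ᶠ k in atTop, ∀ n ∈ Finset.range (i + 1),
      ∫⁻ t, g n k t ∂μ n ≤ (2⁻¹ : ENNReal) ^ i := by
    intro i
    rw [Filter.eventually_all_finset]
    intro n _
    have h0 : (0 : ENNReal) < (2⁻¹ : ENNReal) ^ i := by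
      apply ENNReal.pow_pos
      simp
    exact ((hlim n).eventually (gt_mem_nhds h0)).mono fun _ => le_of_lt
  obtain ⟨σ, hσ, hσi⟩ := extraction_forall_of_eventually hev
  refine ⟨σ, hσ, fun n => ?_⟩
  -- The bound for the `n`-th measure is available only from index `n` on, hence the shift.
  have hsum : ∫⁻ t, ∑' i, g n (σ (i + n)) t ∂μ n ≠ ⊤ := by
    rw [lintegral_tsum fun i => hg n _]
    refine ne_top_of_le_ne_top ?_ (ENNReal.tsum_le_tsum (g := fun i => (2⁻¹ : ENNReal) ^ i)
      fun i => ?_)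
    · rw [ENNReal.tsum_geometric]
      simp
    · refine (hσi (i + n) n (Finset.mem_range.2 (by omega))).trans ?_
      exact pow_le_pow_of_le_one zero_le (by simp) (by omega)
  filter_upwards [ae_lt_top' (AEMeasurable.tsum fun i => hg n _) hsum] with t ht
  have h1 := ENNReal.tendsto_cofinite_zero_of_tsum_ne_top ht.ne
  rw [Nat.cofinite_eq_atTop] at h1
  exact (tendsto_add_atTop_iff_nat n).1 h1

end Selection

/-! ### Limits of derivatives. -/

section DerivLimit

/-- Dominated convergence identifies the increments of `v` with integrals of `g`; Lebesgue
differentiation concludes. -/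
theorem LipschitzOnWith.ae_hasDerivAt_of_tendsto_real {w : ℕ → ℝ → ℝ} {v g : ℝ → ℝ} {α β : ℝ}
    (hαβ : α ≤ β) {Λ : ℝ≥0} (hw : ∀ k, LipschitzOnWith Λ (w k) (Icc α β))
    (hlim : ∀ t ∈ Icc α β, Tendsto (fun k => w k t) atTop (𝓝 (v t)))
    (hg : ∀ᵐ t, t ∈ Icc α β → Tendsto (fun k => deriv (w k) t) atTop (𝓝 (g t))) :
    ∀ᵐ t, t ∈ Icc α β → HasDerivAt v (g t) t := by
  have hgm : AEStronglyMeasurable g (volume.restrict (Icc α β)) :=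
    aestronglyMeasurable_of_tendsto_ae atTop (fun k => aestronglyMeasurable_deriv (w k) _)
      ((ae_restrict_iff' measurableSet_Icc).2 hg)
  have hbd : ∀ᵐ t, t ∈ Icc α β → ∀ k, ‖deriv (w k) t‖ ≤ Λ := by
    filter_upwards [ae_all_iff.2 fun k => (hw k).ae_norm_deriv_le] with t ht htI k
    exact ht k htI
  have hgb : ∀ᵐ t, t ∈ Icc α β → ‖g t‖ ≤ Λ := by
    filter_upwards [hg, hbd] with t h1 h2 htI
    exact le_of_tendsto (h1 htI).norm (Eventually.of_forall (h2 htI))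
  have hgi : IntervalIntegrable g volume α β := by
    rw [intervalIntegrable_iff_integrableOn_Icc_of_le hαβ]
    exact Integrable.of_bound hgm Λ ((ae_restrict_iff' measurableSet_Icc).2 hgb)
  have hint : ∀ s ∈ Icc α β, ∫ t in α..s, g t = v s - v α := by
    intro s hs
    have hsub : uIoc α s ⊆ Icc α β := by
      rw [uIoc_of_le hs.1]
      exact fun t ht => ⟨ht.1.le, ht.2.trans hs.2⟩
    have h1 : Tendsto (fun k => ∫ t in α..s, deriv (w k) t) atTop (𝓝 (∫ t in α..s, g t)) := by
      apply intervalIntegral.tendsto_integral_filter_of_dominated_convergence (fun _ => (Λ : ℝ))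
      · exact Eventually.of_forall fun k => aestronglyMeasurable_deriv (w k) _
      · refine Eventually.of_forall fun k => ?_
        filter_upwards [hbd] with t ht htI using ht (hsub htI) k
      · exact intervalIntegrable_const
      · filter_upwards [hg] with t ht htI using ht (hsub htI)
    have h2 : ∀ k, ∫ t in α..s, deriv (w k) t = w k s - w k α := fun k => by
      refine (LipschitzOnWith.absolutelyContinuousOnInterval (K := Λ) ?_).integral_deriv_eq_sub
      rw [uIcc_of_le hs.1]
      exact (hw k).mono (Icc_subset_Icc_right hs.2)
    simp_rw [h2] at h1
    exact tendsto_nhds_unique h1 ((hlim s hs).sub (hlim α (left_mem_Icc.2 hαβ)))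
  have hne : ∀ᵐ t : ℝ, t ≠ α ∧ t ≠ β := by
    rw [eventually_and]; exact ⟨Measure.ae_ne volume α, Measure.ae_ne volume β⟩
  filter_upwards [hne, hgi.ae_hasDerivAt_integral] with t ht hd htI
  rw [uIcc_of_le hαβ] at hd
  have h1 := (hd htI α (left_mem_Icc.2 hαβ)).add_const (v α)
  refine h1.congr_of_eventuallyEq ?_
  filter_upwards [Icc_mem_nhds (lt_of_le_of_ne htI.1 ht.1.symm) (lt_of_le_of_ne htI.2 ht.2)]
    with s hs
  rw [hint s hs]
  ring

variable {E : Type*} [NormedAddCommGroup E] [NormedSpace ℝ E] [FiniteDimensional ℝ E]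

theorem LipschitzOnWith.ae_hasDerivAt_of_tendsto {w : ℕ → ℝ → E} {v g : ℝ → E} {α β : ℝ}
    (hαβ : α ≤ β) {Λ : ℝ≥0} (hw : ∀ k, LipschitzOnWith Λ (w k) (Icc α β))
    (hlim : ∀ t ∈ Icc α β, Tendsto (fun k => w k t) atTop (𝓝 (v t)))
    (hg : ∀ᵐ t, t ∈ Icc α β → Tendsto (fun k => deriv (w k) t) atTop (𝓝 (g t))) :
    ∀ᵐ t, t ∈ Icc α β → HasDerivAt v (g t) t := by
  obtain ⟨b, ξ, B, hB, -, hξB, hsum⟩ := exists_dual_families E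
  have hreal : ∀ i, ∀ᵐ t, t ∈ Icc α β → HasDerivAt (fun s => ξ i (v s)) (ξ i (g t)) t := by
    intro i
    apply LipschitzOnWith.ae_hasDerivAt_of_tendsto_real hαβ (w := fun k s => ξ i (w k s))
      (Λ := ‖ξ i‖₊ * Λ)
    · exact fun k => (ξ i).lipschitz.comp_lipschitzOnWith (hw k)
    · exact fun t ht => ((ξ i).continuous.tendsto _).comp (hlim t ht)
    · filter_upwards [hg, ae_all_iff.2 fun k => (hw k).ae_differentiableAt_Icc] with t h1 h2 htI
      refine (((ξ i).continuous.tendsto _).comp (h1 htI)).congr fun k => ?_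
      exact (((ξ i).hasFDerivAt.comp_hasDerivAt t (h2 k htI).hasDerivAt).deriv).symm
  filter_upwards [ae_all_iff.2 hreal] with t ht htI
  have h1 := HasDerivAt.fun_sum (u := Finset.range (Module.finrank ℝ E))
    fun i _ => (ht i htI).smul_const (b i)
  simpa only [hsum] using h1

end DerivLimit

/-! ### Convergence of minimal selections along curves. -/

section MinimalSelection

variable {E : Type*} [NormedAddCommGroup E] [NormedSpace ℝ E] [FiniteDimensional ℝ E]
  {U : Set E} {Hk : ℕ → E → (E →L[ℝ] ℝ) → ℝ} {Vk : ℕ → E → (E →L[ℝ] ℝ) → E}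
  {H : E → (E →L[ℝ] ℝ) → ℝ} {V : E → (E →L[ℝ] ℝ) → E}
  {Sk : ℕ → E → Set (E →L[ℝ] ℝ)} {S : E → Set (E →L[ℝ] ℝ)} {L : ℝ}
  (hlimH : ∀ σ : ℕ → ℕ, Tendsto σ atTop atTop → ∀ (zk : ℕ → E × (E →L[ℝ] ℝ))
    (z : E × (E →L[ℝ] ℝ)), z.1 ∈ U → Tendsto zk atTop (𝓝 z) →
    Tendsto (fun n => Hk (σ n) (zk n).1 (zk n).2) atTop (𝓝 (H z.1 z.2)))
  (hSL : ∀ k, ∀ a ∈ U, ∀ P ∈ Sk k a, ‖P‖ ≤ L)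
  (hSlim : ∀ σ : ℕ → ℕ, Tendsto σ atTop atTop → ∀ (ak : ℕ → E) (a : E) (Pk : ℕ → E →L[ℝ] ℝ)
    (P : E →L[ℝ] ℝ), a ∈ U → Tendsto ak atTop (𝓝 a) → Tendsto Pk atTop (𝓝 P) →
    (∀ n, Pk n ∈ Sk (σ n) (ak n)) → P ∈ S a)
include hlimH hSL hSlim

/-- Otherwise a cluster point of the `Pk`, which lies in `S a`, would have energy at most `H a Q -
ε`. -/
theorem eventually_neg_lt_sub_of_forall_le {ak : ℕ → E} {a : E} {Pk : ℕ → E →L[ℝ] ℝ}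
    {Q : E →L[ℝ] ℝ} (ha : a ∈ U) (hak : ∀ k, ak k ∈ U) (hlim : Tendsto ak atTop (𝓝 a))
    (hPk : ∀ k, Pk k ∈ Sk k (ak k)) (hQ : ∀ P ∈ S a, H a Q ≤ H a P) {ε : ℝ} (hε : 0 < ε) :
    ∀ᶠ k in atTop, -ε < Hk k (ak k) (Pk k) - Hk k (ak k) Q := by
  by_contra hcon
  obtain ⟨σ, hσ, hσε⟩ := extraction_of_frequently_atTop (not_eventually.1 hcon)
  obtain ⟨P, -, τ, hτ, hP⟩ := (isCompact_closedBall (0 : E →L[ℝ] ℝ) L).tendsto_subseq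
    (x := Pk ∘ σ) fun n => mem_closedBall_zero_iff.2 (hSL _ _ (hak _) _ (hPk (σ n)))
  have hστ := (hσ.comp hτ).tendsto_atTop
  have hst := hlim.comp hστ
  have h1 := hlimH _ hστ _ (a, P) ha (hst.prodMk_nhds hP)
  have h2 := hlimH _ hστ _ (a, Q) ha (hst.prodMk_nhds tendsto_const_nhds)
  have h3 := hQ P (hSlim _ hστ _ a _ P ha hst hP fun n => hPk _)
  have h4 := le_of_tendsto (h1.sub h2) (b := -ε)
    (Eventually.of_forall fun n => not_lt.1 (hσε (τ n)))
  simp only at h4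
  linarith

/-- Each cluster point lies in `S a` and has energy at most that of `Q`, so it is `Q` by uniqueness
of the minimizer. -/
theorem tendsto_of_sub_le {ak : ℕ → E} {a : E} {Pk : ℕ → E →L[ℝ] ℝ}
    {Q : E →L[ℝ] ℝ} (ha : a ∈ U) (hak : ∀ k, ak k ∈ U) (hlim : Tendsto ak atTop (𝓝 a))
    (hPk : ∀ k, Pk k ∈ Sk k (ak k)) (hQ : ∀ P ∈ S a, H a P ≤ H a Q → P = Q) {σ : ℕ → ℕ}
    (hσ : Tendsto σ atTop atTop) {δ : ℕ → ℝ} (hδ : Tendsto δ atTop (𝓝 0))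
    (hle : ∀ i, Hk (σ i) (ak (σ i)) (Pk (σ i)) - Hk (σ i) (ak (σ i)) Q ≤ δ i) :
    Tendsto (fun i => Pk (σ i)) atTop (𝓝 Q) := by
  apply tendsto_of_subseq_tendsto
  intro s hs
  obtain ⟨P, -, τ, hτ, hP⟩ := (isCompact_closedBall (0 : E →L[ℝ] ℝ) L).tendsto_subseq
    (x := fun n => Pk (σ (s n))) fun n => mem_closedBall_zero_iff.2 (hSL _ _ (hak _) _ (hPk _))
  have hst := hs.comp hτ.tendsto_atTop
  have hστ := hσ.comp hst
  have hlim' := hlim.comp hστ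
  have h1 := hlimH _ hστ _ (a, P) ha (hlim'.prodMk_nhds hP)
  have h2 := hlimH _ hστ _ (a, Q) ha (hlim'.prodMk_nhds tendsto_const_nhds)
  have h3 := hSlim _ hστ _ a _ P ha hlim' hP fun n => hPk _
  have h4 := le_of_tendsto_of_tendsto (h1.sub h2) (hδ.comp hst)
    (Eventually.of_forall fun n => hle (s (τ n)))
  rw [hQ P h3 (sub_nonpos.1 h4)] at hP
  exact ⟨τ, hP⟩

variable (hHk : ∀ k, IsCoordHamiltonian U (Hk k) (Vk k)) {fk : ℕ → E → ℝ} {f : E → ℝ} {Lf : ℝ≥0}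
  (hfk : ∀ k, LipschitzOnWith Lf (fk k) U) (hf : LipschitzOnWith Lf f U)
  (hfr : ∀ k, ∀ a ∈ U, ∀ P ∈ Sk k a, P ∈ frechetSuper (fk k) a)
  {uk : ℕ → ℝ → E} {u : ℝ → E} {α β : ℝ} (hαβ : α ≤ β) {Λ : ℝ≥0}
  (huk : ∀ k, LipschitzOnWith Λ (uk k) (Icc α β)) (hu : LipschitzOnWith Λ u (Icc α β))
  (hukU : ∀ k, MapsTo (uk k) (Icc α β) U) (huU : MapsTo u (Icc α β) U)
  (hulim : ∀ t ∈ Icc α β, Tendsto (fun k => uk k t) atTop (𝓝 (u t)))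
  (hflim : ∀ t ∈ Icc α β, Tendsto (fun k => fk k (uk k t)) atTop (𝓝 (f (u t))))
  {Pk : ℕ → ℝ → E →L[ℝ] ℝ} {Q : ℝ → E →L[ℝ] ℝ}
  (hPk : ∀ k, ∀ t ∈ Icc α β, Pk k t ∈ Sk k (uk k t))
  (hQL : ∀ t ∈ Icc α β, ‖Q t‖ ≤ L)
  (hQf : ∀ t ∈ Icc α β, Q t ∈ frechetSuper f (u t))
  (hQm : AEStronglyMeasurable Q (volume.restrict (Icc α β)))
  (hQmin : ∀ t ∈ Icc α β, ∀ P ∈ S (u t), H (u t) (Q t) ≤ H (u t) P)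
  (hdu : ∀ k, ∀ᵐ t, t ∈ Icc α β → HasDerivAt (uk k) (Vk k (uk k t) (Pk k t)) t)
include hHk hfk hf hfr hαβ huk hu hukU huU hulim hflim hPk hQL hQf hQm hQmin hdu

theorem exists_tendsto_lintegral_enorm :
    ∃ A : ℕ → ℝ → ℝ, (∀ k, AEMeasurable (A k) (volume.restrict (Ioc α β))) ∧
      Tendsto (fun k => ∫⁻ t in Ioc α β, ‖A k t‖ₑ) atTop (𝓝 0) ∧
      ∀ᵐ t, t ∈ Icc α β → ∀ k,
        Hk k (uk k t) (Pk k t) - Hk k (uk k t) (Q t) ≤ A k t := by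
  have hL0 : 0 ≤ L := (norm_nonneg _).trans (hQL α (left_mem_Icc.2 hαβ))
  have hQm' : AEStronglyMeasurable Q (volume.restrict (Ioc α β)) :=
    hQm.mono_measure (Measure.restrict_mono Ioc_subset_Icc_self le_rfl)
  have hcomp : ∀ k, LipschitzOnWith (Lf * Λ) (fk k ∘ uk k) (Icc α β) := fun k =>
    (hfk k).comp (huk k) (hukU k)
  have hcomp' : LipschitzOnWith (Lf * Λ) (f ∘ u) (Icc α β) := hf.comp hu huU
  have hac : ∀ {w : ℝ → ℝ}, LipschitzOnWith (Lf * Λ) w (Icc α β) →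
      AbsolutelyContinuousOnInterval w α β := fun hw =>
    LipschitzOnWith.absolutelyContinuousOnInterval (K := Lf * Λ) (by rwa [uIcc_of_le hαβ])
  have hQi : ∀ {w : ℝ → E}, LipschitzOnWith Λ w (Icc α β) →
      AEStronglyMeasurable (fun t => Q t (deriv w t)) (volume.restrict (Ioc α β)) ∧
      IntervalIntegrable (fun t => Q t (deriv w t)) volume α β := by
    intro w hw
    have hm : AEStronglyMeasurable (fun t => Q t (deriv w t)) (volume.restrict (Ioc α β)) :=
      isBoundedBilinearMap_apply.continuous.comp_aestronglyMeasurable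
        (hQm'.prodMk (aestronglyMeasurable_deriv w _))
    refine ⟨hm, ?_⟩
    rw [intervalIntegrable_iff_integrableOn_Ioc_of_le hαβ]
    refine Integrable.of_bound hm (L * Λ) ((ae_restrict_iff' measurableSet_Ioc).2 ?_)
    filter_upwards [hw.ae_norm_deriv_le] with t ht htI
    have htI' := Ioc_subset_Icc_self htI
    exact (Q t).le_of_opNorm_le_of_le (hQL t htI') (ht htI')
  -- By the chain rule this is `(Pk - Q)(uk')`, and `uk'` is the fibre derivative at `Pk`; so
  -- convexity bounds the energy excess of `Pk` over `Q` by it. Its integral involves only endpoint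
  -- values and a weakly convergent term.
  set A : ℕ → ℝ → ℝ := fun k t => deriv (fk k ∘ uk k) t - Q t (deriv (uk k) t) with hA
  have hAi : ∀ k, IntervalIntegrable (A k) volume α β := fun k =>
    (hac (hcomp k)).intervalIntegrable_deriv.sub (hQi (huk k)).2
  have hAb : ∀ᵐ t, t ∈ Icc α β → ∀ k, |A k t| ≤ Lf * Λ + L * Λ := by
    filter_upwards [ae_all_iff.2 fun k => (hcomp k).ae_norm_deriv_le,
      ae_all_iff.2 fun k => (huk k).ae_norm_deriv_le] with t h1 h2 htI k
    have h3 := (Q t).le_of_opNorm_le_of_le (hQL t htI) (h2 k htI)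
    have h4 := norm_sub_le (deriv (fk k ∘ uk k) t) (Q t (deriv (uk k) t))
    have h5 := h1 k htI
    push_cast at h5
    rw [Real.norm_eq_abs] at h4
    linarith
  have hAle : ∀ᵐ t, t ∈ Icc α β → ∀ k,
      Hk k (uk k t) (Pk k t) - Hk k (uk k t) (Q t) ≤ A k t := by
    filter_upwards [ae_all_iff.2 hdu, ae_all_iff.2 fun k => (hcomp k).ae_differentiableAt_Icc]
      with t h1 h2 htI k
    have h3 := (h1 k htI).eq_of_mem_frechetSuper (h2 k htI).hasDerivAt
      (hfr k _ (hukU k htI) _ (hPk k t htI))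
    have h4 := (hHk k).add_le (hukU k htI) (Pk k t) (Q t - Pk k t)
    rw [add_sub_cancel, sub_apply] at h4
    simp only [hA]
    rw [h3, (h1 k htI).deriv]
    linarith
  have hAint : Tendsto (fun k => ∫ t in α..β, A k t) atTop (𝓝 0) := by
    have h1 := tendsto_integral_apply_deriv hαβ huk hu hulim hQm hQL
    have h2 : ∫ t in α..β, Q t (deriv u t) = f (u β) - f (u α) := by
      rw [← Function.comp_apply (f := f) (x := β), ← Function.comp_apply (f := f) (x := α),
        ← (hac hcomp').integral_deriv_eq_sub]
      apply intervalIntegral.integral_congr_ae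
      filter_upwards [hcomp'.ae_differentiableAt_Icc, hu.ae_differentiableAt_Icc] with t h1 h2 htI
      rw [uIoc_of_le hαβ] at htI
      have htI' := Ioc_subset_Icc_self htI
      exact ((h2 htI').hasDerivAt.eq_of_mem_frechetSuper (h1 htI').hasDerivAt (hQf t htI')).symm
    have h3 := ((hflim β (right_mem_Icc.2 hαβ)).sub (hflim α (left_mem_Icc.2 hαβ))).sub
      (h1.add_const (∫ t in α..β, Q t (deriv u t)))
    rw [h2, zero_add, sub_self] at h3
    refine h3.congr fun k => ?_
    rw [← h2, intervalIntegral.integral_sub (hQi (huk k)).2 (hQi hu).2, sub_add_cancel,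
      intervalIntegral.integral_sub (hac (hcomp k)).intervalIntegrable_deriv (hQi (huk k)).2,
      (hac (hcomp k)).integral_deriv_eq_sub]
    rfl
  -- `-A k` is at most the energy deficit of `Pk`, which is eventually below any `ε` at each time
  -- since `Q` minimizes the limit energy.
  have hneg : Tendsto (fun k => ∫ t in α..β, max (-A k t) 0) atTop (𝓝 0) := by
    have h1 : Tendsto (fun k => ∫ t in α..β, max (-A k t) 0) atTop (𝓝 (∫ t in α..β, (0 : ℝ))) := by
      apply intervalIntegral.tendsto_integral_filter_of_dominated_convergence
        (fun _ => Lf * Λ + L * Λ)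
      · exact Eventually.of_forall fun k =>
          ((hAi k).def'.aestronglyMeasurable.neg.sup aestronglyMeasurable_const)
      · refine Eventually.of_forall fun k => ?_
        filter_upwards [hAb] with t ht htI
        rw [uIoc_of_le hαβ] at htI
        have h1 := ht (Ioc_subset_Icc_self htI) k
        rw [Real.norm_of_nonneg (le_max_right _ _)]
        exact max_le ((neg_le_abs _).trans h1) (by positivity)
      · exact intervalIntegrable_const
      · filter_upwards [hAle] with t ht htI
        rw [uIoc_of_le hαβ] at htI
        have htI' := Ioc_subset_Icc_self htI
        rw [Metric.tendsto_nhds]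
        intro ε hε
        filter_upwards [eventually_neg_lt_sub_of_forall_le hlimH hSL hSlim (huU htI')
          (fun k => hukU k htI') (hulim t htI') (fun k => hPk k t htI') (hQmin t htI') hε] with k hk
        rw [dist_zero_right, Real.norm_of_nonneg (le_max_right _ _)]
        exact max_lt (by linarith [ht htI' k]) hε
    simpa using h1
  refine ⟨A, fun k => ?_, ?_, hAle⟩
  · have := (hAi k).def'.aestronglyMeasurable.aemeasurable
    rwa [uIoc_of_le hαβ] at this
  -- The identity used is `|A| = A + 2 max (-A) 0`.
  · have h1 := ENNReal.tendsto_ofReal (hAint.add (hneg.const_mul 2))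
    simp only [mul_zero, add_zero, ENNReal.ofReal_zero] at h1
    refine h1.congr fun k => ?_
    have hi := (intervalIntegrable_iff_integrableOn_Ioc_of_le hαβ).1 (hAi k)
    have hneg' : IntervalIntegrable (fun t => max (-A k t) 0) volume α β := by
      rw [intervalIntegrable_iff_integrableOn_Ioc_of_le hαβ]
      exact hi.neg.pos_part
    rw [← ofReal_integral_norm_eq_lintegral_enorm hi, ← intervalIntegral.integral_of_le hαβ,
      ← intervalIntegral.integral_const_mul,
      ← intervalIntegral.integral_add (hAi k) (hneg'.const_mul 2)]
    congr 2
    ext t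
    rw [Real.norm_eq_abs]
    rcases le_total 0 (A k t) with h | h
    · rw [abs_of_nonneg h, max_eq_right (by linarith)]; ring
    · rw [abs_of_nonpos h, max_eq_left (by linarith)]; ring

omit hf hu hQL hQf hQm hfr hfk hflim hQmin hSL hSlim hlimH hPk in
theorem ae_hasDerivAt_of_tendsto_selection (hH : IsCoordHamiltonian U H V)
    (hlimH : ∀ σ : ℕ → ℕ, Tendsto σ atTop atTop → ∀ (zk : ℕ → E × (E →L[ℝ] ℝ))
      (z : E × (E →L[ℝ] ℝ)), z.1 ∈ U → Tendsto zk atTop (𝓝 z) →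
      Tendsto (fun n => Hk (σ n) (zk n).1 (zk n).2) atTop (𝓝 (H z.1 z.2))) {σ : ℕ → ℕ}
    (hσ : Tendsto σ atTop atTop)
    (hlim : ∀ᵐ t, t ∈ Icc α β → Tendsto (fun i => Pk (σ i) t) atTop (𝓝 (Q t))) :
    ∀ᵐ t, t ∈ Icc α β → HasDerivAt u (V (u t) (Q t)) t := by
  apply LipschitzOnWith.ae_hasDerivAt_of_tendsto hαβ (fun i => huk (σ i))
    (fun t ht => (hulim t ht).comp hσ)
  filter_upwards [ae_all_iff.2 hdu, hlim] with t h1 h2 htI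
  simp_rw [fun i => (h1 (σ i) htI).deriv]
  apply tendsto_of_forall_clm_tendsto
  have hc := (hulim t htI).comp hσ
  exact IsCoordHamiltonian.tendsto_apply (fun i => hHk (σ i)) hH (huU htI)
    (Eventually.of_forall fun i => hukU (σ i) htI)
    (fun R Q' hR => hlimH σ hσ _ (u t, Q') (huU htI) (hc.prodMk_nhds hR)) (h2 htI)

end MinimalSelection

/-! ### The minimal energy selection in coordinates. -/

section ChartMinEnergy

theorem IsCoordHamiltonian.mono {E : Type*} [NormedAddCommGroup E] [NormedSpace ℝ E] {U W : Set E}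
    {H : E → (E →L[ℝ] ℝ) → ℝ} {V : E → (E →L[ℝ] ℝ) → E} (h : IsCoordHamiltonian U H V)
    (hW : W ⊆ U) : IsCoordHamiltonian W H V where
  hasDerivAt a ha := h.hasDerivAt a (hW ha)
  strictConvexOn a ha := h.strictConvexOn a (hW ha)
  continuousAt a ha := h.continuousAt a (hW ha)

variable {E : Type*} [NormedAddCommGroup E] [NormedSpace ℝ E] [FiniteDimensional ℝ E]
    {M : Type*} [MetricSpace M] [ChartedSpace E M] [IsManifold 𝓘(ℝ, E) ∞ M]

/-- The minimal energy selection, in the coordinates of the chart at `x₀`. -/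
def chartMinEnergy (x₀ : M) (φ : M → ℝ) (H : CotBundle E M → ℝ) (a : E) : E →L[ℝ] ℝ :=
  (minEnergy φ H ((extChartAt 𝓘(ℝ, E) x₀).symm a)).comp
    (frame x₀ ((extChartAt 𝓘(ℝ, E) x₀).symm a))

omit [FiniteDimensional ℝ E] in
theorem comp_frame_comp_coframe {x₀ x : M} (hx : x ∈ (extChartAt 𝓘(ℝ, E) x₀).source)
    (p : CotSpace E x) :
    ((p.comp (frame x₀ x)).comp (coframe x₀ x) : CotSpace E x) = p := by
  ext v
  exact congrArg p (frame_coframe hx v)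

omit [FiniteDimensional ℝ E] in
theorem comp_coframe_comp_frame {x₀ x : M} (hx : x ∈ (extChartAt 𝓘(ℝ, E) x₀).source)
    (P : E →L[ℝ] ℝ) : (P.comp (coframe x₀ x)).comp (frame x₀ x) = P := by
  ext v
  exact congrArg P (coframe_frame hx v)

omit [FiniteDimensional ℝ E] in
theorem cotPoint_chartMinEnergy {x₀ x : M} (hx : x ∈ (extChartAt 𝓘(ℝ, E) x₀).source) (φ : M → ℝ)
    (H : CotBundle E M → ℝ) :
    cotPoint x₀ (extChartAt 𝓘(ℝ, E) x₀ x, chartMinEnergy x₀ φ H (extChartAt 𝓘(ℝ, E) x₀ x)) =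
      (⟨x, minEnergy φ H x⟩ : CotBundle E M) := by
  have key : ∀ y ∈ (extChartAt 𝓘(ℝ, E) x₀).source, y = x →
      (⟨y, ((minEnergy φ H y).comp (frame x₀ y)).comp (coframe x₀ y)⟩ : CotBundle E M) =
        ⟨x, minEnergy φ H x⟩ := by
    rintro y hy rfl
    rw [comp_frame_comp_coframe hy]
  have e := (extChartAt 𝓘(ℝ, E) x₀).left_inv hx
  exact key _ (by rwa [e]) e

theorem coordFiberDeriv_chartMinEnergy {x₀ x : M} (hx : x ∈ (extChartAt 𝓘(ℝ, E) x₀).source)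
    (φ : M → ℝ) (H : CotBundle E M → ℝ) :
    coordFiberDeriv x₀ H (extChartAt 𝓘(ℝ, E) x₀ x)
        (chartMinEnergy x₀ φ H (extChartAt 𝓘(ℝ, E) x₀ x)) =
      coframe x₀ x (fiberDeriv H x (minEnergy φ H x)) := by
  have key : ∀ y ∈ (extChartAt 𝓘(ℝ, E) x₀).source, y = x →
      coframe x₀ y (fiberDeriv H y (((minEnergy φ H y).comp (frame x₀ y)).comp (coframe x₀ y))) =
        coframe x₀ x (fiberDeriv H x (minEnergy φ H x)) := by
    rintro y hy rfl
    rw [comp_frame_comp_coframe hy]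
  have e := (extChartAt 𝓘(ℝ, E) x₀).left_inv hx
  exact key _ (by rwa [e]) e

variable [RiemannianBundle (fun x : M => TangentSpace 𝓘(ℝ, E) x)]

theorem IsHamiltonian.chartMinEnergy_spec {H : CotBundle E M → ℝ} (hH : IsHamiltonian H)
    {x₀ : M} {R C : ℝ} {g : E → E → ℝ → E}
    (h : IsGeodesicChart (extChartAt 𝓘(ℝ, E) x₀).symm (extChartAt 𝓘(ℝ, E) x₀ x₀) R C g)
    (hR : Metric.ball (extChartAt 𝓘(ℝ, E) x₀ x₀) R ⊆ (extChartAt 𝓘(ℝ, E) x₀).target)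
    {θ : ℝ≥0 → ℝ≥0} (hθ : IsModulus θ) {φ : M → ℝ} (hφ : IsSemiconcave θ φ) {A : ℝ}
    (hA : ∀ x, |φ x| ≤ A) {a : E} (ha : a ∈ Metric.ball (extChartAt 𝓘(ℝ, E) x₀ x₀) (R / 16)) :
    let S := uniformSuper (superModulus θ R C A) (extChartAt 𝓘(ℝ, E) x₀ x₀) (R / 16)
      (φ ∘ (extChartAt 𝓘(ℝ, E) x₀).symm) a
    chartMinEnergy x₀ φ H a ∈ S ∧
    (∀ P ∈ S, H (cotPoint x₀ (a, chartMinEnergy x₀ φ H a)) ≤ H (cotPoint x₀ (a, P))) ∧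
    ∀ P ∈ S, H (cotPoint x₀ (a, P)) ≤ H (cotPoint x₀ (a, chartMinEnergy x₀ φ H a)) →
      P = chartMinEnergy x₀ φ H a := by
  intro S
  have hR0 := h.pos_radius
  have hat : a ∈ (extChartAt 𝓘(ℝ, E) x₀).target :=
    hR (Metric.ball_subset_ball (by linarith) ha)
  have hx := (extChartAt 𝓘(ℝ, E) x₀).map_target hat
  have hiff := mem_superdiff_iff h hR hθ hφ hA ha
  have hK : IsCompact S := (isCompact_closedBall (0 : E →L[ℝ] ℝ)
    (semiconcaveLip θ R C A)).of_isClosed_subset (isClosed_uniformSuper _ _ _ _ _) fun P hP =>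
      mem_closedBall_zero_iff.2
        (h.norm_le_semiconcaveLip hθ hφ hA ha (h.frechetSuper_of_uniformSuper hθ ha hP))
  obtain ⟨P, hP, hPmin, hPuniq⟩ := (hH.isCoordHamiltonian x₀).exists_unique_min hat hK
    (h.nonempty_uniformSuper hθ hφ hA ha) (convex_uniformSuper _ _ _ _ _)
  set x := (extChartAt 𝓘(ℝ, E) x₀).symm a with hxa
  have hcot : ∀ q : CotSpace E x, (⟨x, q⟩ : CotBundle E M) =
      cotPoint x₀ (a, q.comp (frame x₀ x)) := fun q => by
    change _ = (⟨x, (q.comp (frame x₀ x)).comp (coframe x₀ x)⟩ : CotBundle E M)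
    rw [comp_frame_comp_coframe hx]
  have hmem : ∀ Q ∈ S, (Q.comp (coframe x₀ x) : CotSpace E x) ∈ superdiff φ x := fun Q hQ => by
    rw [hiff, comp_coframe_comp_frame hx]
    exact hQ
  -- A minimizer exists because the superdifferential in coordinates is compact, convex and
  -- nonempty; `minEnergy` is therefore a true minimizer and not an arbitrary value.
  have hspec := Classical.epsilon_spec (p := fun p : CotSpace E x =>
    p ∈ superdiff φ x ∧ ∀ q ∈ superdiff φ x, H ⟨x, p⟩ ≤ H ⟨x, q⟩)
    ⟨P.comp (coframe x₀ x), hmem P hP, fun q hq => by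
      rw [hcot q]
      exact hPmin _ ((hiff q).1 hq)⟩
  have h1 : chartMinEnergy x₀ φ H a ∈ S := (hiff _).1 hspec.1
  have h2 : ∀ Q ∈ S, H (cotPoint x₀ (a, chartMinEnergy x₀ φ H a)) ≤ H (cotPoint x₀ (a, Q)) := by
    intro Q hQ
    have := hspec.2 _ (hmem Q hQ)
    rw [hcot] at this
    exact this
  refine ⟨h1, h2, fun Q hQ hle => ?_⟩
  rw [hPuniq Q hQ (hle.trans (h2 P hP)), hPuniq _ h1 (h2 P hP)]

omit [FiniteDimensional ℝ E] [RiemannianBundle (fun x : M => TangentSpace 𝓘(ℝ, E) x)] in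
theorem HasMFDerivAt.hasDerivAt_extChartAt_comp {γ : ℝ → M} {t : ℝ} {x₀ : M}
    {v : TangentSpace 𝓘(ℝ, E) (γ t)} (hx : γ t ∈ (extChartAt 𝓘(ℝ, E) x₀).source)
    (h : HasMFDerivAt 𝓘(ℝ, ℝ) 𝓘(ℝ, E) γ t (ContinuousLinearMap.toSpanSingleton ℝ v)) :
    HasDerivAt (extChartAt 𝓘(ℝ, E) x₀ ∘ γ) (coframe x₀ (γ t) v) t := by
  have h1 := (hasMFDerivAt_extChartAt_coframe hx).comp t h
  have h2 : HasFDerivAt (extChartAt 𝓘(ℝ, E) x₀ ∘ γ) ((coframe (E := E) x₀ (γ t) : E →L[ℝ] E).comp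
    (ContinuousLinearMap.toSpanSingleton ℝ (v : E))) t := hasMFDerivAt_iff_hasFDerivAt.1 h1
  convert! h2.hasDerivAt using 1
  change _ = (coframe (E := E) x₀ (γ t) : E →L[ℝ] E) ((1 : ℝ) • (v : E))
  rw [one_smul]

omit [FiniteDimensional ℝ E] [RiemannianBundle (fun x : M => TangentSpace 𝓘(ℝ, E) x)] in
theorem HasDerivAt.hasMFDerivAt_of_extChartAt_comp {γ : ℝ → M} {t : ℝ} {x₀ : M}
    {v : TangentSpace 𝓘(ℝ, E) (γ t)}
    (hx : ∀ᶠ s in 𝓝 t, γ s ∈ (extChartAt 𝓘(ℝ, E) x₀).source)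
    (h : HasDerivAt (extChartAt 𝓘(ℝ, E) x₀ ∘ γ) (coframe x₀ (γ t) v) t) :
    HasMFDerivAt 𝓘(ℝ, ℝ) 𝓘(ℝ, E) γ t (ContinuousLinearMap.toSpanSingleton ℝ v) := by
  have hxt := hx.self_of_nhds
  set ψ := extChartAt 𝓘(ℝ, E) x₀ with hψ
  set w : E := coframe x₀ (γ t) v with hw
  have h1 : HasMFDerivAt 𝓘(ℝ, ℝ) 𝓘(ℝ, E) (ψ ∘ γ) t
    (ContinuousLinearMap.toSpanSingleton ℝ w : ℝ →L[ℝ] E) :=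
    hasMFDerivAt_iff_hasFDerivAt.2 h.hasFDerivAt
  have h2 := (hasMFDerivAt_extChartAt_symm_frame (ψ.map_source hxt)).comp t h1
  have h3 : ∀ T : ℝ →L[ℝ] E, T = (frame (E := E) x₀ (ψ.symm (ψ (γ t))) : E →L[ℝ] E).comp
      (ContinuousLinearMap.toSpanSingleton ℝ w) → HasMFDerivAt 𝓘(ℝ, ℝ) 𝓘(ℝ, E) γ t T := by
    rintro _ rfl
    refine HasMFDerivAt.congr_of_eventuallyEq h2 ?_
    filter_upwards [hx] with s hs
    exact (ψ.left_inv hs).symm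
  have key : ∀ y, y = γ t → (frame (E := E) x₀ y : E →L[ℝ] E) w = v := by
    rintro y rfl
    exact frame_coframe hxt v
  have e : (frame (E := E) x₀ (ψ.symm (ψ (γ t))) : E →L[ℝ] E).comp
      (ContinuousLinearMap.toSpanSingleton ℝ w) = ContinuousLinearMap.toSpanSingleton ℝ (v : E) := by
    ext
    change (frame (E := E) x₀ (ψ.symm (ψ (γ t))) : E →L[ℝ] E) ((1 : ℝ) • w) = (1 : ℝ) • (v : E)
    rw [one_smul, one_smul]
    exact key _ (ψ.left_inv hxt)
  exact h3 _ e.symm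

end ChartMinEnergy

/-! ### The limit on an interval whose image lies in one chart. -/

section LocalLimit

variable {E : Type*} [NormedAddCommGroup E] [NormedSpace ℝ E] [FiniteDimensional ℝ E]
    {M : Type*} [MetricSpace M] [ChartedSpace E M] [IsManifold 𝓘(ℝ, E) ∞ M]
    [RiemannianBundle (fun x : M => TangentSpace 𝓘(ℝ, E) x)]

omit [RiemannianBundle (fun x : M => TangentSpace 𝓘(ℝ, E) x)] in
theorem IsStrictSingularChar.ae_hasDerivAt_extChartAt {φ : M → ℝ} {H : CotBundle E M → ℝ}
    {γ : ℝ → M} (hγ : IsStrictSingularChar φ H γ) (x₀ : M) :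
    ∀ᵐ t : ℝ, γ t ∈ (extChartAt 𝓘(ℝ, E) x₀).source →
      HasDerivAt (extChartAt 𝓘(ℝ, E) x₀ ∘ γ) (coordFiberDeriv x₀ H (extChartAt 𝓘(ℝ, E) x₀ (γ t))
        (chartMinEnergy x₀ φ H (extChartAt 𝓘(ℝ, E) x₀ (γ t)))) t := by
  filter_upwards [hγ.deriv_eq] with t ht hx
  rw [coordFiberDeriv_chartMinEnergy hx]
  exact ht.hasDerivAt_extChartAt_comp hx

theorem IsHamiltonian.aestronglyMeasurable_chartMinEnergy {H : CotBundle E M → ℝ}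
    (hH : IsHamiltonian H) {x₀ : M} {R C : ℝ} {g : E → E → ℝ → E}
    (h : IsGeodesicChart (extChartAt 𝓘(ℝ, E) x₀).symm (extChartAt 𝓘(ℝ, E) x₀ x₀) R C g)
    (hR : Metric.ball (extChartAt 𝓘(ℝ, E) x₀ x₀) R ⊆ (extChartAt 𝓘(ℝ, E) x₀).target)
    {θ : ℝ≥0 → ℝ≥0} (hθ : IsModulus θ) {φ : M → ℝ} (hφ : IsSemiconcave θ φ) {A : ℝ}
    (hA : ∀ x, |φ x| ≤ A) {u : ℝ → E} {α β : ℝ} (hu : ContinuousOn u (Icc α β))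
    (huU : MapsTo u (Icc α β) (Metric.ball (extChartAt 𝓘(ℝ, E) x₀ x₀) (R / 16))) :
    AEStronglyMeasurable (fun t => chartMinEnergy x₀ φ H (u t))
      (volume.restrict (Icc α β)) := by
  borelize (E →L[ℝ] ℝ)
  have hR0 := h.pos_radius
  have hUt : Metric.ball (extChartAt 𝓘(ℝ, E) x₀ x₀) (R / 16) ⊆ (extChartAt 𝓘(ℝ, E) x₀).target :=
    (Metric.ball_subset_ball (by linarith)).trans hR
  have hspec := fun t : Icc α β => hH.chartMinEnergy_spec h hR hθ hφ hA (huU t.2)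
  have huc : Continuous fun t : Icc α β => u t := continuousOn_iff_continuous_domRestrict.1 hu
  apply AEMeasurable.aestronglyMeasurable
  apply aemeasurable_restrict_of_measurable_subtype measurableSet_Icc
  refine aemeasurable_of_unique_min
    (S := fun t : Icc α β => uniformSuper (superModulus θ R C A) (extChartAt 𝓘(ℝ, E) x₀ x₀) (R / 16)
      (φ ∘ (extChartAt 𝓘(ℝ, E) x₀).symm) (u t)) (h := fun t P => H (cotPoint x₀ (u t, P)))
    (L := semiconcaveLip θ R C A) ?_ ?_ ?_ (fun t => (hspec t).1) (fun t => (hspec t).2.1)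
    (fun t => (hspec t).2.2)
  · exact fun t P hP => h.norm_le_semiconcaveLip hθ hφ hA (huU t.2)
      (h.frechetSuper_of_uniformSuper hθ (huU t.2) hP)
  · intro s t P P' hs hP hmem
    refine h.uniformSuper_of_tendsto hθ hφ hA (huU t.2) (l := atTop) (φk := fun _ => φ)
      (ak := fun n => u (s n)) ?_ ((huc.tendsto t).comp hs) hP (Eventually.of_forall hmem)
    rw [Metric.tendstoUniformly_iff]
    exact fun ε hε => Eventually.of_forall fun n x => by simpa using hε
  · intro s t P P' hs hP
    exact (hH.continuous.continuousAt.comp (continuousAt_cotPoint (z := (u t, P'))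
      (hUt (huU t.2)))).tendsto.comp (((huc.tendsto t).comp hs).prodMk_nhds hP)

/-- No subsequence is extracted here. The functions `G k` tend to zero in `L¹`, and along every
subsequence where they tend to zero almost everywhere the conclusion holds; this lets one
subsequence serve countably many intervals later. -/
theorem exists_lintegral_tendsto_zero_of_isGeodesicChart
    {θ : ℝ≥0 → ℝ≥0} (hθ : IsModulus θ)
    {φk : ℕ → M → ℝ} {φ : M → ℝ} {Hk : ℕ → CotBundle E M → ℝ} {H : CotBundle E M → ℝ}
    {γk : ℕ → ℝ → M} {γ : ℝ → M}
    (hφk : ∀ k, IsSemiconcave θ (φk k)) (hφ : IsSemiconcave θ φ)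
    (hHk : ∀ k, IsHamiltonian (Hk k)) (hH : IsHamiltonian H)
    (hγk : ∀ k, IsStrictSingularChar (φk k) (Hk k) (γk k))
    (hφ_lim : TendstoUniformly φk φ atTop)
    (hH_lim : ∀ K : Set (CotBundle E M), IsCompact K → TendstoUniformlyOn Hk H atTop K)
    {A : ℝ} (hAk : ∀ k x, |φk k x| ≤ A) (hA : ∀ x, |φ x| ≤ A)
    {x₀ : M} {R C : ℝ} {g : E → E → ℝ → E}
    (h : IsGeodesicChart (extChartAt 𝓘(ℝ, E) x₀).symm (extChartAt 𝓘(ℝ, E) x₀ x₀) R C g)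
    (hR : Metric.ball (extChartAt 𝓘(ℝ, E) x₀ x₀) R ⊆ (extChartAt 𝓘(ℝ, E) x₀).target)
    {α β : ℝ} (hαβ : α ≤ β)
    (hγ_lim : ∀ t ∈ Icc α β, Tendsto (fun k => γk k t) atTop (𝓝 (γ t)))
    (hγU : MapsTo γ (Icc α β) ((extChartAt 𝓘(ℝ, E) x₀).source ∩
      extChartAt 𝓘(ℝ, E) x₀ ⁻¹' Metric.ball (extChartAt 𝓘(ℝ, E) x₀ x₀) (R / 16)))
    (hγkU : ∀ k, MapsTo (γk k) (Icc α β) ((extChartAt 𝓘(ℝ, E) x₀).source ∩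
      extChartAt 𝓘(ℝ, E) x₀ ⁻¹' Metric.ball (extChartAt 𝓘(ℝ, E) x₀ x₀) (R / 16)))
    {N : ℝ} (hN : ∀ k, ∀ z ∈ Metric.closedBall (extChartAt 𝓘(ℝ, E) x₀ x₀) (R / 16) ×ˢ
      Metric.closedBall (0 : E →L[ℝ] ℝ) (semiconcaveLip θ R C A + 1), |Hk k (cotPoint x₀ z)| ≤ N) :
    (∃ K : ℝ≥0, LipschitzOnWith K γ (Icc α β)) ∧
    ∃ G : ℕ → ℝ → ENNReal, (∀ k, AEMeasurable (G k) (volume.restrict (Ioc α β))) ∧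
      Tendsto (fun k => ∫⁻ t in Ioc α β, G k t) atTop (𝓝 0) ∧
      ∀ σ : ℕ → ℕ, Tendsto σ atTop atTop →
        (∀ᵐ t, t ∈ Icc α β → Tendsto (fun i => G (σ i) t) atTop (𝓝 0)) →
        ∀ᵐ t, t ∈ Icc α β → HasMFDerivAt 𝓘(ℝ, ℝ) 𝓘(ℝ, E) γ t
            (ContinuousLinearMap.toSpanSingleton ℝ (fiberDeriv H (γ t) (minEnergy φ H (γ t)))) ∧
          Tendsto (fun i => (⟨γk (σ i) t,
            minEnergy (φk (σ i)) (Hk (σ i)) (γk (σ i) t)⟩ : CotBundle E M))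
            atTop (𝓝 ⟨γ t, minEnergy φ H (γ t)⟩) := by
  have hR0 := h.pos_radius
  have hR16 : R / 16 ≤ R := by linarith
  set ψ := extChartAt 𝓘(ℝ, E) x₀ with hψ
  set a₀ := ψ x₀ with ha₀
  set L := semiconcaveLip θ R C A with hL
  set U := Metric.ball a₀ (R / 16) with hU
  set S : (M → ℝ) → E → Set (E →L[ℝ] ℝ) := fun φ a =>
    uniformSuper (superModulus θ R C A) a₀ (R / 16) (φ ∘ ψ.symm) a with hS
  have hUR : U ⊆ Metric.ball a₀ R := Metric.ball_subset_ball hR16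
  have hUt : U ⊆ ψ.target := hUR.trans hR
  have hN0 : 0 ≤ N := (abs_nonneg _).trans (hN 0 (a₀, 0) ⟨Metric.mem_closedBall_self (by positivity),
    Metric.mem_closedBall_self (by have := h.semiconcaveLip_nonneg (θ := θ) hA; positivity)⟩)
  set uk : ℕ → ℝ → E := fun k => ψ ∘ γk k with huk_def
  set u : ℝ → E := ψ ∘ γ with hu_def
  have hukU : ∀ k, MapsTo (uk k) (Icc α β) U := fun k t ht => (hγkU k ht).2
  have huU : MapsTo u (Icc α β) U := fun t ht => (hγU ht).2
  have hXuk : ∀ k, ∀ t ∈ Icc α β, ψ.symm (uk k t) = γk k t := fun k t ht =>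
    ψ.left_inv (hγkU k ht).1
  have hXu : ∀ t ∈ Icc α β, ψ.symm (u t) = γ t := fun t ht => ψ.left_inv (hγU ht).1
  have hspeck := fun k t (ht : t ∈ Icc α β) =>
    (hHk k).chartMinEnergy_spec h hR hθ (hφk k) (hAk k) (hukU k ht)
  have hspec := fun t (ht : t ∈ Icc α β) => hH.chartMinEnergy_spec h hR hθ hφ hA (huU ht)
  have hSL : ∀ k, ∀ a ∈ U, ∀ P ∈ S (φk k) a, ‖P‖ ≤ L := fun k a ha P hP =>
    h.norm_le_semiconcaveLip hθ (hφk k) (hAk k) ha (h.frechetSuper_of_uniformSuper hθ ha hP)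
  have hdu : ∀ k, ∀ᵐ t, t ∈ Icc α β → HasDerivAt (uk k) (coordFiberDeriv x₀ (Hk k) (uk k t)
      (chartMinEnergy x₀ (φk k) (Hk k) (uk k t))) t := by
    intro k
    filter_upwards [(hγk k).ae_hasDerivAt_extChartAt x₀] with t ht htI
    exact ht (hγkU k htI).1
  have hcoord : ∀ k, IsCoordHamiltonian U (fun a P => Hk k (cotPoint x₀ (a, P)))
      (coordFiberDeriv x₀ (Hk k)) := fun k => ((hHk k).isCoordHamiltonian x₀).mono hUt
  -- The supergradients are bounded by `L`, so a unit ball around them stays in the ball of radius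
  -- `L + 1` where `N` bounds `Hk`.
  have hspeed : ∀ k, ∀ t ∈ Icc α β, ‖coordFiberDeriv x₀ (Hk k) (uk k t)
      (chartMinEnergy x₀ (φk k) (Hk k) (uk k t))‖ ≤ 2 * N := by
    intro k t ht
    apply (hcoord k).norm_le_of_forall_le (hukU k ht)
    intro Q hQ
    refine hN k (uk k t, _) ⟨Metric.ball_subset_closedBall (hukU k ht), ?_⟩
    rw [mem_closedBall_zero_iff]
    exact (norm_add_le _ _).trans (add_le_add (hSL k _ (hukU k ht) _ (hspeck k t ht).1) hQ)
  set Λ : ℝ≥0 := (2 * N).toNNReal with hΛ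
  have hΛN : (Λ : ℝ) = 2 * N := Real.coe_toNNReal _ (by positivity)
  have huk : ∀ k, LipschitzOnWith Λ (uk k) (Icc α β) := by
    intro k
    have hmono : ∀ s ∈ Icc α β, ∀ t ∈ Icc α β, s ≤ t → ‖uk k t - uk k s‖ ≤ 2 * N * (t - s) := by
      intro s hs t ht hst
      have hsub : Icc s t ⊆ Icc α β := Icc_subset_Icc hs.1 ht.2
      apply AbsolutelyContinuousOnInterval.norm_sub_le hst
      · apply ((hγk k).absolutelyContinuous s t).comp_of_dist_le (K := C)
        intro p hp q hq
        rw [uIcc_of_le hst] at hp hq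
        have h1 := h.le_dist _ (hUR (hukU k (hsub hp))) _ (hUR (hukU k (hsub hq)))
        rw [hXuk k p (hsub hp), hXuk k q (hsub hq)] at h1
        rw [dist_eq_norm]
        exact h1
      · filter_upwards [hdu k] with p hp hpI
        exact ⟨_, hp (hsub hpI), hspeed k p (hsub hpI)⟩
    apply LipschitzOnWith.of_dist_le_mul
    intro s hs t ht
    rw [hΛN, dist_eq_norm, Real.dist_eq]
    rcases le_total s t with hst | hst
    · rw [norm_sub_rev, abs_sub_comm, abs_of_nonneg (sub_nonneg.2 hst)]
      exact hmono s hs t ht hst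
    · rw [abs_of_nonneg (sub_nonneg.2 hst)]
      exact hmono t ht s hs hst
  have hulim : ∀ t ∈ Icc α β, Tendsto (fun k => uk k t) atTop (𝓝 (u t)) := fun t ht =>
    (continuousAt_extChartAt' (hγU ht).1).tendsto.comp (hγ_lim t ht)
  have hu : LipschitzOnWith Λ u (Icc α β) := by
    apply LipschitzOnWith.of_dist_le_mul
    intro s hs t ht
    exact le_of_tendsto ((hulim s hs).dist (hulim t ht))
      (Eventually.of_forall fun k => (huk k).dist_le_mul s hs t ht)
  have hflim : ∀ t ∈ Icc α β, Tendsto (fun k => (φk k ∘ ψ.symm) (uk k t)) atTop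
      (𝓝 ((φ ∘ ψ.symm) (u t))) := fun t ht =>
    (hφ_lim.comp ψ.symm).tendsto_comp
      (h.continuousAt_of_isSemiconcave hθ hφ hA (huU ht)) (hulim t ht)
  have hlimH : ∀ σ : ℕ → ℕ, Tendsto σ atTop atTop → ∀ (zk : ℕ → E × (E →L[ℝ] ℝ))
      (z : E × (E →L[ℝ] ℝ)), z.1 ∈ U → Tendsto zk atTop (𝓝 z) →
      Tendsto (fun n => Hk (σ n) (cotPoint x₀ ((zk n).1, (zk n).2))) atTop
        (𝓝 (H (cotPoint x₀ (z.1, z.2)))) := fun σ hσ zk z hz hzk =>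
    tendsto_cotPoint_of_tendstoUniformlyOn hH hH_lim (hUt hz) hσ hzk
  have hSlim : ∀ σ : ℕ → ℕ, Tendsto σ atTop atTop → ∀ (ak : ℕ → E) (a : E)
      (Pk : ℕ → E →L[ℝ] ℝ) (P : E →L[ℝ] ℝ), a ∈ U → Tendsto ak atTop (𝓝 a) →
      Tendsto Pk atTop (𝓝 P) → (∀ n, Pk n ∈ S (φk (σ n)) (ak n)) → P ∈ S φ a := by
    intro σ hσ ak a Pk P ha hak hPk hmem
    exact h.uniformSuper_of_tendsto hθ hφ hA ha (l := atTop) (φk := fun n => φk (σ n))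
      (fun v hv => hσ.eventually (hφ_lim v hv)) hak hPk (Eventually.of_forall hmem)
  have hPk := fun k t ht => (hspeck k t ht).1
  obtain ⟨B, hBm, hBlim, hBle⟩ := exists_tendsto_lintegral_enorm (U := U)
    (Hk := fun k a P => Hk k (cotPoint x₀ (a, P))) (H := fun a P => H (cotPoint x₀ (a, P)))
    (Sk := fun k => S (φk k)) (S := S φ) (L := L) hlimH hSL hSlim hcoord
    (fk := fun k => φk k ∘ ψ.symm) (f := φ ∘ ψ.symm) (Lf := L.toNNReal)
    (fun k => h.lipschitzOnWith_of_isSemiconcave hθ (hφk k) (hAk k))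
    (h.lipschitzOnWith_of_isSemiconcave hθ hφ hA)
    (fun k a ha P hP => h.frechetSuper_of_uniformSuper hθ ha hP) hαβ huk hu hukU huU hulim hflim
    (Pk := fun k t => chartMinEnergy x₀ (φk k) (Hk k) (uk k t))
    (Q := fun t => chartMinEnergy x₀ φ H (u t)) hPk
    (fun t ht => h.norm_le_semiconcaveLip hθ hφ hA (huU ht)
      (h.frechetSuper_of_uniformSuper hθ (huU ht) (hspec t ht).1))
    (fun t ht => h.frechetSuper_of_uniformSuper hθ (huU ht) (hspec t ht).1)
    (hH.aestronglyMeasurable_chartMinEnergy h hR hθ hφ hA hu.continuousOn huU)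
    (fun t ht => (hspec t ht).2.1) hdu
  refine ⟨⟨C.toNNReal * Λ, ?_⟩, fun k t => ‖B k t‖ₑ, fun k => (hBm k).enorm, hBlim, ?_⟩
  · apply LipschitzOnWith.of_dist_le_mul
    intro s hs t ht
    have h1 := h.dist_le _ (hUR (huU hs)) _ (hUR (huU ht))
    rw [hXu s hs, hXu t ht] at h1
    have h2 := hu.dist_le_mul s hs t ht
    rw [dist_eq_norm] at h2
    have hC := h.const_pos
    rw [NNReal.coe_mul, Real.coe_toNNReal _ hC.le, mul_assoc]
    exact h1.trans (by gcongr)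
  · intro σ hσ hG
    have hPlim : ∀ᵐ t, t ∈ Icc α β →
        Tendsto (fun i => chartMinEnergy x₀ (φk (σ i)) (Hk (σ i)) (uk (σ i) t)) atTop
          (𝓝 (chartMinEnergy x₀ φ H (u t))) := by
      filter_upwards [hBle, hG] with t h1 h2 ht
      refine tendsto_of_sub_le (U := U)
        (Hk := fun k a P => Hk k (cotPoint x₀ (a, P))) (H := fun a P => H (cotPoint x₀ (a, P)))
        (Sk := fun k => S (φk k)) (S := S φ) (L := L) hlimH hSL hSlim (huU ht)
        (fun k => hukU k ht) (hulim t ht)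
        (Pk := fun k => chartMinEnergy x₀ (φk k) (Hk k) (uk k t)) (fun k => hPk k t ht)
        (fun P hP => (hspec t ht).2.2 P hP) hσ (δ := fun i => B (σ i) t) ?_
        (fun i => h1 ht (σ i))
      exact tendsto_zero_iff_enorm_tendsto_zero.2 (h2 ht)
    have hder := ae_hasDerivAt_of_tendsto_selection (U := U)
      (Hk := fun k a P => Hk k (cotPoint x₀ (a, P))) (H := fun a P => H (cotPoint x₀ (a, P)))
      (V := coordFiberDeriv x₀ H) hcoord hαβ huk hukU huU hulim
      (Pk := fun k t => chartMinEnergy x₀ (φk k) (Hk k) (uk k t))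
      (Q := fun t => chartMinEnergy x₀ φ H (u t)) hdu ((hH.isCoordHamiltonian x₀).mono hUt) hlimH
      hσ hPlim
    have hne : ∀ᵐ t : ℝ, t ≠ α ∧ t ≠ β := by
      rw [eventually_and]; exact ⟨Measure.ae_ne volume α, Measure.ae_ne volume β⟩
    filter_upwards [hPlim, hder, hne] with t h1 h2 ht htI
    have hmem := Icc_mem_nhds (lt_of_le_of_ne htI.1 ht.1.symm) (lt_of_le_of_ne htI.2 ht.2)
    constructor
    · apply HasDerivAt.hasMFDerivAt_of_extChartAt_comp (x₀ := x₀)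
      · filter_upwards [hmem] with s hs using (hγU hs).1
      · rw [← coordFiberDeriv_chartMinEnergy (hγU htI).1]
        exact h2 htI
    · rw [← cotPoint_chartMinEnergy (hγU htI).1]
      simp_rw [fun i => (cotPoint_chartMinEnergy (hγkU (σ i) htI).1 (φk (σ i)) (Hk (σ i))).symm]
      exact (continuousAt_cotPoint (hUt (huU htI))).tendsto.comp
        (((hulim t htI).comp hσ).prodMk_nhds (h1 htI))

end LocalLimit

/-! ### Localization around each time. -/

section GlobalLimit

variable {E : Type*} [NormedAddCommGroup E] [NormedSpace ℝ E] [FiniteDimensional ℝ E]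
    {M : Type*} [MetricSpace M] [CompactSpace M] [ChartedSpace E M] [IsManifold 𝓘(ℝ, E) ∞ M]
    [RiemannianBundle (fun x : M => TangentSpace 𝓘(ℝ, E) x)]
    [IsContMDiffRiemannianBundle 𝓘(ℝ, E) ∞ E (fun x : M => TangentSpace 𝓘(ℝ, E) x)]
    [IsRiemannianManifold 𝓘(ℝ, E) M]

theorem AbsolutelyContinuousOnInterval.continuousOn_of_pseudoMetricSpace {X : Type*}
    [PseudoMetricSpace X] {f : ℝ → X} {a b : ℝ} (hf : AbsolutelyContinuousOnInterval f a b) :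
    ContinuousOn f (uIcc a b) := by
  intro t ht
  have h1 : AbsolutelyContinuousOnInterval ((fun x => dist x (f t)) ∘ f) a b :=
    hf.comp_of_dist_le (K := 1) fun s _ s' _ => by
      rw [one_mul, Real.dist_eq]
      exact abs_dist_sub_le _ _ _
  have h2 := h1.continuousOn t ht
  rw [ContinuousWithinAt, Function.comp_apply, dist_self] at h2
  exact tendsto_iff_dist_tendsto_zero.2 h2

theorem TendstoUniformlyOn.eventually_mapsTo_of_isOpen {T X : Type*} [TopologicalSpace T]
    [PseudoMetricSpace X] {F : ℕ → T → X} {f : T → X} {K : Set T} {W : Set X}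
    (h : TendstoUniformlyOn F f atTop K) (hK : IsCompact K) (hf : ContinuousOn f K)
    (hW : IsOpen W) (hfW : MapsTo f K W) : ∀ᶠ k in atTop, MapsTo (F k) K W := by
  obtain ⟨δ, hδ, hsub⟩ := (hK.image_of_continuousOn hf).exists_thickening_subset_open hW
    hfW.image_subset
  filter_upwards [Metric.tendstoUniformlyOn_iff.1 h δ hδ] with k hk t ht
  exact hsub (Metric.mem_thickening_iff.2 ⟨f t, mem_image_of_mem f ht, by
    rw [dist_comm]; exact hk t ht⟩)

theorem exists_lintegral_tendsto_zero
    {θ : ℝ≥0 → ℝ≥0} (hθ : IsModulus θ)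
    {φk : ℕ → M → ℝ} {φ : M → ℝ} {Hk : ℕ → CotBundle E M → ℝ} {H : CotBundle E M → ℝ}
    {γk : ℕ → ℝ → M} {γ : ℝ → M}
    (hφk : ∀ k, IsSemiconcave θ (φk k)) (hφ : IsSemiconcave θ φ)
    (hHk : ∀ k, IsHamiltonian (Hk k)) (hH : IsHamiltonian H)
    (hγk : ∀ k, IsStrictSingularChar (φk k) (Hk k) (γk k))
    (hφ_lim : TendstoUniformly φk φ atTop)
    (hH_lim : ∀ K : Set (CotBundle E M), IsCompact K → TendstoUniformlyOn Hk H atTop K)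
    (hγ_lim : ∀ K : Set ℝ, IsCompact K → TendstoUniformlyOn γk γ atTop K) (t₀ : ℝ) :
    ∃ α β : ℝ, t₀ ∈ Ioo α β ∧ (∃ K : ℝ≥0, LipschitzOnWith K γ (Icc α β)) ∧
    ∃ G : ℕ → ℝ → ENNReal, (∀ k, AEMeasurable (G k) (volume.restrict (Ioc α β))) ∧
      Tendsto (fun k => ∫⁻ t in Ioc α β, G k t) atTop (𝓝 0) ∧
      ∀ σ : ℕ → ℕ, Tendsto σ atTop atTop →
        (∀ᵐ t, t ∈ Icc α β → Tendsto (fun i => G (σ i) t) atTop (𝓝 0)) →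
        ∀ᵐ t, t ∈ Icc α β → HasMFDerivAt 𝓘(ℝ, ℝ) 𝓘(ℝ, E) γ t
            (ContinuousLinearMap.toSpanSingleton ℝ (fiberDeriv H (γ t) (minEnergy φ H (γ t)))) ∧
          Tendsto (fun i => (⟨γk (σ i) t,
            minEnergy (φk (σ i)) (Hk (σ i)) (γk (σ i) t)⟩ : CotBundle E M))
            atTop (𝓝 ⟨γ t, minEnergy φ H (γ t)⟩) := by
  have hcontOn : ∀ a b : ℝ, a ≤ b → ContinuousOn γ (Icc a b) := by
    intro a b hab
    have h1 : ∀ k, ContinuousOn (γk k) (Icc a b) := fun k => by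
      have h2 := ((hγk k).absolutelyContinuous a b).continuousOn_of_pseudoMetricSpace
      rwa [uIcc_of_le hab] at h2
    exact (hγ_lim _ isCompact_Icc).continuousOn (Frequently.of_forall h1)
  have hcont : ContinuousAt γ t₀ :=
    (hcontOn (t₀ - 1) (t₀ + 1) (by linarith)).continuousAt
      (Icc_mem_nhds (by linarith) (by linarith))
  obtain ⟨A₀, hA₀⟩ := hφ.exists_abs_le (E := E) hθ
  set x₀ := γ t₀ with hx₀
  obtain ⟨R, C, g, h, hR⟩ := exists_isGeodesicChart (E := E) x₀
  have hR0 := h.pos_radius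
  set W : Set M := (extChartAt 𝓘(ℝ, E) x₀).source ∩
      extChartAt 𝓘(ℝ, E) x₀ ⁻¹' Metric.ball (extChartAt 𝓘(ℝ, E) x₀ x₀) (R / 16) with hW
  have hWo : IsOpen W := (continuousOn_extChartAt x₀).isOpen_inter_preimage
    (isOpen_extChartAt_source x₀) Metric.isOpen_ball
  have hxW : x₀ ∈ W := ⟨mem_extChartAt_source x₀, Metric.mem_ball_self (by positivity)⟩
  obtain ⟨r, hr, hrW⟩ := Metric.eventually_nhds_iff.1 (hcont.eventually (hWo.mem_nhds hxW))
  have hαβ : t₀ - r / 2 ≤ t₀ + r / 2 := by linarith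
  have hγW : MapsTo γ (Icc (t₀ - r / 2) (t₀ + r / 2)) W := fun t ht => hrW (by
    rw [Real.dist_eq, abs_lt]
    constructor <;> linarith [ht.1, ht.2])
  have hevW := (hγ_lim _ isCompact_Icc).eventually_mapsTo_of_isOpen isCompact_Icc
    (hcontOn _ _ hαβ) hWo hγW
  obtain ⟨N, hN⟩ := exists_eventually_abs_cotPoint_le hH hH_lim (x₀ := x₀)
    ((isCompact_closedBall (extChartAt 𝓘(ℝ, E) x₀ x₀) (R / 16)).prod
      (isCompact_closedBall (0 : E →L[ℝ] ℝ) (semiconcaveLip θ R C (A₀ + 1) + 1)))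
    fun z hz => hR (Metric.closedBall_subset_ball (by linarith) hz.1)
  have hevA : ∀ᶠ k in atTop, ∀ x, |φk k x| ≤ A₀ + 1 := by
    filter_upwards [Metric.tendstoUniformly_iff.1 hφ_lim 1 one_pos] with k hk x
    have h1 := hk x
    rw [dist_comm, Real.dist_eq] at h1
    linarith [abs_sub_abs_le_abs_sub (φk k x) (φ x), hA₀ x]
  -- The bounds hold only from an index `m` on, so the local result is applied to the sequence
  -- shifted by `m`, and the shift is undone through `k - m`; the truncated values for `k < m` do
  -- not affect limits.
  obtain ⟨m, hm⟩ := eventually_atTop.1 (hevW.and (hN.and hevA))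
  have hshift : Tendsto (fun k => k + m) atTop atTop := tendsto_add_atTop_nat m
  obtain ⟨hLip, G, hGm, hGlim, hG⟩ := exists_lintegral_tendsto_zero_of_isGeodesicChart hθ
    (φk := fun k => φk (k + m)) (Hk := fun k => Hk (k + m)) (γk := fun k => γk (k + m))
    (fun k => hφk _) hφ (fun k => hHk _) hH (fun k => hγk _)
    (fun v hv => hshift.eventually (hφ_lim v hv))
    (fun K hK v hv => hshift.eventually (hH_lim K hK v hv))
    (fun k x => (hm (k + m) (Nat.le_add_left m k)).2.2 x) (fun x => (hA₀ x).trans (by linarith))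
    h hR hαβ (fun t ht => ((hγ_lim _ isCompact_Icc).tendsto_at ht).comp hshift) hγW
    (fun k => (hm (k + m) (Nat.le_add_left m k)).1)
    (fun k z hz => (hm (k + m) (Nat.le_add_left m k)).2.1 z hz)
  have hsub := tendsto_sub_atTop_nat m
  refine ⟨t₀ - r / 2, t₀ + r / 2, ⟨by linarith, by linarith⟩, hLip, fun k => G (k - m),
    fun k => hGm _, hGlim.comp hsub, fun σ hσ hσG => ?_⟩
  filter_upwards [hG (fun i => σ i - m) (hsub.comp hσ) hσG] with t ht htI
  refine ⟨(ht htI).1, (ht htI).2.congr' ?_⟩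
  filter_upwards [hσ.eventually_ge_atTop m] with i hi
  rw [Nat.sub_add_cancel hi]

end GlobalLimit

theorem mainTheorem2
    {E : Type*} [NormedAddCommGroup E] [NormedSpace ℝ E] [FiniteDimensional ℝ E]
    {M : Type*} [MetricSpace M] [CompactSpace M] [ConnectedSpace M]
    [ChartedSpace E M] [IsManifold 𝓘(ℝ, E) ∞ M]
    [RiemannianBundle (fun x : M => TangentSpace 𝓘(ℝ, E) x)]
    [IsContMDiffRiemannianBundle 𝓘(ℝ, E) ∞ E (fun x : M => TangentSpace 𝓘(ℝ, E) x)]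
    [IsRiemannianManifold 𝓘(ℝ, E) M]
    (θ : ℝ≥0 → ℝ≥0) (hθ : IsModulus θ)
    (φk : ℕ → M → ℝ) (φ : M → ℝ)
    (Hk : ℕ → CotBundle E M → ℝ) (H : CotBundle E M → ℝ)
    (γk : ℕ → ℝ → M) (γ : ℝ → M)
    (hφk : ∀ k, IsSemiconcave θ (φk k))
    (hHk : ∀ k, IsHamiltonian (Hk k)) (hH : IsHamiltonian H)
    (hγk : ∀ k, IsStrictSingularChar (φk k) (Hk k) (γk k))
    (hφ_lim : TendstoUniformly φk φ atTop)
    (hH_lim : ∀ K : Set (CotBundle E M), IsCompact K → TendstoUniformlyOn Hk H atTop K)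
    (hγ_lim : ∀ K : Set ℝ, IsCompact K → TendstoUniformlyOn γk γ atTop K) :
    IsSemiconcave θ φ ∧ IsStrictSingularChar φ H γ ∧
      ∃ σ : ℕ → ℕ, StrictMono σ ∧ ∀ᵐ t : ℝ,
        Tendsto
          (fun i => (⟨γk (σ i) t, minEnergy (φk (σ i)) (Hk (σ i)) (γk (σ i) t)⟩ : CotBundle E M))
          atTop (𝓝 ⟨γ t, minEnergy φ H (γ t)⟩) := by
  have hφ := IsSemiconcave.of_tendstoUniformly hφk hφ_lim
  choose α β htI hLip G hGm hGlim hG using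
    exists_lintegral_tendsto_zero hθ hφk hφ hHk hH hγk hφ_lim hH_lim hγ_lim
  -- By the Lindelöf property countably many of the intervals cover the line, so one diagonal
  -- subsequence and one null set suffice.
  obtain ⟨s, hs, hcover⟩ := TopologicalSpace.countable_cover_nhds
    (f := fun t => Icc (α t) (β t)) fun t => Icc_mem_nhds (htI t).1 (htI t).2
  have hne : s.Nonempty := by
    by_contra hcon
    rw [not_nonempty_iff_eq_empty] at hcon
    simp only [hcon, biUnion_empty] at hcover
    exact empty_ne_univ hcover
  obtain ⟨τ, rfl⟩ := hs.exists_eq_range hne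
  obtain ⟨σ, hσ, hσG⟩ := exists_strictMono_ae_tendsto_zero
    (μ := fun n => volume.restrict (Ioc (α (τ n)) (β (τ n)))) (g := fun n => G (τ n))
    (fun n => hGm (τ n)) (fun n => hGlim (τ n))
  have hae := ae_all_iff.2 fun n => hG (τ n) σ hσ.tendsto_atTop (by
    have := hσG n
    rwa [Measure.restrict_congr_set Ioc_ae_eq_Icc, ae_restrict_iff' measurableSet_Icc] at this)
  have hall : ∀ᵐ t : ℝ, HasMFDerivAt 𝓘(ℝ, ℝ) 𝓘(ℝ, E) γ t
      (ContinuousLinearMap.toSpanSingleton ℝ (fiberDeriv H (γ t) (minEnergy φ H (γ t)))) ∧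
      Tendsto (fun i => (⟨γk (σ i) t,
        minEnergy (φk (σ i)) (Hk (σ i)) (γk (σ i) t)⟩ : CotBundle E M))
        atTop (𝓝 ⟨γ t, minEnergy φ H (γ t)⟩) := by
    filter_upwards [hae] with t ht
    have h1 : t ∈ ⋃ x ∈ range τ, Icc (α x) (β x) := hcover ▸ mem_univ t
    rw [biUnion_range, mem_iUnion] at h1
    obtain ⟨n, hn⟩ := h1
    exact ht n hn
  refine ⟨hφ, ⟨fun a b => ?_, hall.mono fun t ht => ht.1⟩, σ, hσ, hall.mono fun t ht => ht.2⟩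
  -- Absolute continuity of `γ` holds in the strong form of a Lipschitz bound on compact intervals,
  -- inherited from the common speed bounds.
  have hloc : LocallyLipschitzOn (uIcc a b) γ := fun t _ => by
    obtain ⟨K, hK⟩ := hLip t
    exact ⟨K, _, mem_nhdsWithin_of_mem_nhds (Icc_mem_nhds (htI t).1 (htI t).2), hK⟩
  obtain ⟨K, hK⟩ := hloc.exists_lipschitzOnWith_of_compact isCompact_uIcc
  exact hK.absolutelyContinuousOnInterval
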